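/- Let $s=1$ (defocusing case) or $s=-1$ (focusing case), and consider the equation $$W''(x)+W(x)-s|W(x)|^2W(x)=0,\qquad W:\mathbb R\to\mathbb C .$$ A \emph{family of small waves} on a disc $D_r=\{(a,b)\in\mathbb R^2: a^2+b^2<r^2\}$ consists of real functions $\ell_{a,b},k_{a,b}$, continuous in $(a,b)\in D_r$, and of functions $P_{a,b}(y)$, jointly continuous in $(a,b)\in D_r$ and $y\in\mathbb R$, such that $\ell_{0,0}=0$, $k_{0,0}=1$, $P_{0,0}=0$ and, for all $(a,b)\in D_r$: $P_{a,b}\in C^2(\mathbb R,\mathbb C)$, $P_{a,b}(y+\pi)=-P_{a,b}(y)$, the function $W(x)=e^{i\ell_{a,b}x}P_{a,b}(k_{a,b}x)$ solves the equation, and $$\frac1{2\pi}\int_0^{2\pi}P_{a,b}(y)e^{iy}\,dy=a,\qquad \frac1{2\pi}\int_0^{2\pi}P_{a,b}(y)e^{-iy}\,dy=b .$$ Put $p_{a,b}=\ell_{a,b}+k_{a,b}$ and $Q_{a,b}(z)=e^{-iz/2}P_{a,b}(z/2)=R_{a,b}(z)+iI_{a,b}(z)$, which is $2\pi$-periodic,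 and let $H_{a,b}$ be the operator $$H_{a,b}=\begin{pmatrix}-4k_{a,b}^2\partial_{zz}+(p_{a,b}^2-1)+s(3R_{a,b}^2+I_{a,b}^2) & 4p_{a,b}k_{a,b}\partial_z+2sR_{a,b}I_{a,b}\\ -4p_{a,b}k_{a,b}\partial_z+2sR_{a,b}I_{a,b} & -4k_{a,b}^2\partial_{zz}+(p_{a,b}^2-1)+s(R_{a,b}^2+3I_{a,b}^2)\end{pmatrix}$$ in $L^2_{\rm per}([0,2\pi],\mathbb C^2)$ with domain $H^2_{\rm per}([0,2\pi],\mathbb C^2)$. Then a family of small waves exists for some $r>0$. Moreover, for every such family there exist $\varepsilon_0\in(0,r)$, $C\in\mathbb R$ and real numbers $\lambda^{(2)}_{a,b},\lambda^{(3)}_{a,b}$ such that, for all $(a,b)$ with $\|(a,b)\|=(a^2+b^2)^{1/2}\le\varepsilon_0$, the operator $H_{a,b}$ is self-adjoint and $$\sigma(H_{a,b})=\{0,\lambda^{(2)}_{a,b},\lambda^{(3)}_{a,b}\}\cup\sigma_1(H_{a,b}),\qquad \sigma_1(H_{a,b})\subset[6,+\infty),\qquad \lambda^{(3)}_{a,b}<6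 .$$ Here $0$ counts as a double eigenvalue and $\lambda^{(2)}_{a,b},\lambda^{(3)}_{a,b}$ count as simple ones, multiplicities being added when these numbers coincide: for every real $\mu<6$, the dimension of $\ker(H_{a,b}-\mu)$ is the number of times that $\mu$ occurs in the list $0,0,\lambda^{(2)}_{a,b},\lambda^{(3)}_{a,b}$. Furthermore $$\lambda^{(2)}_{0,0}=\lambda^{(3)}_{0,0},\qquad \lambda^{(2)}_{a,b}<\lambda^{(3)}_{a,b}\ \text{ if }(a,b)\ne(0,0),\qquad \lambda^{(2)}_{a,b}<0<\lambda^{(3)}_{a,b}\ \text{ if }ab\neq0,$$ $$\bigl|\lambda^{(2)}_{a,b}\lambda^{(3)}_{a,b}+12a^2b^2\bigr|\le C\,a^2b^2(a^2+b^2).$$ -/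

import Mathlib

open MeasureTheory AddCircle
open scoped Real ContDiff

noncomputable section

namespace PeriodicNLS

instance fact_two_pi_pos : Fact (0 < 2 * π) := ⟨Real.two_pi_pos⟩

/-! ### The small periodic waves

The equation is `W'' + W - s |W|² W = 0`, with `s = 1` in the defocusing case and `s = -1` in the
focusing case. -/

/-- The open disc of radius `r` in the plane of parameters `q = (a, b)`. -/
def disc (r : ℝ) : Set (ℝ × ℝ) := {q | q.1 ^ 2 + q.2 ^ 2 < r ^ 2}

/-- The function `W(x) = e^{i ℓ x} P(k x)`. -/
def waveW (l k : ℝ) (P : ℝ → ℂ) (x : ℝ) : ℂ :=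
  Complex.exp (Complex.I * (l * x : ℝ)) * P (k * x)

/-- `(ℓ, k, P)` is the family of small waves `W_{a,b}(x) = e^{i ℓ_{a,b} x} P_{a,b}(k_{a,b} x)`,
parametrized by `(a, b)` in the disc of radius `r`, where `a` and `b` are the Fourier coefficients
of `P_{a,b}` at `e^{-iy}` and `e^{iy}`. The family issues from the zero solution, with `k = 1` and
`ℓ = 0` there, and is continuous in the parameters; the continuity is what selects `k` and `ℓ` at
the plane waves (`ab = 0`), where the solution `W` alone does not determine them both. -/
structure IsWaveFamily (s r : ℝ) (l k : ℝ × ℝ → ℝ) (P : ℝ × ℝ → ℝ → ℂ) : Prop where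
  continuousOn_l : ContinuousOn l (disc r)
  continuousOn_k : ContinuousOn k (disc r)
  continuousOn_P : ContinuousOn (fun x : (ℝ × ℝ) × ℝ => P x.1 x.2) (disc r ×ˢ Set.univ)
  l_zero : l 0 = 0
  k_zero : k 0 = 1
  P_zero : ∀ y, P 0 y = 0
  contDiff : ∀ q ∈ disc r, ContDiff ℝ 2 (P q)
  antiperiodic : ∀ q ∈ disc r, ∀ y, P q (y + π) = - P q y
  equation : ∀ q ∈ disc r, ∀ x,
    deriv (deriv (waveW (l q) (k q) (P q))) x + waveW (l q) (k q) (P q) x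
      - s * (‖waveW (l q) (k q) (P q) x‖ ^ 2 : ℝ) * waveW (l q) (k q) (P q) x = 0
  coeff_a : ∀ q ∈ disc r,
    (1 / (2 * π) : ℝ) * ∫ y in (0 : ℝ)..(2 * π), P q y * Complex.exp (Complex.I * y) = q.1
  coeff_b : ∀ q ∈ disc r,
    (1 / (2 * π) : ℝ) * ∫ y in (0 : ℝ)..(2 * π), P q y * Complex.exp (-(Complex.I * y)) = q.2

/-- The `2π`-periodic profile `Q(z) = e^{-iz/2} P(z/2)`. -/
def profileQ (P : ℝ → ℂ) (z : ℝ) : ℂ :=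
  Complex.exp (-(Complex.I * (z / 2 : ℝ))) * P (z / 2)

/-! ### The periodic Lebesgue and Sobolev spaces -/

/-- `L²_per([0,2π], ℂ)`, with the normalized measure `dz / 2π` on the circle. -/
abbrev L2per : Type := Lp ℂ 2 (haarAddCircle (T := 2 * π))

/-- `L²_per([0,2π], ℂ²)`, a complex Hilbert space. -/
abbrev L2per2 : Type := WithLp 2 (L2per × L2per)

/-- `v` is the weak derivative of `u`, tested against smooth periodic functions. -/
def IsWeakDeriv (u v : L2per) : Prop :=
  ∀ φ φ' : C(AddCircle (2 * π), ℂ), ContDiff ℝ ∞ (fun x : ℝ => φ x) →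
    (∀ x : ℝ, HasDerivAt (fun y : ℝ => φ y) (φ' x) x) →
    ∫ z, u z * φ' z ∂haarAddCircle = - ∫ z, v z * φ z ∂haarAddCircle

theorem integrable_mul_test (u : L2per) (φ : C(AddCircle (2 * π), ℂ)) :
    Integrable (fun z => u z * φ z) haarAddCircle := by
  have h1 : Integrable (fun z => u z) (haarAddCircle (T := 2 * π)) :=
    (Lp.memLp u).integrable (by norm_num)
  refine h1.mul_bdd (c := ‖φ‖) φ.continuous.aestronglyMeasurable ?_
  exact Filter.Eventually.of_forall fun z => φ.norm_coe_le_norm z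

theorem IsWeakDeriv.zero : IsWeakDeriv 0 0 := by
  intro φ φ' _ _
  have h (ψ : C(AddCircle (2 * π), ℂ)) :
      ∫ z, (0 : L2per) z * ψ z ∂haarAddCircle = 0 := by
    rw [integral_eq_zero_of_ae]
    filter_upwards [Lp.coeFn_zero ℂ 2 (haarAddCircle (T := 2 * π))] with z hz
    simp [hz]
  rw [h, h, neg_zero]

theorem IsWeakDeriv.add {u v u₁ v₁ : L2per} (h : IsWeakDeriv u v) (h₁ : IsWeakDeriv u₁ v₁) :
    IsWeakDeriv (u + u₁) (v + v₁) := by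
  intro φ φ' hs hd
  have key (f g : L2per) (ψ : C(AddCircle (2 * π), ℂ)) :
      ∫ z, (f + g : L2per) z * ψ z ∂haarAddCircle
        = ∫ z, f z * ψ z ∂haarAddCircle + ∫ z, g z * ψ z ∂haarAddCircle := by
    rw [← integral_add (integrable_mul_test f ψ) (integrable_mul_test g ψ)]
    refine integral_congr_ae ?_
    filter_upwards [Lp.coeFn_add f g] with z hz
    rw [hz, Pi.add_apply, add_mul]
  rw [key, key, h φ φ' hs hd, h₁ φ φ' hs hd]
  ring

theorem IsWeakDeriv.smul {u v : L2per} (c : ℂ) (h : IsWeakDeriv u v) :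
    IsWeakDeriv (c • u) (c • v) := by
  intro φ φ' hs hd
  have key (f : L2per) (ψ : C(AddCircle (2 * π), ℂ)) :
      ∫ z, (c • f : L2per) z * ψ z ∂haarAddCircle = c * ∫ z, f z * ψ z ∂haarAddCircle := by
    rw [← integral_const_mul]
    refine integral_congr_ae ?_
    filter_upwards [Lp.coeFn_smul c f] with z hz
    rw [hz, Pi.smul_apply, smul_eq_mul, mul_assoc]
  rw [key, key, h φ φ' hs hd]
  ring

/-- The weak derivative is unique. -/
theorem IsWeakDeriv.eq_zero {v : L2per} (h : IsWeakDeriv 0 v) : v = 0 := by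
  have hc (n : ℤ) : fourierCoeff v n = 0 := by
    have h2 := h (fourier (-n)) ((2 * π * Complex.I * (-n : ℤ) / (2 * π : ℝ)) • fourier (-n))
      (by
        have : (fun x : ℝ => fourier (T := 2 * π) (-n) (x : AddCircle (2 * π)))
            = fun x : ℝ => Complex.exp (2 * π * Complex.I * (-n : ℤ) * x / (2 * π : ℝ)) := by
          funext x
          exact fourier_coe_apply
        rw [this]
        have hx : ContDiff ℝ ∞ (fun x : ℝ => (x : ℂ)) := Complex.ofRealCLM.contDiff
        exact ((contDiff_const.mul hx).div_const _).cexp)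
      (fun x => by simpa using hasDerivAt_fourier (2 * π) (-n) x)
    have h0 (ψ : C(AddCircle (2 * π), ℂ)) :
        ∫ z, (0 : L2per) z * ψ z ∂haarAddCircle = 0 := by
      rw [integral_eq_zero_of_ae]
      filter_upwards [Lp.coeFn_zero ℂ 2 (haarAddCircle (T := 2 * π))] with z hz
      simp [hz]
    rw [h0] at h2
    rw [fourierCoeff]
    simp only [smul_eq_mul]
    rw [← neg_eq_zero, h2]
    congr 1
    exact integral_congr_ae (Filter.Eventually.of_forall fun z => mul_comm _ _)
  apply (fourierBasis (T := 2 * π)).repr.injective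
  ext n
  rw [fourierBasis_repr, hc, map_zero]
  rfl

/-! ### The operator `H` -/

/-- The graph of the matrix operator
```
( -4k²∂² + (p²-1) + s(3R²+I²)     4pk∂ + 2sRI                 )
( -4pk∂ + 2sRI                    -4k²∂² + (p²-1) + s(R²+3I²) )
```
with domain `H²_per([0,2π], ℂ²)`, where `Q = R + iI` is a `2π`-periodic function. Here `v` and `w`
are the first and second weak derivatives of the argument. -/
def hessianGraph (s k p : ℝ) (Q : ℝ → ℂ) : Submodule ℂ (L2per2 × L2per2) where
  carrier := {x | ∃ v w : L2per2,
    IsWeakDeriv x.1.fst v.fst ∧ IsWeakDeriv x.1.snd v.snd ∧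
    IsWeakDeriv v.fst w.fst ∧ IsWeakDeriv v.snd w.snd ∧
    (∀ᵐ z ∂(haarAddCircle (T := 2 * π)), ∀ R I : ℝ,
      R = (liftIoc (2 * π) 0 Q z).re → I = (liftIoc (2 * π) 0 Q z).im →
      x.2.fst z = -4 * k ^ 2 * w.fst z + ((p ^ 2 - 1) + s * (3 * R ^ 2 + I ^ 2)) * x.1.fst z
          + (4 * p * k * v.snd z + 2 * s * R * I * x.1.snd z) ∧
      x.2.snd z = (-4 * p * k * v.fst z + 2 * s * R * I * x.1.fst z)
          - 4 * k ^ 2 * w.snd z + ((p ^ 2 - 1) + s * (R ^ 2 + 3 * I ^ 2)) * x.1.snd z)}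
  zero_mem' := by
    refine ⟨0, 0, IsWeakDeriv.zero, IsWeakDeriv.zero, IsWeakDeriv.zero, IsWeakDeriv.zero, ?_⟩
    filter_upwards [Lp.coeFn_zero ℂ 2 (haarAddCircle (T := 2 * π))] with z hz R I _ _
    simp [hz]
  add_mem' := by
    rintro x y ⟨v, w, h1, h2, h3, h4, h5⟩ ⟨v', w', h1', h2', h3', h4', h5'⟩
    refine ⟨v + v', w + w', h1.add h1', h2.add h2', h3.add h3', h4.add h4', ?_⟩
    filter_upwards [h5, h5', Lp.coeFn_add x.1.fst y.1.fst, Lp.coeFn_add x.1.snd y.1.snd,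
      Lp.coeFn_add x.2.fst y.2.fst, Lp.coeFn_add x.2.snd y.2.snd,
      Lp.coeFn_add v.fst v'.fst, Lp.coeFn_add v.snd v'.snd,
      Lp.coeFn_add w.fst w'.fst, Lp.coeFn_add w.snd w'.snd]
      with z a5 a5' e1 e2 e3 e4 e5 e6 e7 e8 R I hR hI
    obtain ⟨b1, b2⟩ := a5 R I hR hI
    obtain ⟨b1', b2'⟩ := a5' R I hR hI
    simp only [Prod.fst_add, Prod.snd_add, WithLp.add_fst, WithLp.add_snd, e1, e2, e3, e4, e5, e6,
      e7, e8, Pi.add_apply, b1, b2, b1', b2']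
    constructor <;> ring
  smul_mem' := by
    rintro c x ⟨v, w, h1, h2, h3, h4, h5⟩
    refine ⟨c • v, c • w, h1.smul c, h2.smul c, h3.smul c, h4.smul c, ?_⟩
    filter_upwards [h5, Lp.coeFn_smul c x.1.fst, Lp.coeFn_smul c x.1.snd,
      Lp.coeFn_smul c x.2.fst, Lp.coeFn_smul c x.2.snd,
      Lp.coeFn_smul c v.fst, Lp.coeFn_smul c v.snd,
      Lp.coeFn_smul c w.fst, Lp.coeFn_smul c w.snd]
      with z a5 e1 e2 e3 e4 e5 e6 e7 e8 R I hR hI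
    obtain ⟨b1, b2⟩ := a5 R I hR hI
    simp only [Prod.smul_fst, Prod.smul_snd, WithLp.smul_fst, WithLp.smul_snd, e1, e2, e3, e4, e5,
      e6, e7, e8, Pi.smul_apply, smul_eq_mul, b1, b2]
    constructor <;> ring

/-- The graph is single-valued, so that it is the graph of `hessian` below. -/
theorem hessianGraph_functional (s k p : ℝ) (Q : ℝ → ℂ) (x : L2per2 × L2per2)
    (hx : x ∈ hessianGraph s k p Q) (h0 : x.1 = 0) : x.2 = 0 := by
  obtain ⟨v, w, h1, h2, h3, h4, h5⟩ := hx
  rw [h0] at h1 h2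
  have hv1 := IsWeakDeriv.eq_zero h1
  have hv2 := IsWeakDeriv.eq_zero h2
  rw [hv1] at h3
  rw [hv2] at h4
  have hw1 := IsWeakDeriv.eq_zero h3
  have hw2 := IsWeakDeriv.eq_zero h4
  have key : ∀ᵐ z ∂(haarAddCircle (T := 2 * π)), x.2.fst z = 0 ∧ x.2.snd z = 0 := by
    filter_upwards [h5, Lp.coeFn_zero ℂ 2 (haarAddCircle (T := 2 * π))] with z hz z0
    obtain ⟨b1, b2⟩ := hz _ _ rfl rfl
    rw [b1, b2]
    simp [h0, hv1, hv2, hw1, hw2, z0]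
  have e1 : x.2.fst = 0 := by
    apply Lp.ext
    filter_upwards [key, Lp.coeFn_zero ℂ 2 (haarAddCircle (T := 2 * π))] with z hz z0
    rw [hz.1, z0, Pi.zero_apply]
  have e2 : x.2.snd = 0 := by
    apply Lp.ext
    filter_upwards [key, Lp.coeFn_zero ℂ 2 (haarAddCircle (T := 2 * π))] with z hz z0
    rw [hz.2, z0, Pi.zero_apply]
  exact WithLp.ofLp_injective 2 (Prod.ext e1 e2)

/-- The unbounded operator with graph `hessianGraph`. -/
def hessian (s k p : ℝ) (Q : ℝ → ℂ) : L2per2 →ₗ.[ℂ] L2per2 :=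
  (hessianGraph s k p Q).toLinearPMap

/-- The operator `H_{a,b}` at the wave `(ℓ, k, P)`, where `p = ℓ + k` and `Q(z) = e^{-iz/2}P(z/2)`. -/
def waveHessian (s l k : ℝ) (P : ℝ → ℂ) : L2per2 →ₗ.[ℂ] L2per2 :=
  hessian s k (l + k) (profileQ P)

/-! ### Spectrum of an unbounded operator -/

/-- The resolvent set: the `μ` for which `A - μ` is a bijection of the domain onto the whole
space, with bounded inverse. -/
def resolventSet {E : Type*} [NormedAddCommGroup E] [NormedSpace ℂ E] (A : E →ₗ.[ℂ] E) : Set ℂ :=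
  {μ | ∃ S : E →L[ℂ] E,
    (∀ f : E, ∃ h : S f ∈ A.domain, A ⟨S f, h⟩ - μ • S f = f) ∧
    ∀ u : A.domain, S (A u - μ • (u : E)) = u}

/-- The spectrum. -/
def spectrum {E : Type*} [NormedAddCommGroup E] [NormedSpace ℂ E] (A : E →ₗ.[ℂ] E) : Set ℂ :=
  (resolventSet A)ᶜ

/-- The eigenspace `ker (A - μ)`. -/
def eigenspace {E : Type*} [NormedAddCommGroup E] [NormedSpace ℂ E] (A : E →ₗ.[ℂ] E) (μ : ℂ) :
    Submodule ℂ E :=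
  (LinearMap.ker (A.toFun - μ • A.domain.subtype)).map A.domain.subtype

end PeriodicNLS

end

/-! Put `p = k + ℓ` and `p' = k - ℓ`. Then `W(x) = e^{ipx} Q(2kx)`, and the mode `n` of `Q` has
frequency `p (n+1) + p' n` in `W`. For real Fourier coefficients `q` the equation becomes
`dispersion p p' n * q n = -s ∑ q u₁ q u₂ q (u₁+u₂-n)`. At zero amplitude the symbol is `4n(n+1)`:
it vanishes only at `n = -1` and `n = 0`, the modes that carry `a` and `b`, and is at least 8
elsewhere.

Existence. Write `a = amp A`, `b = amp B` and `q n = amp A^|n| B^|n+1| c n` with `c 0 = c (-1) = 1`.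
Every cubic product is divisible by the monomial of its output mode, so the amplitudes divide out
even on the axes. The equations at the two low modes give `p` and `p'`; the others are a contraction
for `c` in `ℓ¹`, continuous in `(A, B)` (`exists_scaledWave`).

Uniqueness (`IsWaveFamily.exists_eq`). For `ab ≠ 0`, two small solutions with the same amplitudes
agree by a contraction estimate in the sup norm. The wave numbers are controlled only up to factors
`1/|a|`, `1/|b|`, but the high modes of the constructed wave carry `|A||B|`, which pays for this.
Continuity of the family then gives agreement on the axes.

Spectrum. In the basis of vectors that correspond to `e^{inz}` and `i e^{inz}`, the operator is
`dispersion` on the diagonal plus a small bounded symmetric part, and since `q` is real the two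
sectors decouple. Each sector contributes a plane of low eigenvalues, and the quadratic form exceeds
6 on the orthogonal complement of the four-dimensional low space. In the imaginary sector the two
phase symmetries of the equation give exact kernel vectors; divided by an amplitude, these survive
on the axes and make 0 a double eigenvalue. In the real sector a perturbed invariant plane exists
(`exists_invariant_pair`), with matrix `N`. Pairing it with derivatives of the profile in `A` and
`B`, taken with `c`, `p`, `p'` frozen, gives `G N = R`, where `G` is close to the identity and `R`
is close to `s amp²` times the matrix with rows `(2A², 4AB)` and `(4AB, 2B²)`. Hence `det N ≈ -12
a²b²` and `tr N ≈ 2s(a²+b²)`. All errors of the determinant are kept relative to `a²b²`, so its sign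
is known for every `ab ≠ 0`; the trace separates the two eigenvalues on the axes. -/

noncomputable section

namespace PeriodicNLS

/-! ### Spectrum of a self-adjoint operator with finitely many low eigenvalues -/

section Spectral

set_option linter.unusedSectionVars false

open scoped ComplexConjugate

variable {E : Type*} [NormedAddCommGroup E] [InnerProductSpace ℂ E] [CompleteSpace E]
  {A : E →ₗ.[ℂ] E}

theorem graph_adjoint_eq (hA : IsSelfAdjoint A) : A.graph.adjoint = A.graph := by
  have h := LinearPMap.adjoint_graph_eq_graph_adjoint hA.dense_domain
  rw [LinearPMap.isSelfAdjoint_def.1 hA] at h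
  exact h.symm

theorem inner_graph_symm (hA : IsSelfAdjoint A) {x y x' y' : E} (h : (x, y) ∈ A.graph)
    (h' : (x', y') ∈ A.graph) : inner ℂ y x' = inner ℂ x y' := by
  rw [← graph_adjoint_eq hA, Submodule.mem_adjoint_iff] at h'
  exact sub_eq_zero.1 (h' x y h)

/-- A self-adjoint graph is its own adjoint, hence is cut out by continuous linear equations. -/
theorem isClosed_graph (hA : IsSelfAdjoint A) : IsClosed (A.graph : Set (E × E)) := by
  have : (A.graph : Set (E × E)) =
      ⋂ z : A.graph, {x : E × E | inner ℂ z.1.2 x.1 - inner ℂ z.1.1 x.2 = 0} := by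
    ext x
    simp only [Set.mem_iInter]
    rw [SetLike.mem_coe, ← graph_adjoint_eq hA, Submodule.mem_adjoint_iff]
    constructor
    · rintro h ⟨⟨a, b⟩, hz⟩
      rw [graph_adjoint_eq hA] at hz
      exact h a b hz
    · intro h a b hz
      exact h ⟨(a, b), by rw [graph_adjoint_eq hA]; exact hz⟩
  rw [this]
  refine isClosed_iInter fun z => isClosed_eq ?_ continuous_const
  fun_prop

/-- The lower bound makes `A - μ` injective with closed range. A vector orthogonal to the range lies
in the kernel of the adjoint `A - conj μ`, which `h'` excludes, so `A - μ` is onto. -/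
theorem mem_resolventSet_of_bounded_below (hA : IsSelfAdjoint A) {μ : ℂ} {C : ℝ}
    (h : ∀ x y, (x, y) ∈ A.graph → ‖x‖ ≤ C * ‖y - μ • x‖)
    (h' : ∀ x, (x, conj μ • x) ∈ A.graph → x = 0) : μ ∈ resolventSet A := by
  have : CompleteSpace A.graph := (isClosed_graph hA).completeSpace_coe
  -- On the graph, a Banach space for the product norm, `A - μ` becomes a bounded operator.
  let φ : A.graph →L[ℂ] E :=
    (ContinuousLinearMap.snd ℂ E E - μ • ContinuousLinearMap.fst ℂ E E).comp A.graph.subtypeL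
  have hφ (z : A.graph) : φ z = z.1.2 - μ • z.1.1 := rfl
  have hC (z : A.graph) : ‖z‖ ≤ (|C| + (1 + ‖μ‖ * |C|)) * ‖φ z‖ := by
    have h1 : ‖z.1.1‖ ≤ |C| * ‖φ z‖ :=
      (h z.1.1 z.1.2 z.2).trans (by rw [hφ]; gcongr; exact le_abs_self C)
    have h2 : ‖z.1.2‖ ≤ ‖φ z‖ + ‖μ‖ * ‖z.1.1‖ := by
      rw [← norm_smul]
      calc ‖z.1.2‖ = ‖φ z + μ • z.1.1‖ := by rw [hφ, sub_add_cancel]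
        _ ≤ _ := norm_add_le _ _
    have h3 : ‖z‖ ≤ ‖z.1.1‖ + ‖z.1.2‖ :=
      max_le (le_add_of_nonneg_right (norm_nonneg _)) (le_add_of_nonneg_left (norm_nonneg _))
    have h4 := mul_le_mul_of_nonneg_left h1 (norm_nonneg μ)
    linarith
  have hanti : AntilipschitzWith (Real.toNNReal (|C| + (1 + ‖μ‖ * |C|))) φ :=
    φ.antilipschitz_of_bound fun z => by
      rw [Real.coe_toNNReal _ (by positivity)]
      exact hC z
  have hclosed : IsClosed (LinearMap.range φ.toLinearMap : Set E) := by
    have h1 := hanti.isClosed_range φ.uniformContinuous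
    rw [LinearMap.coe_range]
    exact h1
  have hsurj : LinearMap.range φ.toLinearMap = ⊤ := by
    have := hclosed.completeSpace_coe
    rw [← Submodule.orthogonal_eq_bot_iff, Submodule.eq_bot_iff]
    intro z hz
    rw [Submodule.mem_orthogonal] at hz
    apply h'
    rw [← graph_adjoint_eq hA, Submodule.mem_adjoint_iff]
    intro a b hab
    have := hz _ ⟨⟨(a, b), hab⟩, rfl⟩
    change inner ℂ (b - μ • a) z = 0 at this
    rw [inner_sub_left, inner_smul_left] at this
    rw [inner_smul_right]
    exact this
  let e : A.graph ≃L[ℂ] E :=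
    ContinuousLinearEquiv.ofBijective φ (LinearMap.ker_eq_bot.2 hanti.injective) hsurj
  have he (z : A.graph) : e z = z.1.2 - μ • z.1.1 := rfl
  refine ⟨(ContinuousLinearMap.fst ℂ E E).comp (A.graph.subtypeL.comp e.symm.toContinuousLinearMap),
    fun f => ?_, fun u => ?_⟩
  · have hm := (e.symm f).2
    rw [LinearPMap.mem_graph_iff] at hm
    obtain ⟨y, hy1, hy2⟩ := hm
    have hy1' : ((ContinuousLinearMap.fst ℂ E E).comp
      (A.graph.subtypeL.comp e.symm.toContinuousLinearMap)) f = y := hy1.symm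
    refine ⟨hy1' ▸ y.2, ?_⟩
    have h5 := he (e.symm f)
    rw [e.apply_symm_apply, ← hy1, ← hy2] at h5
    conv_rhs => rw [h5]
    simp only [hy1']
  · have h5 := he ⟨((u : E), A u), A.mem_graph u⟩
    simp only at h5
    rw [← h5]
    simp

variable {κ : Type*} [Fintype κ] {y : κ → E} {lam : κ → ℝ}

theorem inner_eigenvector (hA : IsSelfAdjoint A) (hgr : ∀ i, (y i, (lam i : ℂ) • y i) ∈ A.graph)
    {u w : E} (h : (u, w) ∈ A.graph) (i : κ) : inner ℂ (y i) w = lam i * inner ℂ (y i) u := by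
  rw [← inner_graph_symm hA (hgr i) h, inner_smul_left, Complex.conj_ofReal]

theorem sub_proj_mem_graph (hgr : ∀ i, (y i, (lam i : ℂ) • y i) ∈ A.graph)
    {u w : E} (h : (u, w) ∈ A.graph) :
    (u - ∑ i, inner ℂ (y i) u • y i, w - ∑ i, inner ℂ (y i) u • (lam i : ℂ) • y i) ∈ A.graph := by
  have h1 : ∑ i, inner ℂ (y i) u • (y i, (lam i : ℂ) • y i) ∈ A.graph :=
    Submodule.sum_mem _ fun i _ => Submodule.smul_mem _ _ (hgr i)
  have h2 := Submodule.sub_mem _ h h1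
  convert h2 using 1
  ext <;> simp [Prod.fst_sum, Prod.snd_sum]

theorem inner_sub_proj (hy : Orthonormal ℂ y) (u : E) (i : κ) :
    inner ℂ (y i) (u - ∑ j, inner ℂ (y j) u • y j) = 0 := by
  rw [inner_sub_right, hy.inner_right_fintype, sub_self]

/-- Split `u` into its components along the eigenvectors and a remainder `v`. The equation divides
each component by `lam i - μ`, and the form bound controls `v` with the gap `M - μ`. -/
theorem norm_le_of_coercive (hA : IsSelfAdjoint A) (hy : Orthonormal ℂ y)
    (hgr : ∀ i, (y i, (lam i : ℂ) • y i) ∈ A.graph) {M : ℝ}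
    (hM : ∀ u w, (u, w) ∈ A.graph → (∀ i, inner ℂ (y i) u = 0) → M * ‖u‖ ^ 2 ≤ (inner ℂ u w).re)
    {μ : ℝ} (hμ : μ < M) (hne : ∀ i, lam i ≠ μ) {u w : E} (h : (u, w) ∈ A.graph) :
    ‖u‖ ≤ (∑ i, |lam i - μ|⁻¹ + (M - μ)⁻¹) * ‖w - (μ : ℂ) • u‖ := by
  set W := w - (μ : ℂ) • u with hW
  set v := u - ∑ i, inner ℂ (y i) u • y i with hv
  have hcoef (i : κ) : ‖inner ℂ (y i) u‖ ≤ |lam i - μ|⁻¹ * ‖W‖ := by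
    have h1 : inner ℂ (y i) W = ((lam i - μ : ℝ) : ℂ) * inner ℂ (y i) u := by
      rw [hW, inner_sub_right, inner_smul_right, inner_eigenvector hA hgr h]
      push_cast
      ring
    have h2 : ‖inner ℂ (y i) W‖ ≤ ‖W‖ := by
      simpa [hy.1 i] using norm_inner_le_norm (𝕜 := ℂ) (y i) W
    rw [h1, norm_mul, Complex.norm_real, Real.norm_eq_abs] at h2
    have h3 : 0 < |lam i - μ| := abs_pos.2 (sub_ne_zero.2 (hne i))
    rw [inv_mul_eq_div, le_div_iff₀ h3]
    linarith
  have hvperp := inner_sub_proj hy u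
  rw [← hv] at hvperp
  -- The eigenvector parts drop out because `v` is orthogonal to every `y i`.
  have hvs : inner ℂ v (w - ∑ i, inner ℂ (y i) u • (lam i : ℂ) • y i) = inner ℂ v w := by
    rw [inner_sub_right, inner_sum, Finset.sum_eq_zero, sub_zero]
    intro i _
    rw [inner_smul_right, inner_smul_right, inner_eq_zero_symm.1 (hvperp i), mul_zero, mul_zero]
  have hvu : inner ℂ v u = inner ℂ v v := by
    have : u = v + ∑ i, inner ℂ (y i) u • y i := by rw [hv, sub_add_cancel]
    conv_lhs => rw [this]
    rw [inner_add_right, inner_sum, Finset.sum_eq_zero, add_zero]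
    intro i _
    rw [inner_smul_right, inner_eq_zero_symm.1 (hvperp i), mul_zero]
  have hco := hM _ _ (sub_proj_mem_graph hgr h) hvperp
  rw [← hv, hvs] at hco
  have hvW : (inner ℂ v W).re = (inner ℂ v w).re - μ * ‖v‖ ^ 2 := by
    rw [hW, inner_sub_right, inner_smul_right, hvu, inner_self_eq_norm_sq_to_K]
    simp [← Complex.ofReal_pow]
  have hb : (M - μ) * ‖v‖ ^ 2 ≤ ‖v‖ * ‖W‖ := by
    have := (Complex.re_le_norm _).trans (norm_inner_le_norm (𝕜 := ℂ) v W)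
    linarith
  have hvb : ‖v‖ ≤ (M - μ)⁻¹ * ‖W‖ := by
    have hp : 0 < M - μ := sub_pos.2 hμ
    rcases (norm_nonneg v).eq_or_lt with h0 | h0
    · rw [← h0]; positivity
    · rw [inv_mul_eq_div, le_div_iff₀ hp]
      nlinarith
  calc ‖u‖ = ‖∑ i, inner ℂ (y i) u • y i + v‖ := by rw [hv, add_sub_cancel]
    _ ≤ ‖∑ i, inner ℂ (y i) u • y i‖ + ‖v‖ := norm_add_le _ _
    _ ≤ ∑ i, |lam i - μ|⁻¹ * ‖W‖ + (M - μ)⁻¹ * ‖W‖ := by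
      refine add_le_add ((norm_sum_le _ _).trans (Finset.sum_le_sum fun i _ => ?_)) hvb
      rw [norm_smul, hy.1 i, mul_one]
      exact hcoef i
    _ = _ := by rw [← Finset.sum_mul, add_mul]

theorem mem_spectrum_of_mem_graph {μ : ℂ} {u : E} (hu : u ≠ 0) (h : (u, μ • u) ∈ A.graph) :
    μ ∈ PeriodicNLS.spectrum A := by
  rintro ⟨S, -, hS⟩
  rw [LinearPMap.mem_graph_iff] at h
  obtain ⟨v, hv1, hv2⟩ := h
  simp only at hv1 hv2
  have := hS v
  rw [hv2, hv1, sub_self, map_zero] at this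
  exact hu this.symm

/-- The form of `A` is real, so the imaginary part of `⟨u, (A - μ)u⟩` is `-Im μ ‖u‖²`. -/
theorem norm_le_of_im_ne_zero (hA : IsSelfAdjoint A) {μ : ℂ} (hμ : μ.im ≠ 0) {u w : E}
    (h : (u, w) ∈ A.graph) : ‖u‖ ≤ |μ.im|⁻¹ * ‖w - μ • u‖ := by
  have h1 : (inner ℂ u w).im = 0 := by
    have h2 := inner_graph_symm hA h h
    rw [← inner_conj_symm] at h2
    have := congrArg Complex.im h2
    rw [Complex.conj_im] at this
    linarith
  have h3 : (inner ℂ u (w - μ • u)).im = -(μ.im * ‖u‖ ^ 2) := by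
    rw [inner_sub_right, inner_smul_right, inner_self_eq_norm_sq_to_K, Complex.sub_im, h1]
    simp [← Complex.ofReal_pow]
  have h4 := (Complex.abs_im_le_norm _).trans (norm_inner_le_norm (𝕜 := ℂ) u (w - μ • u))
  rw [h3, abs_neg, abs_mul, abs_of_nonneg (sq_nonneg ‖u‖)] at h4
  have hp : 0 < |μ.im| := abs_pos.2 hμ
  rcases (norm_nonneg u).eq_or_lt with h0 | h0
  · rw [← h0]; positivity
  · rw [inv_mul_eq_div, le_div_iff₀ hp]
    nlinarith

/-- If finitely many eigenvectors are split off and the quadratic form is at least `M` on the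
orthogonal complement, the spectrum consists of the eigenvalues and a part above `M`. -/
theorem exists_spectrum_eq (hA : IsSelfAdjoint A) (hy : Orthonormal ℂ y)
    (hgr : ∀ i, (y i, (lam i : ℂ) • y i) ∈ A.graph) {M : ℝ}
    (hM : ∀ u w, (u, w) ∈ A.graph → (∀ i, inner ℂ (y i) u = 0) → M * ‖u‖ ^ 2 ≤ (inner ℂ u w).re) :
    ∃ σ₁ : Set ℝ, σ₁ ⊆ Set.Ici M ∧
      PeriodicNLS.spectrum A = Complex.ofReal '' (Set.range lam ∪ σ₁) := by
  refine ⟨{t | M ≤ t ∧ (t : ℂ) ∈ PeriodicNLS.spectrum A}, fun t ht => ht.1, ?_⟩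
  ext μ
  constructor
  · intro hμ
    have him : μ.im = 0 := by
      by_contra him
      refine hμ (mem_resolventSet_of_bounded_below hA
        (fun u w h => norm_le_of_im_ne_zero hA him h) fun x hx => ?_)
      have := norm_le_of_im_ne_zero hA (μ := conj μ) (by simpa using him) hx
      simpa using this
    obtain ⟨t, rfl⟩ : ∃ t : ℝ, μ = t := ⟨μ.re, Complex.ext rfl (by simpa using him)⟩
    refine ⟨t, ?_, rfl⟩
    by_contra hcon
    simp only [Set.mem_union, Set.mem_range, not_or, not_exists] at hcon
    obtain ⟨h1, h2⟩ := hcon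
    have ht : t < M := by
      by_contra hle
      exact h2 ⟨not_lt.1 hle, hμ⟩
    refine hμ (mem_resolventSet_of_bounded_below hA
      (fun u w h => norm_le_of_coercive hA hy hgr hM ht h1 h) fun x hx => ?_)
    have := norm_le_of_coercive hA hy hgr hM ht h1 hx
    simpa using this
  · rintro ⟨t, ht | ht, rfl⟩
    · obtain ⟨i, rfl⟩ := ht
      exact mem_spectrum_of_mem_graph (hy.ne_zero i) (hgr i)
    · exact ht.2

theorem mem_eigenspace_iff {μ : ℂ} {u : E} : u ∈ eigenspace A μ ↔ (u, μ • u) ∈ A.graph := by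
  rw [eigenspace, Submodule.mem_map, LinearPMap.mem_graph_iff]
  constructor
  · rintro ⟨v, hv, rfl⟩
    refine ⟨v, rfl, ?_⟩
    rw [LinearMap.mem_ker, LinearMap.sub_apply, sub_eq_zero] at hv
    exact hv
  · rintro ⟨v, hv1, hv2⟩
    refine ⟨v, ?_, hv1⟩
    simp only at hv1 hv2
    rw [LinearMap.mem_ker, LinearMap.sub_apply, sub_eq_zero]
    rw [← hv1] at hv2
    exact hv2

/-- An eigenvector for `μ < M` has no component along `y i` when `lam i ≠ μ`. Its part orthogonal to
all the `y i` is again an eigenvector, and `M ‖v‖² ≤ μ ‖v‖²` forces it to vanish. -/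
theorem finrank_eigenspace (hA : IsSelfAdjoint A) (hy : Orthonormal ℂ y)
    (hgr : ∀ i, (y i, (lam i : ℂ) • y i) ∈ A.graph) {M : ℝ}
    (hM : ∀ u w, (u, w) ∈ A.graph → (∀ i, inner ℂ (y i) u = 0) → M * ‖u‖ ^ 2 ≤ (inner ℂ u w).re)
    {μ : ℝ} (hμ : μ < M) :
    Module.finrank ℂ (eigenspace A μ) = ∑ i, if μ = lam i then 1 else 0 := by
  classical
  have hspan : eigenspace A μ =
      Submodule.span ℂ (Set.range fun i : {i // μ = lam i} => y i) := by
    apply le_antisymm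
    · intro u hu
      rw [mem_eigenspace_iff] at hu
      have hz (i : κ) (hi : lam i ≠ μ) : inner ℂ (y i) u = 0 := by
        have h1 := inner_eigenvector hA hgr hu i
        rw [inner_smul_right] at h1
        have h2 : ((lam i : ℂ) - μ) * inner ℂ (y i) u = 0 := by rw [sub_mul, h1, sub_self]
        refine (mul_eq_zero.1 h2).resolve_left ?_
        exact sub_ne_zero.2 (by exact_mod_cast hi)
      have hg := sub_proj_mem_graph hgr hu
      have hsum : ∑ i, inner ℂ (y i) u • (lam i : ℂ) • y i
          = (μ : ℂ) • ∑ i, inner ℂ (y i) u • y i := by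
        rw [Finset.smul_sum]
        refine Finset.sum_congr rfl fun i _ => ?_
        by_cases hi : lam i = μ
        · rw [hi, smul_comm]
        · rw [hz i hi]; simp
      rw [hsum, ← smul_sub] at hg
      have hco := hM _ _ hg (inner_sub_proj hy u)
      set v := u - ∑ i, inner ℂ (y i) u • y i with hv
      rw [inner_smul_right, inner_self_eq_norm_sq_to_K] at hco
      simp only [← Complex.ofReal_pow, Complex.coe_algebraMap, ← Complex.ofReal_mul,
        Complex.ofReal_re] at hco
      have hv0 : v = 0 := by
        have : ‖v‖ ^ 2 ≤ 0 := by nlinarith [sq_nonneg ‖v‖]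
        rw [← norm_eq_zero]
        exact pow_eq_zero_iff two_ne_zero |>.1 (le_antisymm this (sq_nonneg _))
      have hu' : u = ∑ i, inner ℂ (y i) u • y i := sub_eq_zero.1 hv0
      rw [hu']
      refine Submodule.sum_mem _ fun i _ => ?_
      by_cases hi : lam i = μ
      · exact Submodule.smul_mem _ _ (Submodule.subset_span ⟨⟨i, hi.symm⟩, rfl⟩)
      · rw [hz i hi, zero_smul]
        exact Submodule.zero_mem _
    · rw [Submodule.span_le]
      rintro _ ⟨⟨i, hi⟩, rfl⟩
      rw [SetLike.mem_coe, mem_eigenspace_iff]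
      subst hi
      exact hgr i
  have hli : LinearIndependent ℂ fun i : {i // μ = lam i} => y i :=
    (hy.comp _ Subtype.val_injective).linearIndependent
  rw [hspan, finrank_span_eq_card hli, Fintype.card_subtype, Finset.card_filter]

end Spectral

end PeriodicNLS

end

noncomputable section

namespace PeriodicNLS

/-! ### Bounded perturbations of diagonal operators -/

/-- This serves twice: for the invariant planes and for the coefficients of the waves. -/
theorem exists_fixedPoint_of_norm_le {F : Type*} [NormedAddCommGroup F] [CompleteSpace F]
    {f : F → F} {ρ : ℝ} (hρ : 0 ≤ ρ) (hmaps : ∀ x, ‖x‖ ≤ ρ → ‖f x‖ ≤ ρ)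
    (hlip : ∀ x y, ‖x‖ ≤ ρ → ‖y‖ ≤ ρ → ‖f x - f y‖ ≤ 1 / 2 * ‖x - y‖) :
    ∃ x, ‖x‖ ≤ ρ ∧ f x = x := by
  have hm : Set.MapsTo f (Metric.closedBall 0 ρ) (Metric.closedBall 0 ρ) := by
    intro x hx
    rw [mem_closedBall_zero_iff] at hx ⊢
    exact hmaps x hx
  have hc : ContractingWith (1 / 2) (hm.restrict f _ _) := by
    refine ⟨by norm_num, LipschitzWith.of_dist_le_mul fun x y => ?_⟩
    rw [Subtype.dist_eq, Subtype.dist_eq, dist_eq_norm, dist_eq_norm]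
    have := hlip x y (mem_closedBall_zero_iff.1 x.2) (mem_closedBall_zero_iff.1 y.2)
    simpa using this
  obtain ⟨x, hx, hfx, -⟩ := hc.exists_fixedPoint' Metric.isClosed_closedBall.isComplete hm
    (x := 0) (by simpa using hρ) (edist_ne_top _ _)
  exact ⟨x, mem_closedBall_zero_iff.1 hx, hfx⟩

section Diagonal

set_option linter.unusedSectionVars false

variable {E : Type*} [NormedAddCommGroup E] [InnerProductSpace ℂ E]
  {ι : Type*}

/-- The graph of the operator `Λ + V`, with `Λ` diagonal in the Hilbert basis `b`. -/
def diagGraph (b : HilbertBasis ι ℂ E) (Λ : ι → ℝ) (V : E →L[ℂ] E) : Submodule ℂ (E × E) where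
  carrier := {x | ∀ i, inner ℂ (b i) (x.2 - V x.1) = Λ i * inner ℂ (b i) x.1}
  zero_mem' := by intro i; simp
  add_mem' := by
    intro x y hx hy i
    have h1 := hx i
    have h2 := hy i
    simp only [Prod.snd_add, Prod.fst_add, map_add, inner_add_right, inner_sub_right] at h1 h2 ⊢
    linear_combination h1 + h2
  smul_mem' := by
    intro c x hx i
    have h1 := hx i
    simp only [Prod.smul_snd, Prod.smul_fst, map_smul, inner_smul_right, inner_sub_right] at h1 ⊢
    linear_combination c * h1

variable {b : HilbertBasis ι ℂ E} {Λ : ι → ℝ} {V : E →L[ℂ] E}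

theorem mem_diagGraph {x y : E} : (x, y) ∈ diagGraph b Λ V ↔
    ∀ i, inner ℂ (b i) y = Λ i * inner ℂ (b i) x + inner ℂ (b i) (V x) := by
  refine forall_congr' fun i => ?_
  simp only [inner_sub_right, sub_eq_iff_eq_add]

theorem basis_mem_diagGraph (j : ι) : (b j, (Λ j : ℂ) • b j + V (b j)) ∈ diagGraph b Λ V := by
  classical
  rw [mem_diagGraph]
  intro i
  rw [inner_add_right, inner_smul_right, orthonormal_iff_ite.1 b.orthonormal]
  split_ifs with h
  · rw [h]
  · simp

variable [CompleteSpace E]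

/-- By Parseval, since the diagonal entries are real and `V` is symmetric. -/
theorem inner_eq_of_mem_diagGraph (hV : ∀ x y, inner ℂ (V x) y = inner ℂ x (V y)) {x y x' y' : E}
    (h : (x, y) ∈ diagGraph b Λ V) (h' : (x', y') ∈ diagGraph b Λ V) :
    inner ℂ y x' = inner ℂ x y' := by
  have h1 := b.hasSum_inner_mul_inner (y - V x) x'
  have h2 := b.hasSum_inner_mul_inner x (y' - V x')
  have h3 : (fun i => inner ℂ (y - V x) (b i) * inner ℂ (b i) x')
      = fun i => inner ℂ x (b i) * inner ℂ (b i) (y' - V x') := by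
    funext i
    rw [← inner_conj_symm, h i, h' i, map_mul, Complex.conj_ofReal, inner_conj_symm]
    ring
  rw [h3] at h1
  have h4 := h1.unique h2
  rw [inner_sub_left, inner_sub_right, hV] at h4
  linear_combination h4

/-- Testing the adjoint condition on the basis vectors alone, which lie in the domain, already gives
the coordinate equations that define the graph. So the adjoint is no larger than the operator. -/
theorem isSelfAdjoint_of_graph_eq {A : E →ₗ.[ℂ] E} (hV : ∀ x y, inner ℂ (V x) y = inner ℂ x (V y))
    (hA : A.graph = diagGraph b Λ V) : IsSelfAdjoint A := by
  have hd : Dense (A.domain : Set E) := by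
    refine Submodule.dense_iff_topologicalClosure_eq_top.2 ?_
    rw [eq_top_iff, ← b.dense_span]
    refine Submodule.topologicalClosure_mono (Submodule.span_le.2 ?_)
    rintro _ ⟨j, rfl⟩
    refine LinearPMap.mem_domain_of_mem_graph (y := (Λ j : ℂ) • b j + V (b j)) ?_
    rw [hA]
    exact basis_mem_diagGraph j
  rw [LinearPMap.isSelfAdjoint_def]
  apply LinearPMap.eq_of_eq_graph
  rw [LinearPMap.adjoint_graph_eq_graph_adjoint hd, hA]
  ext ⟨x, y⟩
  rw [Submodule.mem_adjoint_iff]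
  constructor
  · intro h
    rw [mem_diagGraph]
    intro i
    have h1 := h _ _ (basis_mem_diagGraph (b := b) (Λ := Λ) (V := V) i)
    rw [inner_add_left, inner_smul_left, Complex.conj_ofReal, hV] at h1
    linear_combination -h1
  · intro h a c hac
    rw [sub_eq_zero]
    exact inner_eq_of_mem_diagGraph hV hac h

/-- The quadratic form of `Λ + V` is at least `6` on vectors that are orthogonal to small
perturbations of at most four basis vectors, if `Λ` is at least `15 / 2` at the others. -/
theorem six_le_of_orthogonal (hVn : ‖V‖ ≤ 1 / 100) (J : Finset ι) (hJ : J.card ≤ 4)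
    (hΛJ : ∀ i ∈ J, |Λ i| ≤ 1 / 10) (hΛ : ∀ i ∉ J, 15 / 2 ≤ Λ i) {x : ι → E}
    (hx : ∀ i ∈ J, ‖x i - b i‖ ≤ 1 / 10) {u w : E} (h : (u, w) ∈ diagGraph b Λ V)
    (hu : ∀ i ∈ J, inner ℂ (x i) u = 0) : 6 * ‖u‖ ^ 2 ≤ (inner ℂ u w).re := by
  classical
  set f : ι → ℝ := fun i => ‖inner ℂ (b i) u‖ ^ 2 with hf
  have hmul (i : ι) : inner ℂ u (b i) * inner ℂ (b i) u = (f i : ℂ) := by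
    rw [← inner_conj_symm, RCLike.conj_mul, hf]
    simp
  have hsum : HasSum f (‖u‖ ^ 2) := by
    have h1 := b.hasSum_inner_mul_inner u u
    simp_rw [hmul] at h1
    rw [inner_self_eq_norm_sq_to_K] at h1
    rw [← Complex.hasSum_ofReal]
    simpa using h1
  have hsumΛ : HasSum (fun i => Λ i * f i) (inner ℂ u (w - V u)).re := by
    have h1 := Complex.hasSum_re (b.hasSum_inner_mul_inner u (w - V u))
    refine h1.congr_fun fun i => ?_
    rw [h i, ← mul_assoc, mul_comm _ (Λ i : ℂ), mul_assoc, hmul, ← Complex.ofReal_mul,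
      Complex.ofReal_re]
  have hsmall : ∀ i ∈ J, f i ≤ 1 / 100 * ‖u‖ ^ 2 := by
    intro i hi
    -- Orthogonality to `x i` transfers the pairing to the small vector `x i - b i`.
    have h1 : inner ℂ (b i) u = -inner ℂ (x i - b i) u := by
      rw [inner_sub_left, hu i hi]; ring
    have h2 : ‖inner ℂ (b i) u‖ ≤ 1 / 10 * ‖u‖ := by
      rw [h1, norm_neg]
      exact (norm_inner_le_norm _ _).trans (by gcongr; exact hx i hi)
    calc f i ≤ (1 / 10 * ‖u‖) ^ 2 := pow_le_pow_left₀ (norm_nonneg _) h2 2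
      _ = _ := by ring
  -- On `J` the entry is at least `-1/10`, so pretending that it is `15/2` costs `76/10`, which 8
  -- covers.
  have hlow : 15 / 2 * ‖u‖ ^ 2 - ∑ i ∈ J, 8 * f i ≤ (inner ℂ u (w - V u)).re := by
    have h1 : HasSum (fun i => 15 / 2 * f i - if i ∈ J then 8 * f i else 0)
        (15 / 2 * ‖u‖ ^ 2 - ∑ i ∈ J, 8 * f i) := by
      refine (hsum.mul_left _).sub ?_
      have : HasSum (fun i => if i ∈ J then 8 * f i else 0)
          (∑ i ∈ J, if i ∈ J then 8 * f i else 0) :=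
        hasSum_sum_of_ne_finset_zero fun i hi => if_neg hi
      rwa [Finset.sum_congr rfl (fun i hi => if_pos hi)] at this
    refine hasSum_le (fun i => ?_) h1 hsumΛ
    have hfi : 0 ≤ f i := sq_nonneg _
    by_cases hi : i ∈ J
    · rw [if_pos hi]
      have := (abs_le.1 (hΛJ i hi)).1
      nlinarith
    · rw [if_neg hi, sub_zero]
      exact mul_le_mul_of_nonneg_right (hΛ i hi) hfi
  have hJs : ∑ i ∈ J, 8 * f i ≤ 32 / 100 * ‖u‖ ^ 2 := by
    calc ∑ i ∈ J, 8 * f i ≤ ∑ i ∈ J, 8 / 100 * ‖u‖ ^ 2 :=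
          Finset.sum_le_sum fun i hi => by linarith [hsmall i hi]
      _ = (J.card : ℝ) * (8 / 100 * ‖u‖ ^ 2) := by rw [Finset.sum_const, nsmul_eq_mul]
      _ ≤ 4 * (8 / 100 * ‖u‖ ^ 2) := by
        gcongr
        exact_mod_cast hJ
      _ = _ := by ring
  have hVu : -(1 / 100 * ‖u‖ ^ 2) ≤ (inner ℂ u (V u)).re := by
    have h1 : ‖inner ℂ u (V u)‖ ≤ 1 / 100 * ‖u‖ ^ 2 := by
      calc ‖inner ℂ u (V u)‖ ≤ ‖u‖ * ‖V u‖ := norm_inner_le_norm _ _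
        _ ≤ ‖u‖ * (1 / 100 * ‖u‖) := by
          gcongr
          exact V.le_of_opNorm_le hVn u
        _ = _ := by ring
    have h2 := (Complex.abs_re_le_norm _).trans h1
    exact (abs_le.1 h2).1
  rw [inner_sub_right, Complex.sub_re] at hlow
  -- The balance is `15/2 - 32/100 - 1/100`, which exceeds 6.
  nlinarith [sq_nonneg ‖u‖]

/-- The diagonal operator with bounded entries `κ` in the Hilbert basis `b`. -/
theorem exists_diagonal (b : HilbertBasis ι ℂ E) (κ : ι → ℂ) {C : ℝ} (hC : 0 ≤ C)
    (hκ : ∀ i, ‖κ i‖ ≤ C) :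
    ∃ K : E →L[ℂ] E, ‖K‖ ≤ C ∧ ∀ x i, inner ℂ (b i) (K x) = κ i * inner ℂ (b i) x := by
  have hmem (x : E) : Memℓp (fun i => κ i * b.repr x i) 2 := by
    refine Memℓp.mono' ((lp.memℓp (b.repr x)).const_mul (C : ℂ)) fun i => ?_
    rw [norm_mul, norm_mul, Complex.norm_real, Real.norm_of_nonneg hC]
    gcongr
    exact hκ i
  let K₀ : E →ₗ[ℂ] E :=
    { toFun := fun x => b.repr.symm (⟨fun i => κ i * b.repr x i, hmem x⟩ : lp (fun _ : ι => ℂ) 2)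
      map_add' := fun x y => by
        rw [← map_add]
        congr 1
        ext i
        simp only [map_add, lp.coeFn_add, Pi.add_apply, mul_add]
      map_smul' := fun c x => by
        rw [RingHom.id_apply, ← map_smul]
        congr 1
        ext i
        simp
        ring }
  have hK₀ (x : E) (i : ι) : b.repr (K₀ x) i = κ i * b.repr x i := by
    simp [K₀]
  have hbound (x : E) : ‖K₀ x‖ ≤ C * ‖x‖ := by
    rw [← b.repr.norm_map (K₀ x), ← b.repr.norm_map x]
    have h1 : ‖b.repr (K₀ x)‖ ≤ ‖(C : ℂ) • b.repr x‖ := by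
      refine lp.norm_mono (by norm_num) fun i => ?_
      rw [hK₀, lp.coeFn_smul, Pi.smul_apply, norm_mul, norm_smul, Complex.norm_real,
        Real.norm_of_nonneg hC]
      gcongr
      exact hκ i
    rwa [norm_smul, Complex.norm_real, Real.norm_of_nonneg hC] at h1
  refine ⟨K₀.mkContinuous C hbound, LinearMap.mkContinuous_norm_le _ hC _, fun x i => ?_⟩
  rw [← b.repr_apply_apply, ← b.repr_apply_apply]
  exact hK₀ x i

/-- `V` is symmetric and has no entries between `S` and its complement, so it preserves the closed
span of the block. -/
theorem inner_eq_zero_of_forall_mem {S : Set ι}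
    (hV : ∀ x y, inner ℂ (V x) y = inner ℂ x (V y))
    (hVS : ∀ i ∉ S, ∀ j ∈ S, inner ℂ (b i) (V (b j)) = 0) {x : E}
    (hx : ∀ i ∉ S, inner ℂ (b i) x = 0) {i : ι} (hi : i ∉ S) : inner ℂ (b i) (V x) = 0 := by
  rw [← hV, ← b.tsum_inner_mul_inner]
  refine (tsum_congr fun j => ?_).trans tsum_zero
  by_cases hj : j ∈ S
  · rw [hV, hVS i hi j hj, zero_mul]
  · rw [hx j hj, mul_zero]

theorem ext_inner_basis (b : HilbertBasis ι ℂ E) {x y : E}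
    (h : ∀ i, inner ℂ (b i) x = inner ℂ (b i) y) : x = y := by
  apply b.repr.injective
  ext i
  rw [b.repr_apply_apply, b.repr_apply_apply, h i]

/-- A pair of basis vectors whose diagonal entries are small, while the others in the block `S` are
large, is deformed by the perturbation `V` into a basis of an invariant plane. -/
theorem exists_invariant_pair {S : Set ι} (hV : ∀ x y, inner ℂ (V x) y = inner ℂ x (V y))
    (hVS : ∀ i ∉ S, ∀ j ∈ S, inner ℂ (b i) (V (b j)) = 0) (hVn : ‖V‖ ≤ 1 / 100)
    {j : Fin 2 → ι} (hj : Function.Injective j) (hjS : ∀ k, j k ∈ S)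
    (hΛj : ∀ k, |Λ (j k)| ≤ 1 / 10) (hΛ : ∀ i ∈ S, (∀ k, i ≠ j k) → 7 ≤ Λ i) :
    ∃ (x : Fin 2 → E) (N : Matrix (Fin 2) (Fin 2) ℂ), (∀ k, ‖x k - b (j k)‖ ≤ ‖V‖) ∧
      (∀ i k, inner ℂ (b (j i)) (x k) = if i = k then 1 else 0) ∧
      (∀ i ∉ S, ∀ k, inner ℂ (b i) (x k) = 0) ∧
      ∀ k, (x k, ∑ i, N i k • x i) ∈ diagGraph b Λ V := by
  classical
  -- `K` inverts `Λ` on the block off the pair and is zero elsewhere; entries of size at least 7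
  -- give norm at most `1/7`.
  obtain ⟨K, hKn, hK⟩ := exists_diagonal b
    (fun i => if i ∈ S ∧ ∀ k, i ≠ j k then ((Λ i)⁻¹ : ℂ) else 0) (C := 1 / 7) (by norm_num) (by
      intro i
      split_ifs with h
      · have h7 := hΛ i h.1 h.2
        rw [norm_inv, Complex.norm_real, Real.norm_of_nonneg (by linarith), one_div]
        exact inv_anti₀ (by norm_num) h7
      · simp)
  set v := ‖V‖ with hv
  have hv0 : 0 ≤ v := norm_nonneg V
  -- If the correction `ξ` has no component on the pair, the coordinates of the invariance equation
  -- along the pair force this matrix.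
  let N : (Fin 2 → E) → Matrix (Fin 2) (Fin 2) ℂ := fun ξ i k =>
    (if i = k then (Λ (j i) : ℂ) else 0) + inner ℂ (b (j i)) (V (b (j k) + ξ k))
  -- The remaining coordinates read `Λ ξ k = ∑ N i k ξ i - V (b (j k) + ξ k)`; applying `K` makes
  -- this a fixed-point problem on the ball of radius `‖V‖`.
  let Ψ : (Fin 2 → E) → (Fin 2 → E) := fun ξ k =>
    K (∑ i, N ξ i k • ξ i - V (b (j k) + ξ k))
  have hb1 (i : ι) : ‖b i‖ = 1 := b.orthonormal.1 i
  -- The budget is `1/10 + 2 · (1/100)(101/100) < 1/7`.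
  have hNb (ξ : Fin 2 → E) (hξ : ‖ξ‖ ≤ v) (k : Fin 2) : ‖N ξ 0 k‖ + ‖N ξ 1 k‖ ≤ 1 / 7 := by
    have h1 (i : Fin 2) : ‖inner ℂ (b (j i)) (V (b (j k) + ξ k))‖ ≤ v * (1 + v) := by
      calc _ ≤ ‖b (j i)‖ * ‖V (b (j k) + ξ k)‖ := norm_inner_le_norm _ _
        _ ≤ 1 * (v * (1 + v)) := by
          rw [hb1]
          gcongr
          refine (V.le_opNorm _).trans ?_
          gcongr
          refine (norm_add_le _ _).trans ?_
          rw [hb1]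
          gcongr
          exact (norm_le_pi_norm ξ k).trans hξ
        _ = _ := one_mul _
    have h2 (i : Fin 2) : ‖N ξ i k‖ ≤ (if i = k then 1 / 10 else 0) + v * (1 + v) := by
      refine (norm_add_le _ _).trans (add_le_add ?_ (h1 i))
      split_ifs
      · rw [Complex.norm_real]; exact hΛj i
      · simp
    have h3 := h2 0
    have h4 := h2 1
    have h5 : v * (1 + v) ≤ 1 / 100 * (1 + 1 / 100) := by gcongr
    fin_cases k <;> simp at h3 h4 ⊢ <;> linarith
  have hKle (x : E) : ‖K x‖ ≤ 1 / 7 * ‖x‖ := K.le_of_opNorm_le hKn x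
  obtain ⟨ξ, hξ, hfix⟩ := exists_fixedPoint_of_norm_le (f := Ψ) hv0 (by
    intro ξ hξ
    rw [pi_norm_le_iff_of_nonneg hv0]
    intro k
    have hk (i : Fin 2) := (norm_le_pi_norm ξ i).trans hξ
    have h1 : ‖∑ i, N ξ i k • ξ i‖ ≤ 1 / 7 * v := by
      rw [Fin.sum_univ_two]
      refine (norm_add_le _ _).trans ?_
      rw [norm_smul, norm_smul]
      have h2 := mul_le_mul_of_nonneg_left (hk 0) (norm_nonneg (N ξ 0 k))
      have h3 := mul_le_mul_of_nonneg_left (hk 1) (norm_nonneg (N ξ 1 k))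
      have h4 := mul_le_mul_of_nonneg_right (hNb ξ hξ k) hv0
      linarith
    have h2 : ‖V (b (j k) + ξ k)‖ ≤ v * 2 := by
      refine (V.le_opNorm _).trans ?_
      gcongr
      refine (norm_add_le _ _).trans ?_
      rw [hb1]
      linarith [hk k]
    calc ‖Ψ ξ k‖ ≤ 1 / 7 * ‖∑ i, N ξ i k • ξ i - V (b (j k) + ξ k)‖ := hKle _
      _ ≤ 1 / 7 * (1 / 7 * v + v * 2) := by
        gcongr
        exact (norm_sub_le _ _).trans (add_le_add h1 h2)
      _ ≤ v := by linarith) (by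
    intro ξ η hξ hη
    rw [pi_norm_le_iff_of_nonneg (by positivity)]
    intro k
    set d := ‖ξ - η‖ with hd
    have hd0 : 0 ≤ d := norm_nonneg _
    have hdk (i : Fin 2) : ‖ξ i - η i‖ ≤ d := norm_le_pi_norm (ξ - η) i
    have hk (i : Fin 2) := (norm_le_pi_norm η i).trans hη
    have hVd : ‖V (ξ k - η k)‖ ≤ v * d := (V.le_opNorm _).trans (by gcongr; exact hdk k)
    have hNd (i : Fin 2) : ‖N ξ i k - N η i k‖ ≤ v * d := by
      have h1 : N ξ i k - N η i k = inner ℂ (b (j i)) (V (ξ k - η k)) := by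
        simp only [N, map_add, map_sub, inner_add_right, inner_sub_right]
        ring
      rw [h1]
      refine (norm_inner_le_norm _ _).trans ?_
      rw [hb1, one_mul]
      exact hVd
    have hterm : Ψ ξ k - Ψ η k = K (∑ i, (N ξ i k • (ξ i - η i) + (N ξ i k - N η i k) • η i)
        - V (ξ k - η k)) := by
      simp only [Ψ]
      rw [← map_sub]
      congr 1
      simp only [Fin.sum_univ_two, map_add, map_sub, smul_sub, sub_smul]
      abel
    have h1 : ‖∑ i, (N ξ i k • (ξ i - η i) + (N ξ i k - N η i k) • η i)‖
        ≤ 1 / 7 * d + 2 * (v * d * v) := by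
      rw [Fin.sum_univ_two]
      have e1 : ‖N ξ 0 k • (ξ 0 - η 0) + (N ξ 0 k - N η 0 k) • η 0‖
          ≤ ‖N ξ 0 k‖ * d + v * d * v := by
        refine (norm_add_le _ _).trans ?_
        rw [norm_smul, norm_smul]
        gcongr
        exacts [hdk 0, hNd 0, hk 0]
      have e2 : ‖N ξ 1 k • (ξ 1 - η 1) + (N ξ 1 k - N η 1 k) • η 1‖
          ≤ ‖N ξ 1 k‖ * d + v * d * v := by
        refine (norm_add_le _ _).trans ?_
        rw [norm_smul, norm_smul]
        gcongr
        exacts [hdk 1, hNd 1, hk 1]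
      have e3 := mul_le_mul_of_nonneg_right (hNb ξ hξ k) hd0
      refine (norm_add_le _ _).trans ?_
      linarith
    rw [Pi.sub_apply, hterm]
    have h2 := (hKle (∑ i, (N ξ i k • (ξ i - η i) + (N ξ i k - N η i k) • η i)
        - V (ξ k - η k))).trans (mul_le_mul_of_nonneg_left
          ((norm_sub_le _ _).trans (add_le_add h1 hVd)) (by norm_num))
    have h3 : v * d ≤ 1 / 100 * d := by gcongr
    have h4 : v * d * v ≤ 1 / 100 * d * (1 / 100) := by gcongr
    linarith)
  have hcoord (i : ι) (k : Fin 2) : inner ℂ (b i) (ξ k)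
      = (if i ∈ S ∧ ∀ k, i ≠ j k then ((Λ i)⁻¹ : ℂ) else 0)
        * inner ℂ (b i) (∑ l, N ξ l k • ξ l - V (b (j k) + ξ k)) := by
    rw [← hK]
    exact congrArg (fun z => inner ℂ (b i) (z k)) hfix.symm
  -- The range of `K` has no component on the pair, so the ansatz behind `N` is consistent.
  have hjj (i k : Fin 2) : inner ℂ (b (j i)) (ξ k) = 0 := by
    rw [hcoord, if_neg, zero_mul]
    push Not
    exact fun _ => ⟨i, rfl⟩
  have hbb (i k : Fin 2) : inner ℂ (b (j i)) (b (j k)) = if i = k then (1 : ℂ) else 0 := by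
    rw [orthonormal_iff_ite.1 b.orthonormal]
    simp only [hj.eq_iff]
  have hout (i : ι) (hi : i ∉ S) (k : Fin 2) : inner ℂ (b i) (b (j k) + ξ k) = 0 := by
    rw [inner_add_right, hcoord, if_neg (fun h => hi h.1), zero_mul, add_zero]
    refine b.orthonormal.2 fun h => hi ?_
    rw [h]
    exact hjS k
  refine ⟨fun k => b (j k) + ξ k, N ξ, fun k => ?_, fun i k => ?_, hout, fun k => ?_⟩
  · rw [add_sub_cancel_left]
    exact (norm_le_pi_norm ξ k).trans hξ
  · rw [inner_add_right, hjj, add_zero, hbb]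
  · rw [mem_diagGraph]
    intro i
    by_cases hiS : i ∈ S
    · by_cases hik : ∀ k, i ≠ j k
      · have hbi (l : Fin 2) : inner ℂ (b i) (b (j l)) = (0 : ℂ) := b.orthonormal.2 (hik l)
        have h1 := hcoord i k
        rw [if_pos ⟨hiS, hik⟩] at h1
        have hne : (Λ i : ℂ) ≠ 0 := by
          have := hΛ i hiS hik
          exact_mod_cast (by linarith : (0 : ℝ) < Λ i).ne'
        rw [eq_inv_mul_iff_mul_eq₀ hne, inner_sub_right, inner_sum] at h1
        rw [inner_sum]
        simp only [inner_smul_right, inner_add_right, hbi, zero_add] at h1 ⊢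
        rw [h1]
        ring
      · push Not at hik
        obtain ⟨l, rfl⟩ := hik
        rw [inner_sum]
        simp only [inner_smul_right, inner_add_right, hjj, hbb, add_zero, N]
        simp only [mul_ite, mul_one, mul_zero, Finset.sum_ite_eq, Finset.mem_univ, if_true,
          map_add, inner_add_right]
    · rw [hout i hiS k, inner_eq_zero_of_forall_mem hV hVS (fun i hi => hout i hi k) hiS, inner_sum]
      simp only [inner_smul_right, hout i hiS]
      simp

/-- Symmetry moves the operator from the invariant plane to the trial vectors `w`. Thus `N` can be
estimated from the explicit images `r`, without knowing the plane beyond leading order. -/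
theorem gram_mul_eq (hV : ∀ x y, inner ℂ (V x) y = inner ℂ x (V y)) {x w r : Fin 2 → E}
    {N : Matrix (Fin 2) (Fin 2) ℂ}
    (hx : ∀ k, (x k, ∑ i, N i k • x i) ∈ diagGraph b Λ V)
    (hw : ∀ k, (w k, r k) ∈ diagGraph b Λ V) :
    Matrix.of (fun i k => inner ℂ (w i) (x k)) * N = Matrix.of fun i k => inner ℂ (r i) (x k) := by
  ext i k
  rw [Matrix.mul_apply, Matrix.of_apply, inner_eq_of_mem_diagGraph hV (hw i) (hx k), inner_sum]
  refine Finset.sum_congr rfl fun l _ => ?_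
  rw [inner_smul_right, Matrix.of_apply, mul_comm]

end Diagonal

/-! ### Diagonalization on an invariant plane. -/

section Plane

variable {E : Type*} [NormedAddCommGroup E] [InnerProductSpace ℂ E] [CompleteSpace E]

/-- A self-adjoint operator is diagonalized on an invariant plane. -/
theorem exists_eigenvectors_of_plane {A : E →ₗ.[ℂ] E} (hA : IsSelfAdjoint A) {x : Fin 2 → E}
    (hli : LinearIndependent ℂ x) {N : Matrix (Fin 2) (Fin 2) ℂ}
    (hx : ∀ k, (x k, ∑ i, N i k • x i) ∈ A.graph) :
    ∃ (y : Fin 2 → E) (lam : Fin 2 → ℝ), Orthonormal ℂ y ∧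
      (∀ k, (y k, (lam k : ℂ) • y k) ∈ A.graph) ∧
      Submodule.span ℂ (Set.range y) = Submodule.span ℂ (Set.range x) ∧ lam 1 ≤ lam 0 ∧
      (lam 0 : ℂ) * lam 1 = N.det ∧ (lam 0 : ℂ) + lam 1 = N.trace := by
  classical
  set U := Submodule.span ℂ (Set.range x) with hU
  let B := Module.Basis.span hli
  have hB (k : Fin 2) : (B k : E) = x k := by
    rw [Module.Basis.span_apply hli k]
  let T : U →ₗ[ℂ] U := Matrix.toLin B B N
  have hTB (k : Fin 2) : (T (B k) : E) = ∑ i, N i k • x i := by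
    simp only [T, Matrix.toLin_self]
    rw [Submodule.coe_sum]
    refine Finset.sum_congr rfl fun i _ => ?_
    rw [Submodule.coe_smul, hB]
  have hT (u : U) : ((u : E), (T u : E)) ∈ A.graph := by
    have h1 : u = ∑ k, B.repr u k • B k := (B.sum_repr u).symm
    have h2 : (u : E) = ∑ k, B.repr u k • (B k : E) := by
      conv_lhs => rw [h1]
      rw [Submodule.coe_sum]
      rfl
    have h3 : (T u : E) = ∑ k, B.repr u k • (T (B k) : E) := by
      conv_lhs => rw [h1]
      rw [map_sum, Submodule.coe_sum]
      refine Finset.sum_congr rfl fun k _ => ?_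
      rw [map_smul]
      rfl
    have h4 : ((u : E), (T u : E)) = ∑ k, B.repr u k • ((B k : E), (T (B k) : E)) := by
      refine Prod.ext ?_ ?_
      · rw [Prod.fst_sum]; exact h2
      · rw [Prod.snd_sum]; exact h3
    rw [h4]
    refine Submodule.sum_mem _ fun k _ => Submodule.smul_mem _ _ ?_
    rw [hTB, hB]
    exact hx k
  have hfin : FiniteDimensional ℂ U := B.finiteDimensional_of_finite
  have hsymm : T.IsSymmetric := fun u u' => inner_graph_symm hA (hT u) (hT u')
  have hn : Module.finrank ℂ U = 2 := by
    rw [Module.finrank_eq_card_basis B, Fintype.card_fin]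
  let e := hsymm.eigenvectorBasis hn
  refine ⟨fun k => e k, hsymm.eigenvalues hn, ?_, fun k => ?_, ?_, ?_, ?_, ?_⟩
  · exact e.orthonormal.comp_linearIsometry U.subtypeₗᵢ
  · have h1 := hT (e k)
    rw [hsymm.apply_eigenvectorBasis hn k] at h1
    exact h1
  · have h1 : Submodule.span ℂ (Set.range e) = ⊤ := by
      have := e.toBasis.span_eq
      rwa [e.coe_toBasis] at this
    have h2 : Set.range (fun k => (e k : E)) = U.subtype '' Set.range e := by
      rw [← Set.range_comp]; rfl
    rw [h2, Submodule.span_image, h1, Submodule.map_top, Submodule.range_subtype]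
  -- Eigenvalues are listed in decreasing order, so index 0 carries the larger one.
  · exact hsymm.eigenvalues_antitone hn (Fin.zero_le 1)
  · have h1 := hsymm.det_eq_prod_eigenvalues hn
    rw [Fin.prod_univ_two, LinearMap.det_toLin] at h1
    exact h1.symm
  · have h1 := hsymm.trace_eq_sum_eigenvalues (hn := hn)
    rw [Matrix.trace_toLin_eq] at h1
    rw [h1, Fin.sum_univ_two]
    simp

end Plane

end PeriodicNLS

end

noncomputable section

namespace PeriodicNLS

/-! ### Cubic convolution sums -/

section Triple

set_option linter.unusedSectionVars false

/-- The change of variables `(n₁, n₂, n) ↦ (n₁, n₂, n₁ + n₂ - n)`. -/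
def tripleEquiv : (ℤ × ℤ) × ℤ ≃ (ℤ × ℤ) × ℤ where
  toFun t := (t.1, t.1.1 + t.1.2 - t.2)
  invFun t := (t.1, t.1.1 + t.1.2 - t.2)
  left_inv t := by ext <;> simp
  right_inv t := by ext <;> simp

variable {R : Type*} [NormedCommRing R] [CompleteSpace R] {x y z : ℤ → R}

/-- The index `n₁ + n₂ - n` belongs to the conjugated factor of the cubic term, `n` being the output
mode. One bijection turns a plain triple product into all convolution sums at once. -/
theorem summable_norm_triple (hx : Summable fun n => ‖x n‖) (hy : Summable fun n => ‖y n‖)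
    (hz : Summable fun n => ‖z n‖) :
    Summable fun t : (ℤ × ℤ) × ℤ => ‖x t.1.1 * y t.1.2 * z (t.1.1 + t.1.2 - t.2)‖ := by
  have h1 : Summable fun t : (ℤ × ℤ) × ℤ => ‖x t.1.1 * y t.1.2 * z t.2‖ :=
    Summable.mul_norm (f := fun u : ℤ × ℤ => x u.1 * y u.2) (hx.mul_norm hy) hz
  have h2 := h1.comp_injective tripleEquiv.injective
  exact h2

theorem hasSum_triple (hx : Summable fun n => ‖x n‖) (hy : Summable fun n => ‖y n‖)
    (hz : Summable fun n => ‖z n‖) :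
    HasSum (fun t : (ℤ × ℤ) × ℤ => x t.1.1 * y t.1.2 * z (t.1.1 + t.1.2 - t.2))
      ((∑' n, x n) * (∑' n, y n) * ∑' n, z n) := by
  have h1 : HasSum (fun t : (ℤ × ℤ) × ℤ => x t.1.1 * y t.1.2 * z t.2)
      ((∑' n, x n) * (∑' n, y n) * ∑' n, z n) := by
    rw [tsum_mul_tsum_of_summable_norm hx hy, tsum_mul_tsum_of_summable_norm (hx.mul_norm hy) hz]
    exact ((hx.mul_norm hy).mul_norm hz).of_norm.hasSum
  have h2 := tripleEquiv.hasSum_iff.2 h1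
  exact h2

theorem summable_norm_triple_fiber (hx : Summable fun n => ‖x n‖) (hy : Summable fun n => ‖y n‖)
    (hz : Summable fun n => ‖z n‖) (n : ℤ) :
    Summable fun u : ℤ × ℤ => ‖x u.1 * y u.2 * z (u.1 + u.2 - n)‖ :=
  (summable_norm_triple hx hy hz).comp_injective (i := fun u : ℤ × ℤ => (u, n))
    fun _ _ h => (Prod.ext_iff.1 h).1

end Triple

/-- This is the `ℓ¹` convolution inequality: fibre sums over the output mode are dominated by the
total sum of `G`. -/
theorem summable_fiber_of_le {g G : (ℤ × ℤ) × ℤ → ℝ} (h : ∀ t, |g t| ≤ G t) (hG : Summable G) :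
    (Summable fun n => |∑' u, g (u, n)|) ∧ ∑' n, |∑' u, g (u, n)| ≤ ∑' t, G t := by
  have hG' : Summable (G ∘ Prod.swap : ℤ × (ℤ × ℤ) → ℝ) :=
    (Equiv.prodComm ℤ (ℤ × ℤ)).summable_iff.2 hG
  have hfib (n : ℤ) : Summable fun u => G (u, n) := hG'.prod_factor n
  have hb (n : ℤ) : |∑' u, g (u, n)| ≤ ∑' u, G (u, n) := by
    have h1 : Summable fun u => |g (u, n)| :=
      Summable.of_nonneg_of_le (fun _ => abs_nonneg _) (fun u => h (u, n)) (hfib n)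
    have h2 : ‖∑' u, g (u, n)‖ ≤ ∑' u, ‖g (u, n)‖ := norm_tsum_le_tsum_norm h1
    exact h2.trans (h1.tsum_le_tsum (fun u => h (u, n)) (hfib n))
  have hs : Summable fun n => ∑' u, G (u, n) := hG'.prod
  have hsum : Summable fun n => |∑' u, g (u, n)| :=
    Summable.of_nonneg_of_le (fun _ => abs_nonneg _) hb hs
  refine ⟨hsum, (hsum.tsum_le_tsum hb hs).trans ?_⟩
  have h3 : ∑' p : ℤ × (ℤ × ℤ), G p.swap = ∑' n, ∑' u, G (u, n) := hG'.tsum_prod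
  have h4 : ∑' p : ℤ × (ℤ × ℤ), G p.swap = ∑' t, G t :=
    (Equiv.prodComm ℤ (ℤ × ℤ)).tsum_eq G
  rw [← h3, h4]

/-! ### The space of summable coefficients and the cubic nonlinearity -/

/-- Real sequences indexed by `ℤ` with summable absolute values. -/
abbrev SeqSpace : Type := lp (fun _ : ℤ => ℝ) 1

theorem memSeq_iff {x : ℤ → ℝ} : Memℓp x 1 ↔ Summable fun n => |x n| := by
  rw [memℓp_gen_iff (by simp)]
  simp

theorem seq_summable (c : SeqSpace) : Summable fun n => |c n| := memSeq_iff.1 (lp.memℓp c)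

theorem seq_norm (c : SeqSpace) : ‖c‖ = ∑' n, |c n| := by
  rw [lp.norm_eq_tsum_rpow (by simp)]
  simp

theorem seq_abs_le (c : SeqSpace) (n : ℤ) : |c n| ≤ ‖c‖ :=
  lp.norm_apply_le_norm (by simp) c n

/-- The excess of powers of `a` in a cubic monomial with output frequency `n`. -/
def expA (u : ℤ × ℤ) (n : ℤ) : ℕ :=
  u.1.natAbs + u.2.natAbs + (u.1 + u.2 - n).natAbs - n.natAbs

/-- The excess of powers of `b` in a cubic monomial with output frequency `n`. -/
def expB (u : ℤ × ℤ) (n : ℤ) : ℕ :=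
  (u.1 + 1).natAbs + (u.2 + 1).natAbs + (u.1 + u.2 - n + 1).natAbs - (n + 1).natAbs

/-- The weight of a cubic monomial. -/
def wt (A B : ℝ) (u : ℤ × ℤ) (n : ℤ) : ℝ := A ^ expA u n * B ^ expB u n

/-- The closed square of scaled amplitudes. -/
def square : Set (ℝ × ℝ) := {q | |q.1| ≤ 1 ∧ |q.2| ≤ 1}

theorem abs_wt_le {A B : ℝ} (hA : |A| ≤ 1) (hB : |B| ≤ 1) (u : ℤ × ℤ) (n : ℤ) :
    |wt A B u n| ≤ 1 := by
  rw [wt, abs_mul, abs_pow, abs_pow]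
  exact mul_le_one₀ (pow_le_one₀ (abs_nonneg _) hA) (by positivity)
    (pow_le_one₀ (abs_nonneg _) hB)

theorem seq_triple_summable (x y z : SeqSpace) :
    Summable fun t : (ℤ × ℤ) × ℤ => |x t.1.1 * y t.1.2 * z (t.1.1 + t.1.2 - t.2)| := by
  simpa only [Real.norm_eq_abs] using
    summable_norm_triple (R := ℝ) (seq_summable x) (seq_summable y) (seq_summable z)

theorem seq_triple_tsum (x y z : SeqSpace) :
    ∑' t : (ℤ × ℤ) × ℤ, |x t.1.1 * y t.1.2 * z (t.1.1 + t.1.2 - t.2)| = ‖x‖ * ‖y‖ * ‖z‖ := by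
  have h1 (x : SeqSpace) : Summable fun n => ‖|x n|‖ := (seq_summable x).congr fun n => by simp
  have := (hasSum_triple (h1 x) (h1 y) (h1 z)).tsum_eq
  rw [seq_norm, seq_norm, seq_norm, ← this]
  exact tsum_congr fun t => by rw [abs_mul, abs_mul]

theorem summable_cubic {A B : ℝ} (hA : |A| ≤ 1) (hB : |B| ≤ 1) (c : SeqSpace) (n : ℤ) :
    Summable fun u : ℤ × ℤ => wt A B u n * (c u.1 * c u.2 * c (u.1 + u.2 - n)) := by
  have h1 := summable_norm_triple_fiber (R := ℝ) (seq_summable c) (seq_summable c)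
    (seq_summable c) n
  refine Summable.of_norm_bounded h1 fun u => ?_
  rw [norm_mul]
  exact mul_le_of_le_one_left (norm_nonneg _) (abs_wt_le hA hB u n)

open Classical in
/-- The weighted cubic convolution. -/
def cubic (A B : ℝ) (c : SeqSpace) : SeqSpace :=
  if h : |A| ≤ 1 ∧ |B| ≤ 1 then
    ⟨fun n => ∑' u : ℤ × ℤ, wt A B u n * (c u.1 * c u.2 * c (u.1 + u.2 - n)), by
      refine memSeq_iff.2 (summable_fiber_of_le (g := fun t => wt A B t.1 t.2 *
        (c t.1.1 * c t.1.2 * c (t.1.1 + t.1.2 - t.2))) (fun t => ?_) (seq_triple_summable c c c)).1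
      rw [abs_mul]
      exact mul_le_of_le_one_left (abs_nonneg _) (abs_wt_le h.1 h.2 _ _)⟩
  else 0

theorem cubic_apply {A B : ℝ} (hA : |A| ≤ 1) (hB : |B| ≤ 1) (c : SeqSpace) (n : ℤ) :
    cubic A B c n = ∑' u : ℤ × ℤ, wt A B u n * (c u.1 * c u.2 * c (u.1 + u.2 - n)) := by
  rw [cubic, dif_pos ⟨hA, hB⟩]

theorem norm_cubic_le {A B : ℝ} (hA : |A| ≤ 1) (hB : |B| ≤ 1) (c : SeqSpace) :
    ‖cubic A B c‖ ≤ ‖c‖ * ‖c‖ * ‖c‖ := by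
  rw [← seq_triple_tsum, seq_norm]
  simp_rw [cubic_apply hA hB]
  refine (summable_fiber_of_le (g := fun t => wt A B t.1 t.2 *
    (c t.1.1 * c t.1.2 * c (t.1.1 + t.1.2 - t.2))) (fun t => ?_) (seq_triple_summable c c c)).2
  rw [abs_mul]
  exact mul_le_of_le_one_left (abs_nonneg _) (abs_wt_le hA hB _ _)

/-- The difference of the two products is telescoped one factor at a time; each of the three pieces
costs `M²`. -/
theorem norm_cubic_sub_le {A B : ℝ} (hA : |A| ≤ 1) (hB : |B| ≤ 1) (c d : SeqSpace) {M : ℝ}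
    (hc : ‖c‖ ≤ M) (hd : ‖d‖ ≤ M) : ‖cubic A B c - cubic A B d‖ ≤ 3 * M ^ 2 * ‖c - d‖ := by
  have hM : 0 ≤ M := (norm_nonneg c).trans hc
  set G : (ℤ × ℤ) × ℤ → ℝ := fun t =>
    |(c - d) t.1.1 * c t.1.2 * c (t.1.1 + t.1.2 - t.2)|
    + |d t.1.1 * (c - d) t.1.2 * c (t.1.1 + t.1.2 - t.2)|
    + |d t.1.1 * d t.1.2 * (c - d) (t.1.1 + t.1.2 - t.2)| with hG
  have s1 := seq_triple_summable (c - d) c c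
  have s2 := seq_triple_summable d (c - d) c
  have s3 := seq_triple_summable d d (c - d)
  have hGs : Summable G := (s1.add s2).add s3
  have hGt : ∑' t, G t ≤ 3 * M ^ 2 * ‖c - d‖ := by
    rw [hG, (s1.add s2).tsum_add s3, s1.tsum_add s2, seq_triple_tsum, seq_triple_tsum,
      seq_triple_tsum]
    have h1 : ‖c - d‖ * ‖c‖ * ‖c‖ ≤ ‖c - d‖ * M * M := by gcongr
    have h2 : ‖d‖ * ‖c - d‖ * ‖c‖ ≤ M * ‖c - d‖ * M := by gcongr
    have h3 : ‖d‖ * ‖d‖ * ‖c - d‖ ≤ M * M * ‖c - d‖ := by gcongr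
    linarith
  rw [seq_norm]
  refine le_trans ?_ hGt
  have key (n : ℤ) : (cubic A B c - cubic A B d) n = ∑' u : ℤ × ℤ, wt A B u n *
      (c u.1 * c u.2 * c (u.1 + u.2 - n) - d u.1 * d u.2 * d (u.1 + u.2 - n)) := by
    rw [lp.coeFn_sub, Pi.sub_apply, cubic_apply hA hB, cubic_apply hA hB,
      ← (summable_cubic hA hB c n).tsum_sub (summable_cubic hA hB d n)]
    exact tsum_congr fun u => by ring
  simp_rw [key]
  refine (summable_fiber_of_le (g := fun t => wt A B t.1 t.2 *
    (c t.1.1 * c t.1.2 * c (t.1.1 + t.1.2 - t.2)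
      - d t.1.1 * d t.1.2 * d (t.1.1 + t.1.2 - t.2))) (fun t => ?_) hGs).2
  rw [abs_mul]
  refine (mul_le_of_le_one_left (abs_nonneg _) (abs_wt_le hA hB _ _)).trans ?_
  have : c t.1.1 * c t.1.2 * c (t.1.1 + t.1.2 - t.2) - d t.1.1 * d t.1.2 * d (t.1.1 + t.1.2 - t.2)
      = (c - d) t.1.1 * c t.1.2 * c (t.1.1 + t.1.2 - t.2)
        + d t.1.1 * (c - d) t.1.2 * c (t.1.1 + t.1.2 - t.2)
        + d t.1.1 * d t.1.2 * (c - d) (t.1.1 + t.1.2 - t.2) := by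
    simp only [lp.coeFn_sub, Pi.sub_apply]
    ring
  rw [this]
  exact (abs_add_le _ _).trans (add_le_add_left (abs_add_le _ _) _)

/-- Dominated convergence at a fixed `c`: the weights are polynomials in the amplitudes, bounded by
1 on the square. Joint continuity then follows from the Lipschitz bound in `c`. -/
theorem continuousOn_cubic (c : SeqSpace) :
    ContinuousOn (fun q : ℝ × ℝ => cubic q.1 q.2 c) square := by
  intro q₀ hq₀
  rw [ContinuousWithinAt, tendsto_iff_norm_sub_tendsto_zero]
  have hb : Filter.Tendsto (fun q : ℝ × ℝ => ∑' t : (ℤ × ℤ) × ℤ,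
      |wt q.1 q.2 t.1 t.2 - wt q₀.1 q₀.2 t.1 t.2|
        * |c t.1.1 * c t.1.2 * c (t.1.1 + t.1.2 - t.2)|) (nhdsWithin q₀ square) (nhds 0) := by
    rw [← tsum_zero (α := ℝ) (β := (ℤ × ℤ) × ℤ)]
    refine tendsto_tsum_of_dominated_convergence ((seq_triple_summable c c c).mul_left 2)
      (fun t => ?_) ?_
    · have : Continuous fun q : ℝ × ℝ => |wt q.1 q.2 t.1 t.2 - wt q₀.1 q₀.2 t.1 t.2|
        * |c t.1.1 * c t.1.2 * c (t.1.1 + t.1.2 - t.2)| := by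
        unfold wt
        fun_prop
      have h2 := (this.tendsto q₀).mono_left (nhdsWithin_le_nhds (s := square))
      simpa using h2
    · filter_upwards [self_mem_nhdsWithin] with q hq t
      rw [Real.norm_eq_abs, abs_mul, abs_abs, abs_abs]
      gcongr
      have h1 := abs_sub (wt q.1 q.2 t.1 t.2) (wt q₀.1 q₀.2 t.1 t.2)
      linarith [abs_wt_le hq.1 hq.2 t.1 t.2, abs_wt_le hq₀.1 hq₀.2 t.1 t.2]
  refine squeeze_zero' (Filter.Eventually.of_forall fun _ => norm_nonneg _) ?_ hb
  filter_upwards [self_mem_nhdsWithin] with q hq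
  rw [seq_norm]
  have key (n : ℤ) : (cubic q.1 q.2 c - cubic q₀.1 q₀.2 c) n = ∑' u : ℤ × ℤ,
      (wt q.1 q.2 u n - wt q₀.1 q₀.2 u n) * (c u.1 * c u.2 * c (u.1 + u.2 - n)) := by
    rw [lp.coeFn_sub, Pi.sub_apply, cubic_apply hq.1 hq.2, cubic_apply hq₀.1 hq₀.2,
      ← (summable_cubic hq.1 hq.2 c n).tsum_sub (summable_cubic hq₀.1 hq₀.2 c n)]
    exact tsum_congr fun u => by ring
  simp_rw [key]
  refine (summable_fiber_of_le (g := fun t => (wt q.1 q.2 t.1 t.2 - wt q₀.1 q₀.2 t.1 t.2) *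
    (c t.1.1 * c t.1.2 * c (t.1.1 + t.1.2 - t.2))) (fun t => (abs_mul _ _).le) ?_).2
  refine Summable.of_nonneg_of_le (fun _ => by positivity) (fun t => ?_)
    ((seq_triple_summable c c c).mul_left 2)
  gcongr
  have h1 := abs_sub (wt q.1 q.2 t.1 t.2) (wt q₀.1 q₀.2 t.1 t.2)
  linarith [abs_wt_le hq.1 hq.2 t.1 t.2, abs_wt_le hq₀.1 hq₀.2 t.1 t.2]

end PeriodicNLS

end

noncomputable section

namespace PeriodicNLS

/-! ### Construction of the small waves -/

/-- The symbol `(p (n + 1) + p' n)² - 1`, where `p = k + ℓ` and `p' = k - ℓ`. -/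
def dispersion (p p' : ℝ) (n : ℤ) : ℝ := (p * (n + 1) + p' * n) ^ 2 - 1

/-- At `p = p' = 1` the frequency is `2n + 1`, of modulus at least 3 here. A relative error of
`1/100` leaves `(297/100)² - 1 > 15/2`. The quadratic growth is what gains two derivatives later. -/
theorem dispersion_lower {p p' : ℝ} (hp : |p - 1| ≤ 1 / 100) (hp' : |p' - 1| ≤ 1 / 100) {n : ℤ}
    (h0 : n ≠ 0) (h1 : n ≠ -1) :
    15 / 2 ≤ dispersion p p' n ∧ (1 + |(n : ℝ)|) ^ 2 / 2 ≤ dispersion p p' n := by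
  obtain ⟨hp1, hp2⟩ := abs_le.1 hp
  obtain ⟨hp3, hp4⟩ := abs_le.1 hp'
  rw [dispersion]
  rcases lt_or_ge n 0 with hn | hn
  · have hn' : (n : ℝ) ≤ -2 := by exact_mod_cast (by omega : n ≤ -2)
    have hg : 99 / 100 * (-2 * (n : ℝ) - 1) ≤ -(p * (n + 1) + p' * n) := by nlinarith
    have hsq : (99 / 100 * (-2 * (n : ℝ) - 1)) ^ 2 ≤ (p * (n + 1) + p' * n) ^ 2 := by
      rw [← neg_sq (p * (n + 1) + p' * n)]
      exact pow_le_pow_left₀ (by linarith) hg 2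
    rw [abs_of_nonpos (by linarith)]
    constructor <;> nlinarith
  · have hn' : (1 : ℝ) ≤ n := by exact_mod_cast (by omega : 1 ≤ n)
    have hg : 99 / 100 * (2 * (n : ℝ) + 1) ≤ p * (n + 1) + p' * n := by nlinarith
    have hsq : (99 / 100 * (2 * (n : ℝ) + 1)) ^ 2 ≤ (p * (n + 1) + p' * n) ^ 2 :=
      pow_le_pow_left₀ (by linarith) hg 2
    rw [abs_of_nonneg (by linarith)]
    constructor <;> nlinarith

theorem abs_dispersion_sub_le {p p' r r' : ℝ} (hp : |p - 1| ≤ 1 / 100) (hp' : |p' - 1| ≤ 1 / 100)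
    (hr : |r - 1| ≤ 1 / 100) (hr' : |r' - 1| ≤ 1 / 100) (n : ℤ) :
    |dispersion p p' n - dispersion r r' n|
      ≤ 5 * (1 + |(n : ℝ)|) ^ 2 * (|p - r| + |p' - r'|) := by
  have hn1 : |(n : ℝ) + 1| ≤ 1 + |(n : ℝ)| := by
    rw [add_comm]; exact (abs_add_le _ _).trans (by simp)
  have hn2 : |(n : ℝ)| ≤ 1 + |(n : ℝ)| := by linarith
  have hle (t : ℝ) (ht : |t - 1| ≤ 1 / 100) : |t| ≤ 101 / 100 := by
    obtain ⟨h1, h2⟩ := abs_le.1 ht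
    rw [abs_le]; constructor <;> linarith
  have e : dispersion p p' n - dispersion r r' n
      = ((p - r) * (n + 1) + (p' - r') * n) * ((p + r) * (n + 1) + (p' + r') * n) := by
    simp only [dispersion]; ring
  have h1 : |(p - r) * (n + 1) + (p' - r') * n| ≤ (1 + |(n : ℝ)|) * (|p - r| + |p' - r'|) := by
    refine (abs_add_le _ _).trans ?_
    rw [abs_mul, abs_mul]
    have := mul_le_mul_of_nonneg_left hn1 (abs_nonneg (p - r))
    have := mul_le_mul_of_nonneg_left hn2 (abs_nonneg (p' - r'))
    linarith
  have h2 : |(p + r) * (n + 1) + (p' + r') * n| ≤ 5 * (1 + |(n : ℝ)|) := by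
    refine (abs_add_le _ _).trans ?_
    rw [abs_mul, abs_mul]
    have a1 : |p + r| ≤ 202 / 100 := (abs_add_le _ _).trans (by linarith [hle p hp, hle r hr])
    have a2 : |p' + r'| ≤ 202 / 100 := (abs_add_le _ _).trans (by linarith [hle p' hp', hle r' hr'])
    have := mul_le_mul a1 hn1 (abs_nonneg _) (by norm_num)
    have := mul_le_mul a2 hn2 (abs_nonneg _) (by norm_num)
    linarith [abs_nonneg (n : ℝ)]
  rw [e, abs_mul]
  calc _ ≤ ((1 + |(n : ℝ)|) * (|p - r| + |p' - r'|)) * (5 * (1 + |(n : ℝ)|)) := by gcongr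
    _ = _ := by ring

open Classical in
/-- The inverse of the symbol off the frequencies `0` and `-1`. -/
def invSymbol (p p' : ℝ) (n : ℤ) : ℝ :=
  if (|p - 1| ≤ 1 / 100 ∧ |p' - 1| ≤ 1 / 100) ∧ n ≠ 0 ∧ n ≠ -1 then (dispersion p p' n)⁻¹ else 0

theorem abs_invSymbol_le (p p' : ℝ) (n : ℤ) : |invSymbol p p' n| ≤ 2 / (1 + |(n : ℝ)|) ^ 2 := by
  rw [invSymbol]
  split_ifs with h
  · have h1 := (dispersion_lower h.1.1 h.1.2 h.2.1 h.2.2).2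
    have h2 : 0 < (1 + |(n : ℝ)|) ^ 2 / 2 := by positivity
    rw [abs_of_nonneg (by rw [inv_nonneg]; linarith)]
    calc _ ≤ ((1 + |(n : ℝ)|) ^ 2 / 2)⁻¹ := inv_anti₀ h2 h1
      _ = _ := by rw [inv_div]
  · rw [abs_zero]; positivity

theorem abs_invSymbol_le_one (p p' : ℝ) (n : ℤ) : |invSymbol p p' n| ≤ 1 := by
  rw [invSymbol]
  split_ifs with h
  · have h1 := (dispersion_lower h.1.1 h.1.2 h.2.1 h.2.2).1
    rw [abs_of_nonneg (by rw [inv_nonneg]; linarith)]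
    exact inv_le_one_of_one_le₀ (by linarith)
  · simp

/-- Two inverse symbols decay like `n⁻⁴` together, which beats the growth `n²` of the difference of
the symbols, so the estimate is uniform in `n`. -/
theorem abs_invSymbol_sub_le {p p' r r' : ℝ} (hp : |p - 1| ≤ 1 / 100) (hp' : |p' - 1| ≤ 1 / 100)
    (hr : |r - 1| ≤ 1 / 100) (hr' : |r' - 1| ≤ 1 / 100) (n : ℤ) :
    |invSymbol p p' n - invSymbol r r' n| ≤ 20 * (|p - r| + |p' - r'|) := by
  by_cases hn : n ≠ 0 ∧ n ≠ -1
  · have e1 : invSymbol p p' n = (dispersion p p' n)⁻¹ := if_pos ⟨⟨hp, hp'⟩, hn⟩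
    have e2 : invSymbol r r' n = (dispersion r r' n)⁻¹ := if_pos ⟨⟨hr, hr'⟩, hn⟩
    have d1 := (dispersion_lower hp hp' hn.1 hn.2).1
    have d2 := (dispersion_lower hr hr' hn.1 hn.2).1
    have h3 : invSymbol p p' n - invSymbol r r' n
        = invSymbol p p' n * invSymbol r r' n * (dispersion r r' n - dispersion p p' n) := by
      rw [e1, e2]; field_simp
    rw [h3, abs_mul, abs_mul]
    have h4 := abs_dispersion_sub_le hr hr' hp hp' n
    rw [abs_sub_comm r p, abs_sub_comm r' p'] at h4
    have h5 : |invSymbol p p' n| * |invSymbol r r' n|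
        ≤ 2 / (1 + |(n : ℝ)|) ^ 2 * (2 / (1 + |(n : ℝ)|) ^ 2) :=
      mul_le_mul (abs_invSymbol_le _ _ _) (abs_invSymbol_le _ _ _) (abs_nonneg _) (by positivity)
    have hN : 1 ≤ 1 + |(n : ℝ)| := by linarith [abs_nonneg (n : ℝ)]
    calc _ ≤ 2 / (1 + |(n : ℝ)|) ^ 2 * (2 / (1 + |(n : ℝ)|) ^ 2)
          * (5 * (1 + |(n : ℝ)|) ^ 2 * (|p - r| + |p' - r'|)) := by gcongr
      _ = 20 * (|p - r| + |p' - r'|) * (1 / (1 + |(n : ℝ)|) ^ 2) := by field_simp; ring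
      _ ≤ 20 * (|p - r| + |p' - r'|) * 1 := by
        gcongr
        rw [div_le_one (by positivity)]
        exact one_le_pow₀ hN
      _ = _ := mul_one _
  · have e1 : invSymbol p p' n = 0 := if_neg fun h => hn h.2
    have e2 : invSymbol r r' n = 0 := if_neg fun h => hn h.2
    rw [e1, e2, sub_zero, abs_zero]
    positivity

/-- The scale of the amplitudes. -/
def amp : ℝ := 1 / 100

/-- The wave number as a function of the cubic correction. -/
def root (s t : ℝ) : ℝ := √(1 - s * amp ^ 2 * t)

/-- The number 27 is `3³`, the bound of the cubic term for `‖c‖ ≤ 3`. -/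
theorem abs_correction_le {s t : ℝ} (hs : |s| = 1) (ht : |t| ≤ 27) :
    |s * amp ^ 2 * t| ≤ 27 / 10000 := by
  rw [abs_mul, abs_mul, hs, amp]
  norm_num
  linarith

theorem root_sq {s t : ℝ} (hs : |s| = 1) (ht : |t| ≤ 27) : root s t ^ 2 = 1 - s * amp ^ 2 * t := by
  have := (abs_le.1 (abs_correction_le hs ht)).2
  exact Real.sq_sqrt (by linarith)

theorem abs_root_sub_le {s t t' : ℝ} (hs : |s| = 1) (ht : |t| ≤ 27) (ht' : |t'| ≤ 27) :
    |root s t - root s t'| ≤ amp ^ 2 * |t - t'| := by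
  have h1 := abs_le.1 (abs_correction_le hs ht)
  have h2 := abs_le.1 (abs_correction_le hs ht')
  have half (y : ℝ) (hy : 1 / 4 ≤ y) : 1 / 2 ≤ √y := by
    apply Real.le_sqrt_of_sq_le
    linarith
  have a1 : 1 / 2 ≤ root s t := half _ (by linarith)
  have a2 : 1 / 2 ≤ root s t' := half _ (by linarith)
  have e : (root s t - root s t') * (root s t + root s t') = -(s * amp ^ 2 * (t - t')) := by
    have := root_sq hs ht
    have := root_sq hs ht'
    linear_combination root_sq hs ht - root_sq hs ht'
  have e2 : |root s t - root s t'| * (root s t + root s t') = amp ^ 2 * |t - t'| := by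
    rw [← abs_of_nonneg (by linarith : 0 ≤ root s t + root s t'), ← abs_mul, e, abs_neg, abs_mul,
      abs_mul, hs, abs_of_nonneg (sq_nonneg amp), one_mul]
  nlinarith [abs_nonneg (root s t - root s t')]

theorem abs_root_sub_one_le {s t : ℝ} (hs : |s| = 1) (ht : |t| ≤ 27) :
    |root s t - 1| ≤ 1 / 100 := by
  have h := abs_root_sub_le hs ht (t' := 0) (by norm_num)
  have h0 : root s 0 = 1 := by simp [root]
  rw [h0, sub_zero, amp] at h
  linarith

/-- The coefficients off the frequencies `0` and `-1`, as a function of the cubic term. -/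
def waveMap (s : ℝ) (x : SeqSpace) : SeqSpace :=
  ⟨fun n => -(s * amp ^ 2) * (invSymbol (root s (x 0)) (root s (x (-1))) n * x n), by
    refine Memℓp.const_mul (memSeq_iff.2 ?_) _
    refine Summable.of_nonneg_of_le (fun _ => abs_nonneg _) (fun n => ?_) (seq_summable x)
    rw [abs_mul]
    exact mul_le_of_le_one_left (abs_nonneg _) (abs_invSymbol_le_one _ _ _)⟩

theorem waveMap_apply (s : ℝ) (x : SeqSpace) (n : ℤ) : waveMap s x n
    = -(s * amp ^ 2) * (invSymbol (root s (x 0)) (root s (x (-1))) n * x n) := rfl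

theorem norm_waveMap_le {s : ℝ} (hs : |s| = 1) (x : SeqSpace) :
    ‖waveMap s x‖ ≤ amp ^ 2 * ‖x‖ := by
  rw [seq_norm, seq_norm, ← tsum_mul_left]
  refine (seq_summable _).tsum_le_tsum (fun n => ?_) ((seq_summable x).mul_left _)
  rw [waveMap_apply, abs_mul, abs_neg, abs_mul, hs, abs_of_nonneg (sq_nonneg amp), one_mul, abs_mul]
  gcongr
  exact mul_le_of_le_one_left (abs_nonneg _) (abs_invSymbol_le_one _ _ _)

/-- The cubic term enters linearly and also through the wave numbers in the symbol. The second
dependence costs a further `amp²`, so the total `amp² (1 + 40 · 27 amp²)` is far below `1/1000`. -/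
theorem norm_waveMap_sub_le {s : ℝ} (hs : |s| = 1) {x y : SeqSpace} (hx : ‖x‖ ≤ 27)
    (hy : ‖y‖ ≤ 27) : ‖waveMap s x - waveMap s y‖ ≤ 1 / 1000 * ‖x - y‖ := by
  have hx' (n : ℤ) := (seq_abs_le x n).trans hx
  have hy' (n : ℤ) := (seq_abs_le y n).trans hy
  have hd (n : ℤ) : |root s (x n) - root s (y n)| ≤ amp ^ 2 * ‖x - y‖ :=
    (abs_root_sub_le hs (hx' n) (hy' n)).trans (by gcongr; exact seq_abs_le (x - y) n)
  have hk (n : ℤ) := abs_invSymbol_sub_le (abs_root_sub_one_le hs (hx' 0))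
    (abs_root_sub_one_le hs (hx' (-1))) (abs_root_sub_one_le hs (hy' 0))
    (abs_root_sub_one_le hs (hy' (-1))) n
  have hpt (n : ℤ) : |(waveMap s x - waveMap s y) n|
      ≤ amp ^ 2 * |(x - y) n| + amp ^ 2 * (40 * (amp ^ 2 * ‖x - y‖)) * |y n| := by
    have e : (waveMap s x - waveMap s y) n = -(s * amp ^ 2) *
        (invSymbol (root s (x 0)) (root s (x (-1))) n * (x - y) n
          + (invSymbol (root s (x 0)) (root s (x (-1))) n
            - invSymbol (root s (y 0)) (root s (y (-1))) n) * y n) := by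
      simp only [lp.coeFn_sub, Pi.sub_apply, waveMap_apply]
      ring
    rw [e, abs_mul, abs_neg, abs_mul, hs, abs_of_nonneg (sq_nonneg amp), one_mul, mul_assoc,
      ← mul_add]
    gcongr
    refine (abs_add_le _ _).trans (add_le_add ?_ ?_)
    · rw [abs_mul]
      exact mul_le_of_le_one_left (abs_nonneg _) (abs_invSymbol_le_one _ _ _)
    · rw [abs_mul]
      gcongr
      refine (hk n).trans ?_
      linarith [hd 0, hd (-1)]
  have s1 := (seq_summable (x - y)).mul_left (amp ^ 2)
  have s2 := (seq_summable y).mul_left (amp ^ 2 * (40 * (amp ^ 2 * ‖x - y‖)))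
  calc ‖waveMap s x - waveMap s y‖
      ≤ ∑' n, (amp ^ 2 * |(x - y) n| + amp ^ 2 * (40 * (amp ^ 2 * ‖x - y‖)) * |y n|) := by
        rw [seq_norm]
        exact (seq_summable _).tsum_le_tsum hpt (s1.add s2)
    _ = amp ^ 2 * ‖x - y‖ + amp ^ 2 * (40 * (amp ^ 2 * ‖x - y‖)) * ‖y‖ := by
        rw [s1.tsum_add s2, tsum_mul_left, tsum_mul_left, ← seq_norm, ← seq_norm]
    _ ≤ amp ^ 2 * ‖x - y‖ + amp ^ 2 * (40 * (amp ^ 2 * ‖x - y‖)) * 27 := by gcongr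
    _ ≤ 1 / 1000 * ‖x - y‖ := by
        rw [amp]
        nlinarith [norm_nonneg (x - y)]

/-- The leading coefficients. -/
def baseSeq : SeqSpace := lp.single 1 0 1 + lp.single 1 (-1) 1

theorem norm_baseSeq_le : ‖baseSeq‖ ≤ 2 := by
  refine (norm_add_le _ _).trans ?_
  rw [lp.norm_single (by norm_num), lp.norm_single (by norm_num)]
  norm_num

theorem baseSeq_zero : baseSeq 0 = 1 := by
  simp [baseSeq, lp.single_apply]

theorem baseSeq_neg_one : baseSeq (-1) = 1 := by
  simp [baseSeq, lp.single_apply]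

theorem baseSeq_of_ne {n : ℤ} (h0 : n ≠ 0) (h1 : n ≠ -1) : baseSeq n = 0 := by
  simp [baseSeq, lp.single_apply, h0, h1]

/-- The scaled coefficients `c` and the wave numbers `p = k + ℓ`, `p' = k - ℓ` of a small wave with
scaled amplitudes `A`, `B`. -/
structure IsScaledWave (s A B p p' : ℝ) (c : SeqSpace) : Prop where
  abs_A : |A| ≤ 1
  abs_B : |B| ≤ 1
  abs_p : |p - 1| ≤ 1 / 100
  abs_p' : |p' - 1| ≤ 1 / 100
  c_zero : c 0 = 1
  c_neg_one : c (-1) = 1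
  norm_c : ‖c‖ ≤ 3
  equation : ∀ n, dispersion p p' n * c n = -(s * amp ^ 2) *
    ∑' u : ℤ × ℤ, wt A B u n * (c u.1 * c u.2 * c (u.1 + u.2 - n))

theorem norm_cubic_base_le {A B : ℝ} (hA : |A| ≤ 1) (hB : |B| ≤ 1) {ζ : SeqSpace} (hζ : ‖ζ‖ ≤ 1) :
    ‖baseSeq + ζ‖ ≤ 3 ∧ ‖cubic A B (baseSeq + ζ)‖ ≤ 27 := by
  have h1 : ‖baseSeq + ζ‖ ≤ 3 := (norm_add_le _ _).trans (by linarith [norm_baseSeq_le])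
  refine ⟨h1, (norm_cubic_le hA hB _).trans ?_⟩
  calc _ ≤ (3 : ℝ) * 3 * 3 := by gcongr
    _ = 27 := by norm_num

theorem waveMap_cubic_lipschitz {s : ℝ} (hs : |s| = 1) {A B : ℝ} (hA : |A| ≤ 1) (hB : |B| ≤ 1)
    {ζ η : SeqSpace} (hζ : ‖ζ‖ ≤ 1) (hη : ‖η‖ ≤ 1) :
    ‖waveMap s (cubic A B (baseSeq + ζ)) - waveMap s (cubic A B (baseSeq + η))‖
      ≤ 1 / 2 * ‖ζ - η‖ := by
  obtain ⟨a1, a2⟩ := norm_cubic_base_le hA hB hζ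
  obtain ⟨b1, b2⟩ := norm_cubic_base_le hA hB hη
  refine (norm_waveMap_sub_le hs a2 b2).trans ?_
  have h := norm_cubic_sub_le hA hB _ _ a1 b1
  rw [add_sub_add_left_eq_sub] at h
  nlinarith [norm_nonneg (ζ - η)]

theorem exists_wave_coefficients {s : ℝ} (hs : |s| = 1) {A B : ℝ} (hA : |A| ≤ 1) (hB : |B| ≤ 1) :
    ∃ ζ : SeqSpace, ‖ζ‖ ≤ 1 ∧ waveMap s (cubic A B (baseSeq + ζ)) = ζ := by
  refine exists_fixedPoint_of_norm_le (f := fun ζ => waveMap s (cubic A B (baseSeq + ζ)))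
    zero_le_one (fun ζ hζ => ?_) fun ζ η hζ hη => waveMap_cubic_lipschitz hs hA hB hζ hη
  refine (norm_waveMap_le hs _).trans ?_
  have := (norm_cubic_base_le hA hB hζ).2
  rw [amp]
  linarith

/-- At `n = 0` and `n = -1`, where `c = 1`, the equation is the defining property of `root`; at the
other modes it is the fixed-point equation multiplied by the symbol. -/
theorem isScaledWave_of_fixedPoint {s : ℝ} (hs : |s| = 1) {A B : ℝ} (hA : |A| ≤ 1) (hB : |B| ≤ 1)
    {ζ : SeqSpace} (hζ : ‖ζ‖ ≤ 1) (hfix : waveMap s (cubic A B (baseSeq + ζ)) = ζ) :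
    IsScaledWave s A B (root s (cubic A B (baseSeq + ζ) 0))
      (root s (cubic A B (baseSeq + ζ) (-1))) (baseSeq + ζ) := by
  obtain ⟨h1, h2⟩ := norm_cubic_base_le hA hB hζ
  set x := cubic A B (baseSeq + ζ) with hx
  have hx' (n : ℤ) := (seq_abs_le x n).trans h2
  have hζn (n : ℤ) : ζ n
      = -(s * amp ^ 2) * (invSymbol (root s (x 0)) (root s (x (-1))) n * x n) := by
    rw [← waveMap_apply, hfix]
  have hp := abs_root_sub_one_le hs (hx' 0)
  have hp' := abs_root_sub_one_le hs (hx' (-1))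
  have c0 : (baseSeq + ζ) 0 = 1 := by
    rw [lp.coeFn_add, Pi.add_apply, baseSeq_zero, hζn, invSymbol, if_neg (by simp)]
    ring
  have c1 : (baseSeq + ζ) (-1) = 1 := by
    rw [lp.coeFn_add, Pi.add_apply, baseSeq_neg_one, hζn, invSymbol, if_neg (by simp)]
    ring
  refine ⟨hA, hB, hp, hp', c0, c1, h1, fun n => ?_⟩
  rw [← cubic_apply hA hB, ← hx]
  by_cases h0 : n = 0
  · rw [h0, c0, dispersion]
    have := root_sq hs (hx' 0)
    push_cast
    linear_combination this
  by_cases hn1 : n = -1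
  · rw [hn1, c1, dispersion]
    have := root_sq hs (hx' (-1))
    push_cast
    linear_combination this
  rw [lp.coeFn_add, Pi.add_apply, baseSeq_of_ne h0 hn1, hζn, invSymbol,
    if_pos ⟨⟨hp, hp'⟩, h0, hn1⟩]
  have := (dispersion_lower hp hp' h0 hn1).1
  field_simp
  ring

theorem exists_scaledWave {s : ℝ} (hs : |s| = 1) :
    ∃ (p p' : ℝ × ℝ → ℝ) (c : ℝ × ℝ → SeqSpace), ContinuousOn p square ∧ ContinuousOn p' square ∧
      ContinuousOn c square ∧ ∀ q ∈ square, IsScaledWave s q.1 q.2 (p q) (p' q) (c q) := by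
  -- The implication makes the selection total; the value outside the square is irrelevant.
  have hex (q : ℝ × ℝ) : ∃ ζ : SeqSpace, q ∈ square →
      ‖ζ‖ ≤ 1 ∧ waveMap s (cubic q.1 q.2 (baseSeq + ζ)) = ζ := by
    by_cases hq : q ∈ square
    · obtain ⟨ζ, h⟩ := exists_wave_coefficients hs hq.1 hq.2
      exact ⟨ζ, fun _ => h⟩
    · exact ⟨0, fun h => absurd h hq⟩
  choose ζ hζ using hex
  -- Uniform contraction: `ζ q - ζ q₀` is at most half of itself plus the change of the map at the
  -- fixed argument `ζ q₀`.
  have hζc : ContinuousOn ζ square := by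
    intro q₀ hq₀
    rw [ContinuousWithinAt, tendsto_iff_norm_sub_tendsto_zero]
    have hlim : Filter.Tendsto (fun q : ℝ × ℝ =>
        ‖cubic q.1 q.2 (baseSeq + ζ q₀) - cubic q₀.1 q₀.2 (baseSeq + ζ q₀)‖)
        (nhdsWithin q₀ square) (nhds 0) :=
      tendsto_iff_norm_sub_tendsto_zero.1 (continuousOn_cubic (baseSeq + ζ q₀) q₀ hq₀)
    refine squeeze_zero' (Filter.Eventually.of_forall fun _ => norm_nonneg _) ?_ hlim
    filter_upwards [self_mem_nhdsWithin] with q hq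
    obtain ⟨a1, a2⟩ := hζ q hq
    obtain ⟨b1, b2⟩ := hζ q₀ hq₀
    have h1 := waveMap_cubic_lipschitz hs hq.1 hq.2 a1 b1
    have h2 := norm_waveMap_sub_le hs (norm_cubic_base_le hq.1 hq.2 b1).2
      (norm_cubic_base_le hq₀.1 hq₀.2 b1).2
    rw [a2] at h1
    rw [b2] at h2
    have h3 := norm_sub_le_norm_sub_add_norm_sub (ζ q)
      (waveMap s (cubic q.1 q.2 (baseSeq + ζ q₀))) (ζ q₀)
    have h4 := norm_nonneg (cubic q.1 q.2 (baseSeq + ζ q₀) - cubic q₀.1 q₀.2 (baseSeq + ζ q₀))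
    linarith
  have hxc : ContinuousOn (fun q : ℝ × ℝ => cubic q.1 q.2 (baseSeq + ζ q)) square := by
    intro q₀ hq₀
    rw [ContinuousWithinAt, tendsto_iff_norm_sub_tendsto_zero]
    have hlim : Filter.Tendsto (fun q : ℝ × ℝ => 27 * ‖ζ q - ζ q₀‖ +
        ‖cubic q.1 q.2 (baseSeq + ζ q₀) - cubic q₀.1 q₀.2 (baseSeq + ζ q₀)‖)
        (nhdsWithin q₀ square) (nhds 0) := by
      have h1 := tendsto_iff_norm_sub_tendsto_zero.1 (continuousOn_cubic (baseSeq + ζ q₀) q₀ hq₀)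
      have h2 := tendsto_iff_norm_sub_tendsto_zero.1 (hζc q₀ hq₀)
      simpa using (h2.const_mul 27).add h1
    refine squeeze_zero' (Filter.Eventually.of_forall fun _ => norm_nonneg _) ?_ hlim
    filter_upwards [self_mem_nhdsWithin] with q hq
    have h1 := norm_cubic_sub_le hq.1 hq.2 _ _ (norm_cubic_base_le hq.1 hq.2 (hζ q hq).1).1
      (norm_cubic_base_le hq.1 hq.2 (hζ q₀ hq₀).1).1
    rw [add_sub_add_left_eq_sub] at h1
    have h3 := norm_sub_le_norm_sub_add_norm_sub (cubic q.1 q.2 (baseSeq + ζ q))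
      (cubic q.1 q.2 (baseSeq + ζ q₀)) (cubic q₀.1 q₀.2 (baseSeq + ζ q₀))
    linarith
  have hroot (n : ℤ) :
      ContinuousOn (fun q : ℝ × ℝ => root s (cubic q.1 q.2 (baseSeq + ζ q) n)) square := by
    have h1 : ContinuousOn (fun q : ℝ × ℝ => cubic q.1 q.2 (baseSeq + ζ q) n) square :=
      ((lp.lipschitzWith_one_eval 1 n).continuous.comp_continuousOn hxc)
    unfold root
    fun_prop
  exact ⟨_, _, fun q => baseSeq + ζ q, hroot 0, hroot (-1), continuousOn_const.add hζc,
    fun q hq => isScaledWave_of_fixedPoint hs hq.1 hq.2 (hζ q hq).1 (hζ q hq).2⟩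

end PeriodicNLS

end

noncomputable section

namespace PeriodicNLS

/-! ### Fourier coefficients, weak derivatives and multiplication operators -/

open scoped ComplexConjugate

/-- The `n`-th Fourier coefficient as a functional on `L²`. -/
def hat (n : ℤ) : L2per →L[ℂ] ℂ := innerSL ℂ (fourierBasis (T := 2 * π) n)

theorem hat_apply (n : ℤ) (u : L2per) : hat n u = inner ℂ (fourierBasis n) u := rfl

theorem hat_eq_fourierCoeff (n : ℤ) (u : L2per) : hat n u = fourierCoeff u n := by
  rw [hat_apply, ← HilbertBasis.repr_apply_apply, fourierBasis_repr]

theorem hat_fourierBasis (n m : ℤ) :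
    hat n (fourierBasis (T := 2 * π) m) = if n = m then 1 else 0 := by
  classical
  rw [hat_apply, orthonormal_iff_ite.1 fourierBasis.orthonormal]

theorem hat_ext {u v : L2per} (h : ∀ n, hat n u = hat n v) : u = v :=
  ext_inner_basis fourierBasis h

theorem hat_toLp (φ : C(AddCircle (2 * π), ℂ)) (n : ℤ) :
    hat n (ContinuousMap.toLp (E := ℂ) 2 haarAddCircle ℂ φ) = fourierCoeff φ n := by
  rw [hat_eq_fourierCoeff, fourierCoeff_toLp]

theorem integral_mul_eq_inner (u : L2per) (φ : C(AddCircle (2 * π), ℂ)) :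
    ∫ z, u z * φ z ∂haarAddCircle
      = inner ℂ (ContinuousMap.toLp (E := ℂ) 2 (haarAddCircle (T := 2 * π)) ℂ (star φ)) u := by
  rw [L2.inner_def]
  refine integral_congr_ae ?_
  filter_upwards [ContinuousMap.coeFn_toLp (p := 2) (𝕜 := ℂ) (haarAddCircle (T := 2 * π)) (star φ)]
    with z hz
  rw [hz]
  simp

theorem fourierCoeff_star (φ : C(AddCircle (2 * π), ℂ)) (n : ℤ) :
    fourierCoeff (star φ : C(AddCircle (2 * π), ℂ)) n = conj (fourierCoeff φ (-n)) := by
  rw [fourierCoeff, fourierCoeff, ← integral_conj]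
  congr 1
  funext z
  simp

/-- The Fourier coefficients of a periodic derivative. -/
theorem fourierCoeff_deriv {φ φ' : C(AddCircle (2 * π), ℂ)}
    (h : ∀ x : ℝ, HasDerivAt (fun y : ℝ => φ y) (φ' x) x) (n : ℤ) :
    fourierCoeff φ' n = Complex.I * n * fourierCoeff φ n := by
  have hc (ψ : C(AddCircle (2 * π), ℂ)) : Continuous fun x : ℝ => ψ x :=
    ψ.continuous.comp (AddCircle.continuous_mk' _)
  have hd (x : ℝ) : HasDerivAt (fun y : ℝ => fourier (T := 2 * π) (-n) (y : AddCircle (2 * π)) * φ y)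
      (fourier (T := 2 * π) (-n) (x : AddCircle (2 * π)) * φ' x
        - Complex.I * n * (fourier (T := 2 * π) (-n) (x : AddCircle (2 * π)) * φ x)) x := by
    have h1 := (hasDerivAt_fourier_neg (2 * π) n x).mul (h x)
    refine h1.congr_deriv ?_
    have : (π : ℂ) ≠ 0 := by exact_mod_cast Real.pi_ne_zero
    push_cast
    field_simp
    ring
  have hi1 : IntervalIntegrable (fun x : ℝ => fourier (T := 2 * π) (-n) (x : AddCircle (2 * π))
      * φ' x) volume 0 (0 + 2 * π) :=
    ((hc _).mul (hc _)).intervalIntegrable _ _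
  have hi2 : IntervalIntegrable (fun x : ℝ => Complex.I * n *
      (fourier (T := 2 * π) (-n) (x : AddCircle (2 * π)) * φ x)) volume 0 (0 + 2 * π) :=
    (continuous_const.mul ((hc _).mul (hc _))).intervalIntegrable _ _
  have hint := intervalIntegral.integral_eq_sub_of_hasDerivAt (a := 0) (b := 0 + 2 * π)
    (fun x _ => hd x) (hi1.sub hi2)
  have hper : ((0 + 2 * π : ℝ) : AddCircle (2 * π)) = ((0 : ℝ) : AddCircle (2 * π)) := by
    rw [zero_add, AddCircle.coe_period]; rfl
  rw [hper, sub_self, intervalIntegral.integral_sub hi1 hi2, sub_eq_zero,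
    intervalIntegral.integral_const_mul] at hint
  rw [fourierCoeff_eq_intervalIntegral _ n 0, fourierCoeff_eq_intervalIntegral _ n 0]
  simp only [smul_eq_mul]
  rw [hint, mul_smul_comm]

/-- Testing against exponentials gives one direction and Parseval the other, so weak differentiation
is multiplication by `i n`. -/
theorem isWeakDeriv_iff (u v : L2per) :
    IsWeakDeriv u v ↔ ∀ n : ℤ, hat n v = Complex.I * n * hat n u := by
  constructor
  · intro h n
    have h2 := h (fourier (-n)) ((-(Complex.I * n)) • fourier (-n))
      (by
        have : (fun x : ℝ => fourier (T := 2 * π) (-n) (x : AddCircle (2 * π)))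
            = fun x : ℝ => Complex.exp (2 * π * Complex.I * (-n : ℤ) * x / (2 * π : ℝ)) := by
          funext x
          exact fourier_coe_apply
        rw [this]
        have hx : ContDiff ℝ ∞ (fun x : ℝ => (x : ℂ)) := Complex.ofRealCLM.contDiff
        exact ((contDiff_const.mul hx).div_const _).cexp)
      (fun x => by
        refine (hasDerivAt_fourier_neg (2 * π) n x).congr_deriv ?_
        have : (π : ℂ) ≠ 0 := by exact_mod_cast Real.pi_ne_zero
        rw [ContinuousMap.smul_apply, smul_eq_mul]
        push_cast
        field_simp)
    have hv : ∫ z, v z * fourier (-n) z ∂haarAddCircle = hat n v := by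
      rw [hat_eq_fourierCoeff, fourierCoeff]
      simp only [smul_eq_mul, mul_comm]
    have hu : ∫ z, u z * ((-(Complex.I * n)) • fourier (T := 2 * π) (-n)) z ∂haarAddCircle
        = -(Complex.I * n) * hat n u := by
      rw [hat_eq_fourierCoeff, fourierCoeff, ← integral_const_mul]
      refine integral_congr_ae (Filter.Eventually.of_forall fun z => ?_)
      simp only [ContinuousMap.smul_apply, smul_eq_mul]
      ring
    rw [hu, hv] at h2
    linear_combination h2
  · intro h φ φ' _ hd
    rw [integral_mul_eq_inner, integral_mul_eq_inner]
    have h1 := fourierBasis.hasSum_inner_mul_inner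
      (ContinuousMap.toLp (E := ℂ) 2 (haarAddCircle (T := 2 * π)) ℂ (star φ')) u
    have h2 := fourierBasis.hasSum_inner_mul_inner
      (ContinuousMap.toLp (E := ℂ) 2 (haarAddCircle (T := 2 * π)) ℂ (star φ)) v
    refine h1.unique (h2.neg.congr_fun fun n => ?_)
    rw [← hat_apply, ← hat_apply, ← inner_conj_symm, ← hat_apply, hat_toLp, ← inner_conj_symm,
      ← hat_apply, hat_toLp, fourierCoeff_star, fourierCoeff_star, fourierCoeff_deriv hd, h n]
    simp only [Complex.conj_conj]
    push_cast
    ring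

theorem exists_weakDeriv {u : L2per} {f : ℤ → ℂ} (hf : Memℓp f 2)
    (h : ∀ n : ℤ, f n = Complex.I * n * hat n u) : ∃ v : L2per, IsWeakDeriv u v := by
  refine ⟨fourierBasis.repr.symm ⟨f, hf⟩, (isWeakDeriv_iff _ _).2 fun n => ?_⟩
  rw [hat_apply, ← HilbertBasis.repr_apply_apply, LinearIsometryEquiv.apply_symm_apply, ← h]

theorem memLp_mul (φ : C(AddCircle (2 * π), ℂ)) (u : L2per) :
    MemLp (fun z => φ z * u z) 2 (haarAddCircle (T := 2 * π)) := by
  refine (Lp.memLp u).of_le_mul (c := ‖φ‖)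
    (φ.continuous.aestronglyMeasurable.mul (Lp.aestronglyMeasurable u)) ?_
  refine Filter.Eventually.of_forall fun z => ?_
  rw [norm_mul]
  gcongr
  exact φ.norm_coe_le_norm z

/-- Multiplication by a continuous function. -/
def mulOp (φ : C(AddCircle (2 * π), ℂ)) : L2per →L[ℂ] L2per :=
  LinearMap.mkContinuous
    { toFun := fun u => (memLp_mul φ u).toLp _
      map_add' := fun u v => by
        rw [← MemLp.toLp_add]
        refine MemLp.toLp_congr _ _ ?_
        filter_upwards [Lp.coeFn_add u v] with z hz
        rw [hz, Pi.add_apply, Pi.add_apply, mul_add]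
      map_smul' := fun c u => by
        rw [RingHom.id_apply, ← MemLp.toLp_const_smul]
        refine MemLp.toLp_congr _ _ ?_
        filter_upwards [Lp.coeFn_smul c u] with z hz
        rw [hz, Pi.smul_apply, Pi.smul_apply, smul_eq_mul, smul_eq_mul]
        ring }
    ‖φ‖ fun u => by
      refine Lp.norm_le_mul_norm_of_ae_le_mul ?_
      filter_upwards [(memLp_mul φ u).coeFn_toLp] with z hz
      simp only [LinearMap.coe_mk, AddHom.coe_mk]
      rw [hz, norm_mul]
      gcongr
      exact φ.norm_coe_le_norm z

theorem mulOp_coeFn (φ : C(AddCircle (2 * π), ℂ)) (u : L2per) :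
    mulOp φ u =ᵐ[haarAddCircle] fun z => φ z * u z := (memLp_mul φ u).coeFn_toLp

theorem norm_mulOp_apply_le (φ : C(AddCircle (2 * π), ℂ)) (u : L2per) :
    ‖mulOp φ u‖ ≤ ‖φ‖ * ‖u‖ :=
  (mulOp φ).le_of_opNorm_le (LinearMap.mkContinuous_norm_le _ (norm_nonneg _) _) u

theorem inner_mulOp_of_star_eq {φ : C(AddCircle (2 * π), ℂ)} (hφ : star φ = φ) (u v : L2per) :
    inner ℂ (mulOp φ u) v = inner ℂ u (mulOp φ v) := by
  rw [L2.inner_def, L2.inner_def]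
  refine integral_congr_ae ?_
  filter_upwards [mulOp_coeFn φ u, mulOp_coeFn φ v] with z h1 h2
  have h3 : conj (φ z) = φ z := congrArg (fun ψ : C(AddCircle (2 * π), ℂ) => ψ z) hφ
  rw [h1, h2]
  simp only [RCLike.inner_apply, map_mul, h3]
  ring

theorem hat_mulOp_fourierBasis (φ : C(AddCircle (2 * π), ℂ)) (n m : ℤ) :
    hat n (mulOp φ (fourierBasis (T := 2 * π) m)) = fourierCoeff φ (n - m) := by
  rw [hat_eq_fourierCoeff, fourierCoeff, fourierCoeff]
  refine integral_congr_ae ?_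
  filter_upwards [mulOp_coeFn φ (fourierBasis (T := 2 * π) m), coeFn_fourierLp 2 m] with z h1 h2
  rw [coe_fourierBasis] at h1
  rw [coe_fourierBasis, h1, h2]
  simp only [smul_eq_mul]
  rw [neg_sub, sub_eq_add_neg, fourier_add]
  ring

end PeriodicNLS

end

noncomputable section

namespace PeriodicNLS

open scoped ComplexConjugate

/-! ### The adapted basis of `L²_per([0,2π], ℂ²)` -/

/-- The vectors `(cos nz, sin nz)` and `(-sin nz, cos nz)`, which correspond to the complex-valued
functions `e^{inz}` and `i e^{inz}`. -/
def basVec : Bool × ℤ → L2per2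
  | (true, n) => WithLp.toLp 2 (((1 / 2 : ℂ) • (fourierBasis n + fourierBasis (-n)) : L2per),
      ((-Complex.I / 2) • (fourierBasis n - fourierBasis (-n)) : L2per))
  | (false, n) => WithLp.toLp 2 (((Complex.I / 2) • (fourierBasis n - fourierBasis (-n)) : L2per),
      ((1 / 2 : ℂ) • (fourierBasis n + fourierBasis (-n)) : L2per))

theorem inner_basVec_true (n : ℤ) (x : L2per2) : inner ℂ (basVec (true, n)) x
    = 1 / 2 * (hat n x.fst + hat (-n) x.fst)
      + Complex.I / 2 * (hat n x.snd - hat (-n) x.snd) := by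
  rw [WithLp.prod_inner_apply]
  simp [basVec, inner_add_left, inner_sub_left, inner_smul_left, hat_apply,
    map_ofNat (starRingEnd ℂ)]
  ring

theorem inner_basVec_false (n : ℤ) (x : L2per2) : inner ℂ (basVec (false, n)) x
    = -(Complex.I / 2) * (hat n x.fst - hat (-n) x.fst)
      + 1 / 2 * (hat n x.snd + hat (-n) x.snd) := by
  rw [WithLp.prod_inner_apply]
  simp [basVec, inner_add_left, inner_sub_left, inner_smul_left, hat_apply,
    map_ofNat (starRingEnd ℂ)]
  ring

theorem basVec_true_fst (n : ℤ) : (basVec (true, n)).fst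
    = ((1 / 2 : ℂ) • (fourierBasis n + fourierBasis (-n)) : L2per) := rfl

theorem basVec_true_snd (n : ℤ) : (basVec (true, n)).snd
    = ((-Complex.I / 2) • (fourierBasis n - fourierBasis (-n)) : L2per) := rfl

theorem basVec_false_fst (n : ℤ) : (basVec (false, n)).fst
    = ((Complex.I / 2) • (fourierBasis n - fourierBasis (-n)) : L2per) := rfl

theorem basVec_false_snd (n : ℤ) : (basVec (false, n)).snd
    = ((1 / 2 : ℂ) • (fourierBasis n + fourierBasis (-n)) : L2per) := rfl

theorem orthonormal_basVec : Orthonormal ℂ basVec := by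
  classical
  rw [orthonormal_iff_ite]
  rintro ⟨τ, n⟩ ⟨τ', m⟩
  have e1 : (-n = m) = (n = -m) := propext neg_eq_iff_eq_neg
  cases τ <;> cases τ' <;>
    simp only [inner_basVec_true, inner_basVec_false, basVec_true_fst, basVec_true_snd,
      basVec_false_fst, basVec_false_snd, map_smul, map_add, map_sub, hat_fourierBasis, neg_inj, e1,
      smul_eq_mul, Prod.mk.injEq, Bool.false_eq_true, Bool.true_eq_false, false_and, true_and,
      if_false]
  · linear_combination (-(if n = m then (1 : ℂ) else 0) + (if n = -m then 1 else 0)) / 2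
      * Complex.I_sq
  · ring
  · ring
  · linear_combination (-(if n = m then (1 : ℂ) else 0) + (if n = -m then 1 else 0)) / 2
      * Complex.I_sq

theorem hat_fst_eq (n : ℤ) (x : L2per2) : hat n x.fst
    = 1 / 2 * (inner ℂ (basVec (true, n)) x + Complex.I * inner ℂ (basVec (false, n)) x
      + inner ℂ (basVec (true, -n)) x - Complex.I * inner ℂ (basVec (false, -n)) x) := by
  simp only [inner_basVec_true, inner_basVec_false, neg_neg]
  linear_combination 1 / 2 * (hat n x.fst - hat (-n) x.fst) * Complex.I_sq

theorem hat_snd_eq (n : ℤ) (x : L2per2) : hat n x.snd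
    = 1 / 2 * (-Complex.I * inner ℂ (basVec (true, n)) x + inner ℂ (basVec (false, n)) x
      + Complex.I * inner ℂ (basVec (true, -n)) x + inner ℂ (basVec (false, -n)) x) := by
  simp only [inner_basVec_true, inner_basVec_false, neg_neg]
  linear_combination 1 / 2 * (hat n x.snd - hat (-n) x.snd) * Complex.I_sq

/-- The Hilbert basis of vectors `basVec`. -/
def bas : HilbertBasis (Bool × ℤ) ℂ L2per2 :=
  HilbertBasis.mkOfOrthogonalEqBot orthonormal_basVec (by
    rw [Submodule.eq_bot_iff]
    intro x hx
    rw [Submodule.mem_orthogonal] at hx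
    have h (i : Bool × ℤ) : inner ℂ (basVec i) x = 0 :=
      hx _ (Submodule.subset_span ⟨i, rfl⟩)
    have e1 : x.fst = 0 := hat_ext fun n => by rw [hat_fst_eq]; simp [h]
    have e2 : x.snd = 0 := hat_ext fun n => by rw [hat_snd_eq]; simp [h]
    exact WithLp.ofLp_injective 2 (Prod.ext e1 e2))

theorem bas_apply (i : Bool × ℤ) : bas i = basVec i := by
  rw [bas, HilbertBasis.coe_mkOfOrthogonalEqBot]

/-! ### The multiplication part of the operator -/

/-- The entry `s (3 R² + I²)`. -/
def pot11 (s : ℝ) (Q : C(AddCircle (2 * π), ℂ)) : C(AddCircle (2 * π), ℂ) :=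
  (s : ℂ) • ((2 : ℂ) • (Q * star Q) + (1 / 2 : ℂ) • (Q * Q + star Q * star Q))

/-- The entry `2 s R I`. -/
def pot12 (s : ℝ) (Q : C(AddCircle (2 * π), ℂ)) : C(AddCircle (2 * π), ℂ) :=
  (s : ℂ) • ((-Complex.I / 2) • (Q * Q - star Q * star Q))

/-- The entry `s (R² + 3 I²)`. -/
def pot22 (s : ℝ) (Q : C(AddCircle (2 * π), ℂ)) : C(AddCircle (2 * π), ℂ) :=
  (s : ℂ) • ((2 : ℂ) • (Q * star Q) - (1 / 2 : ℂ) • (Q * Q + star Q * star Q))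

theorem pot11_apply (s : ℝ) (Q : C(AddCircle (2 * π), ℂ)) (z : AddCircle (2 * π)) :
    pot11 s Q z = s * (3 * (Q z).re ^ 2 + (Q z).im ^ 2) := by
  simp only [pot11, ContinuousMap.smul_apply, ContinuousMap.add_apply, ContinuousMap.mul_apply,
    ContinuousMap.star_apply, smul_eq_mul, RCLike.star_def]
  have h1 := Complex.re_add_im (Q z)
  have h2 : conj (Q z) = (Q z).re - (Q z).im * Complex.I := by
    apply Complex.ext <;> simp
  rw [h2]
  set R := (Q z).re
  set J := (Q z).im
  rw [← h1]
  linear_combination (s * (-J ^ 2)) * Complex.I_sq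

theorem pot12_apply (s : ℝ) (Q : C(AddCircle (2 * π), ℂ)) (z : AddCircle (2 * π)) :
    pot12 s Q z = 2 * s * (Q z).re * (Q z).im := by
  simp only [pot12, ContinuousMap.smul_apply, ContinuousMap.sub_apply, ContinuousMap.mul_apply,
    ContinuousMap.star_apply, smul_eq_mul, RCLike.star_def]
  have h1 := Complex.re_add_im (Q z)
  have h2 : conj (Q z) = (Q z).re - (Q z).im * Complex.I := by
    apply Complex.ext <;> simp
  rw [h2]
  set R := (Q z).re
  set J := (Q z).im
  rw [← h1]
  linear_combination (-2 * s * R * J) * Complex.I_sq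

theorem pot22_apply (s : ℝ) (Q : C(AddCircle (2 * π), ℂ)) (z : AddCircle (2 * π)) :
    pot22 s Q z = s * ((Q z).re ^ 2 + 3 * (Q z).im ^ 2) := by
  simp only [pot22, ContinuousMap.smul_apply, ContinuousMap.add_apply, ContinuousMap.sub_apply,
    ContinuousMap.mul_apply, ContinuousMap.star_apply, smul_eq_mul, RCLike.star_def]
  have h1 := Complex.re_add_im (Q z)
  have h2 : conj (Q z) = (Q z).re - (Q z).im * Complex.I := by
    apply Complex.ext <;> simp
  rw [h2]
  set R := (Q z).re
  set J := (Q z).im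
  rw [← h1]
  linear_combination (s * (-3 * J ^ 2)) * Complex.I_sq

theorem star_pot11 (s : ℝ) (Q : C(AddCircle (2 * π), ℂ)) : star (pot11 s Q) = pot11 s Q := by
  ext z
  rw [ContinuousMap.star_apply, pot11_apply, RCLike.star_def]
  simp only [map_mul, map_add, map_pow, Complex.conj_ofReal, map_ofNat]

theorem star_pot12 (s : ℝ) (Q : C(AddCircle (2 * π), ℂ)) : star (pot12 s Q) = pot12 s Q := by
  ext z
  rw [ContinuousMap.star_apply, pot12_apply, RCLike.star_def]
  simp only [map_mul, Complex.conj_ofReal, map_ofNat]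

theorem star_pot22 (s : ℝ) (Q : C(AddCircle (2 * π), ℂ)) : star (pot22 s Q) = pot22 s Q := by
  ext z
  rw [ContinuousMap.star_apply, pot22_apply, RCLike.star_def]
  simp only [map_mul, map_add, map_pow, Complex.conj_ofReal, map_ofNat]

/-- The multiplication part of the operator. -/
def potOp (s : ℝ) (Q : C(AddCircle (2 * π), ℂ)) : L2per2 →L[ℂ] L2per2 :=
  (WithLp.prodContinuousLinearEquiv 2 ℂ L2per L2per).symm.toContinuousLinearMap.comp
    (((mulOp (pot11 s Q)).comp (WithLp.fstL 2 ℂ L2per L2per)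
        + (mulOp (pot12 s Q)).comp (WithLp.sndL 2 ℂ L2per L2per)).prod
      ((mulOp (pot12 s Q)).comp (WithLp.fstL 2 ℂ L2per L2per)
        + (mulOp (pot22 s Q)).comp (WithLp.sndL 2 ℂ L2per L2per)))

theorem potOp_fst (s : ℝ) (Q : C(AddCircle (2 * π), ℂ)) (x : L2per2) :
    (potOp s Q x).fst = mulOp (pot11 s Q) x.fst + mulOp (pot12 s Q) x.snd := rfl

theorem potOp_snd (s : ℝ) (Q : C(AddCircle (2 * π), ℂ)) (x : L2per2) :
    (potOp s Q x).snd = mulOp (pot12 s Q) x.fst + mulOp (pot22 s Q) x.snd := rfl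

theorem potOp_symm (s : ℝ) (Q : C(AddCircle (2 * π), ℂ)) (x y : L2per2) :
    inner ℂ (potOp s Q x) y = inner ℂ x (potOp s Q y) := by
  simp only [WithLp.prod_inner_apply, WithLp.ofLp_fst, WithLp.ofLp_snd, potOp_fst, potOp_snd,
    inner_add_left, inner_add_right, inner_mulOp_of_star_eq (star_pot11 s Q),
    inner_mulOp_of_star_eq (star_pot12 s Q), inner_mulOp_of_star_eq (star_pot22 s Q)]
  ring

/-- Each of the two rows contributes `3 + 1`. -/
theorem norm_potOp_le {s : ℝ} (hs : |s| = 1) (Q : C(AddCircle (2 * π), ℂ)) :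
    ‖potOp s Q‖ ≤ 8 * ‖Q‖ ^ 2 := by
  have hre (z : AddCircle (2 * π)) : (Q z).re ^ 2 + (Q z).im ^ 2 ≤ ‖Q‖ ^ 2 := by
    have h1 := Complex.normSq_apply (Q z)
    rw [Complex.normSq_eq_norm_sq] at h1
    have h2 : ‖Q z‖ ^ 2 ≤ ‖Q‖ ^ 2 := by
      gcongr
      exact Q.norm_coe_le_norm z
    nlinarith
  have b11 : ‖pot11 s Q‖ ≤ 3 * ‖Q‖ ^ 2 := by
    rw [ContinuousMap.norm_le _ (by positivity)]
    intro z
    rw [pot11_apply, norm_mul, Complex.norm_real, Real.norm_eq_abs, hs, one_mul]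
    norm_cast
    rw [Real.norm_of_nonneg (by positivity)]
    nlinarith [hre z, sq_nonneg (Q z).im]
  have b22 : ‖pot22 s Q‖ ≤ 3 * ‖Q‖ ^ 2 := by
    rw [ContinuousMap.norm_le _ (by positivity)]
    intro z
    rw [pot22_apply, norm_mul, Complex.norm_real, Real.norm_eq_abs, hs, one_mul]
    norm_cast
    rw [Real.norm_of_nonneg (by positivity)]
    nlinarith [hre z, sq_nonneg (Q z).re]
  have b12 : ‖pot12 s Q‖ ≤ ‖Q‖ ^ 2 := by
    rw [ContinuousMap.norm_le _ (by positivity)]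
    intro z
    have e : (2 * s * (Q z).re * (Q z).im : ℂ) = (s : ℂ) * ((2 * ((Q z).re * (Q z).im) : ℝ) : ℂ) := by
      push_cast; ring
    rw [pot12_apply, e, norm_mul, Complex.norm_real, Complex.norm_real, Real.norm_eq_abs, hs,
      one_mul, Real.norm_eq_abs, abs_le]
    constructor <;>
      nlinarith [hre z, sq_nonneg ((Q z).re + (Q z).im), sq_nonneg ((Q z).re - (Q z).im)]
  refine ContinuousLinearMap.opNorm_le_bound _ (by positivity) fun x => ?_
  have hsplit (y : L2per2) : ‖y‖ ≤ ‖y.fst‖ + ‖y.snd‖ := by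
    rw [WithLp.prod_norm_eq_of_L2]
    rw [Real.sqrt_le_left (by positivity)]
    nlinarith [norm_nonneg y.fst, norm_nonneg y.snd]
  have hf : ‖x.fst‖ ≤ ‖x‖ := WithLp.norm_fst_le _ x
  have hg : ‖x.snd‖ ≤ ‖x‖ := WithLp.norm_snd_le _ x
  refine (hsplit _).trans ?_
  rw [potOp_fst, potOp_snd]
  have i1 := (norm_mulOp_apply_le (pot11 s Q) x.fst).trans (mul_le_mul b11 hf (norm_nonneg _)
    (by positivity))
  have i2 := (norm_mulOp_apply_le (pot12 s Q) x.snd).trans (mul_le_mul b12 hg (norm_nonneg _)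
    (by positivity))
  have i3 := (norm_mulOp_apply_le (pot12 s Q) x.fst).trans (mul_le_mul b12 hf (norm_nonneg _)
    (by positivity))
  have i4 := (norm_mulOp_apply_le (pot22 s Q) x.snd).trans (mul_le_mul b22 hg (norm_nonneg _)
    (by positivity))
  have j1 := norm_add_le (mulOp (pot11 s Q) x.fst) (mulOp (pot12 s Q) x.snd)
  have j2 := norm_add_le (mulOp (pot12 s Q) x.fst) (mulOp (pot22 s Q) x.snd)
  linarith

/-! ### Matrix entries of the multiplication part in the adapted basis. -/

section Matrix

variable {s : ℝ} {Q : C(AddCircle (2 * π), ℂ)} {T K : ℤ → ℝ}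

theorem fourierCoeff_smul_add (c d : ℂ) (φ ψ : C(AddCircle (2 * π), ℂ)) (n : ℤ) :
    fourierCoeff (c • φ + d • ψ : C(AddCircle (2 * π), ℂ)) n
      = c * fourierCoeff φ n + d * fourierCoeff ψ n := by
  simp only [← hat_toLp, map_add, map_smul, smul_eq_mul]

theorem fourierCoeff_star_sq (hK : ∀ n, fourierCoeff (Q * Q : C(AddCircle (2 * π), ℂ)) n = K n)
    (n : ℤ) : fourierCoeff (star Q * star Q : C(AddCircle (2 * π), ℂ)) n = K (-n) := by
  rw [← star_mul', fourierCoeff_star, hK, Complex.conj_ofReal]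

theorem fourierCoeff_pot11 (hT : ∀ n, fourierCoeff (Q * star Q : C(AddCircle (2 * π), ℂ)) n = T n)
    (hK : ∀ n, fourierCoeff (Q * Q : C(AddCircle (2 * π), ℂ)) n = K n) (n : ℤ) :
    fourierCoeff (pot11 s Q) n = s * (2 * T n + (K n + K (-n)) / 2) := by
  have e : pot11 s Q = (s * 2 : ℂ) • (Q * star Q) + (s * (1 / 2) : ℂ) •
      ((1 : ℂ) • (Q * Q) + (1 : ℂ) • (star Q * star Q)) := by
    rw [pot11, one_smul, one_smul, smul_add, smul_smul, smul_smul]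
  rw [e, fourierCoeff_smul_add, fourierCoeff_smul_add, hT, hK, fourierCoeff_star_sq hK]
  ring

theorem fourierCoeff_pot22 (hT : ∀ n, fourierCoeff (Q * star Q : C(AddCircle (2 * π), ℂ)) n = T n)
    (hK : ∀ n, fourierCoeff (Q * Q : C(AddCircle (2 * π), ℂ)) n = K n) (n : ℤ) :
    fourierCoeff (pot22 s Q) n = s * (2 * T n - (K n + K (-n)) / 2) := by
  have e : pot22 s Q = (s * 2 : ℂ) • (Q * star Q) + (-(s * (1 / 2)) : ℂ) •
      ((1 : ℂ) • (Q * Q) + (1 : ℂ) • (star Q * star Q)) := by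
    rw [pot22, one_smul, one_smul, smul_sub, smul_smul, smul_smul, neg_smul, sub_eq_add_neg]
  rw [e, fourierCoeff_smul_add, fourierCoeff_smul_add, hT, hK, fourierCoeff_star_sq hK]
  ring

theorem fourierCoeff_pot12 (hK : ∀ n, fourierCoeff (Q * Q : C(AddCircle (2 * π), ℂ)) n = K n)
    (n : ℤ) : fourierCoeff (pot12 s Q) n = s * (-Complex.I / 2) * (K n - K (-n)) := by
  have e : pot12 s Q = (s * (-Complex.I / 2) : ℂ) • (Q * Q)
      + (-(s * (-Complex.I / 2)) : ℂ) • (star Q * star Q) := by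
    rw [pot12, smul_smul, smul_sub, neg_smul, sub_eq_add_neg]
  rw [e, fourierCoeff_smul_add, hK, fourierCoeff_star_sq hK]
  ring

/-- The matrix entries of the multiplication part. -/
theorem inner_potOp (hT : ∀ n, fourierCoeff (Q * star Q : C(AddCircle (2 * π), ℂ)) n = T n)
    (hT' : ∀ n, T (-n) = T n)
    (hK : ∀ n, fourierCoeff (Q * Q : C(AddCircle (2 * π), ℂ)) n = K n) (n m : ℤ) :
    inner ℂ (bas (true, n)) (potOp s Q (bas (true, m))) = s * (2 * T (n - m) + K (n + m)) ∧
    inner ℂ (bas (false, n)) (potOp s Q (bas (false, m))) = s * (2 * T (n - m) - K (n + m)) ∧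
    inner ℂ (bas (true, n)) (potOp s Q (bas (false, m))) = 0 ∧
    inner ℂ (bas (false, n)) (potOp s Q (bas (true, m))) = 0 := by
  have e1 : n - -m = n + m := by ring
  have e2 : -n - m = -(n + m) := by ring
  have e3 : -n - -m = -(n - m) := by ring
  simp only [bas_apply, inner_basVec_true, inner_basVec_false, potOp_fst, potOp_snd,
    basVec_true_fst, basVec_true_snd, basVec_false_fst, basVec_false_snd, map_smul, map_add,
    map_sub, hat_mulOp_fourierBasis, e1, e2, e3, fourierCoeff_pot11 hT hK, fourierCoeff_pot22 hT hK,
    fourierCoeff_pot12 hK, hT', smul_eq_mul, neg_neg]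
  -- The mixed entries cancel because the coefficients of `Q²` are real and `T` is even; this
  -- decouples the two sectors.
  refine ⟨?_, ?_, ?_, ?_⟩
  · ring_nf
    simp only [Complex.I_sq]
    ring
  · ring_nf
    simp only [Complex.I_sq]
    ring
  · ring
  · ring

end Matrix

end PeriodicNLS

end

noncomputable section

namespace PeriodicNLS

open scoped ComplexConjugate

/-! ### The operator in the adapted basis -/

/-- The differential part of the operator, with `v` and `w` the derivatives of `x`. -/
def diffPart (k p : ℝ) (x v w : L2per2) : L2per2 :=
  WithLp.toLp 2
    (((-4 * k ^ 2 : ℂ) • w.fst + (p ^ 2 - 1 : ℂ) • x.fst + (4 * p * k : ℂ) • v.snd : L2per),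
      ((-4 * p * k : ℂ) • v.fst + (-4 * k ^ 2 : ℂ) • w.snd + (p ^ 2 - 1 : ℂ) • x.snd : L2per))

theorem diffPart_fst (k p : ℝ) (x v w : L2per2) : (diffPart k p x v w).fst
    = (-4 * k ^ 2 : ℂ) • w.fst + (p ^ 2 - 1 : ℂ) • x.fst + (4 * p * k : ℂ) • v.snd := rfl

theorem diffPart_snd (k p : ℝ) (x v w : L2per2) : (diffPart k p x v w).snd
    = (-4 * p * k : ℂ) • v.fst + (-4 * k ^ 2 : ℂ) • w.snd + (p ^ 2 - 1 : ℂ) • x.snd := rfl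

/-- In terms of `u = x₁ + i x₂` the differential part is `-4k²u'' - 4ipk u' + (p² - 1)u`, which
multiplies `e^{inz}` by `(p + 2kn)² - 1`, and `2k = p + p'`. -/
theorem inner_diffPart {k p p' : ℝ} (hk : k = (p + p') / 2) {x v w : L2per2}
    (h1 : IsWeakDeriv x.fst v.fst) (h2 : IsWeakDeriv x.snd v.snd)
    (h3 : IsWeakDeriv v.fst w.fst) (h4 : IsWeakDeriv v.snd w.snd) (i : Bool × ℤ) :
    inner ℂ (bas i) (diffPart k p x v w) = dispersion p p' i.2 * inner ℂ (bas i) x := by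
  rw [isWeakDeriv_iff] at h1 h2 h3 h4
  obtain ⟨τ, n⟩ := i
  have hd : (dispersion p p' n : ℂ) = (p + 2 * k * n) ^ 2 - 1 := by
    rw [dispersion, hk]
    push_cast
    ring
  have hsq (t m : ℂ) : Complex.I * m * (Complex.I * m * t) = -(m ^ 2 * t) := by
    linear_combination (m ^ 2 * t) * Complex.I_sq
  rw [bas_apply]
  cases τ
  · simp only [inner_basVec_false, diffPart_fst, diffPart_snd, map_add, map_smul, smul_eq_mul, h3,
      h4, h1, h2, hd, hsq, Int.cast_neg]
    linear_combination (-2 * p * k * n * (hat n x.snd + hat (-n) x.snd)) * Complex.I_sq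
  · simp only [inner_basVec_true, diffPart_fst, diffPart_snd, map_add, map_smul, smul_eq_mul, h3,
      h4, h1, h2, hd, hsq, Int.cast_neg]
    linear_combination (-2 * p * k * n * (hat n x.fst + hat (-n) x.fst)) * Complex.I_sq

theorem ae_iff_eq_diffPart {s k p : ℝ} {Qf : ℝ → ℂ} {Q : C(AddCircle (2 * π), ℂ)}
    (hQ : ∀ z, liftIoc (2 * π) 0 Qf z = Q z) (x y v w : L2per2) :
    (∀ᵐ z ∂(haarAddCircle (T := 2 * π)), ∀ R I : ℝ,
      R = (liftIoc (2 * π) 0 Qf z).re → I = (liftIoc (2 * π) 0 Qf z).im →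
      y.fst z = -4 * k ^ 2 * w.fst z + ((p ^ 2 - 1) + s * (3 * R ^ 2 + I ^ 2)) * x.fst z
          + (4 * p * k * v.snd z + 2 * s * R * I * x.snd z) ∧
      y.snd z = (-4 * p * k * v.fst z + 2 * s * R * I * x.fst z)
          - 4 * k ^ 2 * w.snd z + ((p ^ 2 - 1) + s * (R ^ 2 + 3 * I ^ 2)) * x.snd z) ↔
    y = diffPart k p x v w + potOp s Q x := by
  have e1 : (diffPart k p x v w + potOp s Q x).fst =ᵐ[haarAddCircle] fun z =>
      -4 * k ^ 2 * w.fst z + (p ^ 2 - 1) * x.fst z + 4 * p * k * v.snd z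
        + (s * (3 * (Q z).re ^ 2 + (Q z).im ^ 2) * x.fst z
          + 2 * s * (Q z).re * (Q z).im * x.snd z) := by
    rw [WithLp.add_fst, diffPart_fst, potOp_fst]
    filter_upwards [Lp.coeFn_add ((-4 * k ^ 2 : ℂ) • w.fst + (p ^ 2 - 1 : ℂ) • x.fst
        + (4 * p * k : ℂ) • v.snd) (mulOp (pot11 s Q) x.fst + mulOp (pot12 s Q) x.snd),
      Lp.coeFn_add ((-4 * k ^ 2 : ℂ) • w.fst + (p ^ 2 - 1 : ℂ) • x.fst) ((4 * p * k : ℂ) • v.snd),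
      Lp.coeFn_add ((-4 * k ^ 2 : ℂ) • w.fst) ((p ^ 2 - 1 : ℂ) • x.fst),
      Lp.coeFn_smul (-4 * k ^ 2 : ℂ) w.fst, Lp.coeFn_smul (p ^ 2 - 1 : ℂ) x.fst,
      Lp.coeFn_smul (4 * p * k : ℂ) v.snd,
      Lp.coeFn_add (mulOp (pot11 s Q) x.fst) (mulOp (pot12 s Q) x.snd),
      mulOp_coeFn (pot11 s Q) x.fst, mulOp_coeFn (pot12 s Q) x.snd]
      with z a1 a2 a3 a4 a5 a6 a7 a8 a9
    simp only [a1, a2, a3, a4, a5, a6, a7, a8, a9, Pi.add_apply, Pi.smul_apply, smul_eq_mul,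
      pot11_apply, pot12_apply]
  have e2 : (diffPart k p x v w + potOp s Q x).snd =ᵐ[haarAddCircle] fun z =>
      -4 * p * k * v.fst z + -4 * k ^ 2 * w.snd z + (p ^ 2 - 1) * x.snd z
        + (2 * s * (Q z).re * (Q z).im * x.fst z
          + s * ((Q z).re ^ 2 + 3 * (Q z).im ^ 2) * x.snd z) := by
    rw [WithLp.add_snd, diffPart_snd, potOp_snd]
    filter_upwards [Lp.coeFn_add ((-4 * p * k : ℂ) • v.fst + (-4 * k ^ 2 : ℂ) • w.snd
        + (p ^ 2 - 1 : ℂ) • x.snd) (mulOp (pot12 s Q) x.fst + mulOp (pot22 s Q) x.snd),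
      Lp.coeFn_add ((-4 * p * k : ℂ) • v.fst + (-4 * k ^ 2 : ℂ) • w.snd) ((p ^ 2 - 1 : ℂ) • x.snd),
      Lp.coeFn_add ((-4 * p * k : ℂ) • v.fst) ((-4 * k ^ 2 : ℂ) • w.snd),
      Lp.coeFn_smul (-4 * p * k : ℂ) v.fst, Lp.coeFn_smul (-4 * k ^ 2 : ℂ) w.snd,
      Lp.coeFn_smul (p ^ 2 - 1 : ℂ) x.snd,
      Lp.coeFn_add (mulOp (pot12 s Q) x.fst) (mulOp (pot22 s Q) x.snd),
      mulOp_coeFn (pot12 s Q) x.fst, mulOp_coeFn (pot22 s Q) x.snd]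
      with z a1 a2 a3 a4 a5 a6 a7 a8 a9
    simp only [a1, a2, a3, a4, a5, a6, a7, a8, a9, Pi.add_apply, Pi.smul_apply, smul_eq_mul,
      pot22_apply, pot12_apply]
  constructor
  · intro h
    have f1 : y.fst = (diffPart k p x v w + potOp s Q x).fst := by
      apply Lp.ext
      filter_upwards [h, e1] with z hz hz1
      rw [(hz _ _ rfl rfl).1, hz1, hQ]
      ring
    have f2 : y.snd = (diffPart k p x v w + potOp s Q x).snd := by
      apply Lp.ext
      filter_upwards [h, e2] with z hz hz2
      rw [(hz _ _ rfl rfl).2, hz2, hQ]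
      ring
    exact WithLp.ofLp_injective 2 (Prod.ext f1 f2)
  · rintro rfl
    filter_upwards [e1, e2] with z hz1 hz2 R I hR hI
    rw [hz1, hz2, hR, hI, hQ]
    constructor <;> ring

theorem memℓp_comp_injective {α β : Type*} {f : β → ℂ} (hf : Memℓp f 2) {g : α → β}
    (hg : Function.Injective g) : Memℓp (fun i => f (g i)) 2 := by
  rw [memℓp_gen_iff (by norm_num)] at hf ⊢
  exact hf.comp_injective hg

theorem memℓp_inner_bas (τ : Bool) (z : L2per2) : Memℓp (fun n : ℤ => inner ℂ (bas (τ, n)) z) 2 := by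
  have h := lp.memℓp (bas.repr z)
  have h2 := memℓp_comp_injective h (g := fun n : ℤ => (τ, n)) fun a b hab => (Prod.ext_iff.1 hab).2
  simpa only [HilbertBasis.repr_apply_apply] using h2

theorem sq_le_dispersion {p p' : ℝ} (hp : |p - 1| ≤ 1 / 100) (hp' : |p' - 1| ≤ 1 / 100) (n : ℤ) :
    (n : ℝ) ^ 2 ≤ 2 * |dispersion p p' n| + 1 := by
  by_cases h0 : n = 0
  · rw [h0]
    simp only [Int.cast_zero]
    nlinarith [abs_nonneg (dispersion p p' 0)]
  by_cases h1 : n = -1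
  · rw [h1]
    push_cast
    nlinarith [abs_nonneg (dispersion p p' (-1))]
  have h2 := (dispersion_lower hp hp' h0 h1).2
  have h3 := le_abs_self (dispersion p p' n)
  have h4 : (n : ℝ) ^ 2 ≤ (1 + |(n : ℝ)|) ^ 2 := by
    rw [← sq_abs]
    gcongr
    linarith
  linarith

/-- Elliptic regularity: `Λ x` is square summable in coordinates and the symbol dominates `n²` up to
constants, so `x` has two weak derivatives. -/
theorem exists_weakDeriv_of_mem {p p' : ℝ} (hp : |p - 1| ≤ 1 / 100) (hp' : |p' - 1| ≤ 1 / 100)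
    {V : L2per2 →L[ℂ] L2per2} {x y : L2per2}
    (h : (x, y) ∈ diagGraph bas (fun i => dispersion p p' i.2) V) :
    ∃ v w : L2per2, IsWeakDeriv x.fst v.fst ∧ IsWeakDeriv x.snd v.snd ∧
      IsWeakDeriv v.fst w.fst ∧ IsWeakDeriv v.snd w.snd := by
  have hsq (τ : Bool) : Memℓp (fun n : ℤ => ((n : ℂ) ^ 2) * inner ℂ (bas (τ, n)) x) 2 := by
    have hz := (memℓp_inner_bas τ (y - V x)).const_mul 2
    have hx := memℓp_inner_bas τ x
    refine Memℓp.mono (hz.norm.add hx.norm) fun n => ?_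
    simp only [Pi.add_apply, h (τ, n), norm_mul, norm_pow, Complex.norm_intCast, Complex.norm_real,
      sq_abs, Real.norm_eq_abs, Complex.norm_ofNat]
    have := mul_le_mul_of_nonneg_right (sq_le_dispersion hp hp' n)
      (norm_nonneg (inner ℂ (bas (τ, n)) x))
    linarith
  have hneg (τ : Bool) : Memℓp (fun n : ℤ => ((n : ℂ) ^ 2) * inner ℂ (bas (τ, -n)) x) 2 := by
    have := memℓp_comp_injective (hsq τ) (g := fun n : ℤ => -n) neg_injective
    simpa using this
  have hfst : Memℓp (fun n : ℤ => -((n : ℂ) ^ 2 * hat n x.fst)) 2 := by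
    have := ((((hsq true).const_mul (-(1 / 2))).add ((hsq false).const_mul (-(Complex.I / 2)))).add
      ((hneg true).const_mul (-(1 / 2)))).add ((hneg false).const_mul (Complex.I / 2))
    refine Memℓp.mono' this fun n => le_of_eq (congrArg norm ?_)
    simp only [Pi.add_apply]
    rw [hat_fst_eq]
    simp only [bas_apply]
    ring
  have hsnd : Memℓp (fun n : ℤ => -((n : ℂ) ^ 2 * hat n x.snd)) 2 := by
    have := ((((hsq true).const_mul (Complex.I / 2)).add ((hsq false).const_mul (-(1 / 2)))).add
      ((hneg true).const_mul (-(Complex.I / 2)))).add ((hneg false).const_mul (-(1 / 2)))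
    refine Memℓp.mono' this fun n => le_of_eq (congrArg norm ?_)
    simp only [Pi.add_apply]
    rw [hat_snd_eq]
    simp only [bas_apply]
    ring
  -- The intermediate derivative comes for free, since `|n| ≤ n²` for integers.
  have hder (u : L2per) (hu : Memℓp (fun n : ℤ => -((n : ℂ) ^ 2 * hat n u)) 2) :
      ∃ v w : L2per, IsWeakDeriv u v ∧ IsWeakDeriv v w := by
    have h1 : Memℓp (fun n : ℤ => Complex.I * n * hat n u) 2 := by
      refine Memℓp.mono' hu fun n => ?_
      simp only [norm_mul, norm_neg, norm_pow, Complex.norm_I, one_mul, Complex.norm_intCast]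
      gcongr
      rcases eq_or_ne n 0 with h0 | h0
      · simp [h0]
      · have : (1 : ℝ) ≤ |(n : ℝ)| := by exact_mod_cast Int.one_le_abs h0
        nlinarith
    obtain ⟨v, hv⟩ := exists_weakDeriv h1 fun _ => rfl
    obtain ⟨w, hw⟩ := exists_weakDeriv (u := v) hu fun n => by
      rw [(isWeakDeriv_iff _ _).1 hv n]
      linear_combination (-((n : ℂ) ^ 2 * hat n u)) * Complex.I_sq
    exact ⟨v, w, hv, hw⟩
  obtain ⟨v1, w1, a1, b1⟩ := hder _ hfst
  obtain ⟨v2, w2, a2, b2⟩ := hder _ hsnd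
  exact ⟨WithLp.toLp 2 (v1, v2), WithLp.toLp 2 (w1, w2), a1, a2, b1, b2⟩

/-- The graph of the operator is diagonal in the adapted basis, up to the multiplication part. -/
theorem hessianGraph_eq {s k p p' : ℝ} (hp : |p - 1| ≤ 1 / 100) (hp' : |p' - 1| ≤ 1 / 100)
    (hk : k = (p + p') / 2) {Qf : ℝ → ℂ} {Q : C(AddCircle (2 * π), ℂ)}
    (hQ : ∀ z, liftIoc (2 * π) 0 Qf z = Q z) :
    hessianGraph s k p Qf = diagGraph bas (fun i => dispersion p p' i.2) (potOp s Q) := by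
  ext ⟨x, y⟩
  constructor
  · rintro ⟨v, w, h1, h2, h3, h4, h5⟩
    rw [ae_iff_eq_diffPart hQ x y v w] at h5
    intro i
    simp only
    rw [h5, add_sub_cancel_right, inner_diffPart hk h1 h2 h3 h4]
  · intro h
    obtain ⟨v, w, h1, h2, h3, h4⟩ := exists_weakDeriv_of_mem hp hp' h
    refine ⟨v, w, h1, h2, h3, h4, ?_⟩
    rw [ae_iff_eq_diffPart hQ x y v w, ← sub_eq_iff_eq_add]
    refine ext_inner_basis bas fun i => ?_
    rw [inner_diffPart hk h1 h2 h3 h4]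
    exact h i

theorem hessian_graph (s k p : ℝ) (Qf : ℝ → ℂ) :
    (hessian s k p Qf).graph = hessianGraph s k p Qf :=
  Submodule.toLinearPMap_graph_eq _ (hessianGraph_functional s k p Qf)

end PeriodicNLS

end

noncomputable section

namespace PeriodicNLS

/-! ### Decay of the coefficients of a wave -/

theorem IsScaledWave.weighted_le {s A B p p' : ℝ} {c : SeqSpace} (h : IsScaledWave s A B p p' c)
    (hs : |s| = 1) {n : ℤ} (h0 : n ≠ 0) (h1 : n ≠ -1) :
    (1 + |(n : ℝ)|) ^ 2 * |c n| ≤ 2 * amp ^ 2 * |cubic A B c n| := by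
  have h2 := (dispersion_lower h.abs_p h.abs_p' h0 h1).2
  have h3 := congrArg abs (h.equation n)
  rw [← cubic_apply h.abs_A h.abs_B, abs_mul, abs_mul, abs_neg, abs_mul, hs, one_mul,
    abs_of_nonneg (sq_nonneg amp)] at h3
  have h4 := le_abs_self (dispersion p p' n)
  have h5 := mul_le_mul_of_nonneg_right (h2.trans h4) (abs_nonneg (c n))
  rw [h3] at h5
  linarith

/-- The sequence `(1 + |n|)² |c n|`. -/
def IsWeighting (c d : SeqSpace) : Prop := ∀ n : ℤ, d n = (1 + |(n : ℝ)|) ^ 2 * |c n|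

theorem IsScaledWave.norm_cubic_le {s A B p p' : ℝ} {c : SeqSpace}
    (h : IsScaledWave s A B p p' c) : ‖cubic A B c‖ ≤ 27 := by
  refine (PeriodicNLS.norm_cubic_le h.abs_A h.abs_B c).trans ?_
  have := h.norm_c
  calc _ ≤ (3 : ℝ) * 3 * 3 := by gcongr
    _ = 27 := by norm_num

/-- The equation gains the weight `(1 + |n|)²` over the summable cubic term. The modes `0` and `-1`
contribute 1 and 4, and the factor `2 amp² · 27` makes all the others small. -/
theorem IsScaledWave.exists_weighting {s A B p p' : ℝ} {c : SeqSpace}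
    (h : IsScaledWave s A B p p' c) (hs : |s| = 1) : ∃ d : SeqSpace, IsWeighting c d ∧ ‖d‖ ≤ 6 ∧
      ∑' n, (if n = 0 ∨ n = -1 then 0 else |d n|) ≤ 1 / 100 := by
  have hcs : Summable fun n => 2 * amp ^ 2 * |cubic A B c n| :=
    (seq_summable _).mul_left _
  have hct : ∑' n, 2 * amp ^ 2 * |cubic A B c n| ≤ 1 / 100 := by
    rw [tsum_mul_left, ← seq_norm]
    have := h.norm_cubic_le
    have h2 : 2 * amp ^ 2 * ‖cubic A B c‖ ≤ 2 * amp ^ 2 * 27 := by gcongr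
    refine h2.trans ?_
    norm_num [amp]
  set f : ℤ → ℝ := fun n => if n = 0 ∨ n = -1 then 0 else (1 + |(n : ℝ)|) ^ 2 * |c n| with hf
  have hf0 (n : ℤ) : 0 ≤ f n := by
    simp only [hf]
    split_ifs <;> positivity
  have hfle (n : ℤ) : f n ≤ 2 * amp ^ 2 * |cubic A B c n| := by
    simp only [hf]
    split_ifs with h1
    · positivity
    · push Not at h1
      exact h.weighted_le hs h1.1 h1.2
  have hfs : Summable f := Summable.of_nonneg_of_le hf0 hfle hcs
  have hft : ∑' n, f n ≤ 1 / 100 := (hfs.tsum_le_tsum hfle hcs).trans hct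
  have hdec : (fun n : ℤ => (1 + |(n : ℝ)|) ^ 2 * |c n|) = fun n : ℤ =>
      (if n = 0 then 1 else 0) + (if n = -1 then 4 else 0) + f n := by
    funext n
    simp only [hf]
    by_cases h0 : n = 0
    · simp [h0, h.c_zero]
    by_cases h1 : n = -1
    · simp [h1, h.c_neg_one]
      norm_num
    simp [h0, h1]
  have t0 : HasSum (fun n : ℤ => if n = 0 then (1 : ℝ) else 0) 1 := hasSum_ite_eq 0 1
  have t1 : HasSum (fun n : ℤ => if n = -1 then (4 : ℝ) else 0) 4 := hasSum_ite_eq (-1) 4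
  have hall := (t0.add t1).add hfs.hasSum
  rw [← hdec] at hall
  have hpos (n : ℤ) : |((1 + |(n : ℝ)|) ^ 2 * |c n| : ℝ)| = (1 + |(n : ℝ)|) ^ 2 * |c n| :=
    abs_of_nonneg (by positivity)
  refine ⟨⟨fun n => (1 + |(n : ℝ)|) ^ 2 * |c n|, memSeq_iff.2 ?_⟩, fun n => rfl, ?_, ?_⟩
  · simp_rw [hpos]
    exact hall.summable
  · rw [seq_norm]
    simp only [hpos]
    rw [hall.tsum_eq]
    linarith
  · simp only [hpos]
    exact hft

theorem IsWeighting.mul_abs_le {c d : SeqSpace} (h : IsWeighting c d) {n : ℤ} {t : ℝ}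
    (ht : |t| ≤ 1 + |(n : ℝ)|) : |t| * |c n| ≤ d n := by
  rw [h n]
  have : 1 + |(n : ℝ)| ≤ (1 + |(n : ℝ)|) ^ 2 := by nlinarith [abs_nonneg (n : ℝ)]
  gcongr
  exact ht.trans this

/-! ### Tangent vectors and their residuals -/

/-- The monomial `A^|n| B^|n+1|`. -/
def mon (A B : ℝ) (n : ℤ) : ℝ := A ^ n.natAbs * B ^ (n + 1).natAbs

/-- The Fourier coefficients of the profile. -/
def profileCoeff (A B : ℝ) (c : ℤ → ℝ) (n : ℤ) : ℝ := amp * mon A B n * c n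

/-- The coefficients `g n A^(|n|-1) B^|n+1| c n`. -/
def tangentCoeff (A B : ℝ) (c : ℤ → ℝ) (g : ℤ → ℝ) (n : ℤ) : ℝ :=
  g n * (A ^ (n.natAbs - 1) * B ^ (n + 1).natAbs) * c n

/-- The linearized operator on sequences of coefficients. -/
def linSeq (s p p' ε : ℝ) (q h : ℤ → ℝ) (n : ℤ) : ℝ :=
  dispersion p p' n * h n + s * ∑' u : ℤ × ℤ, (h u.1 * q u.2 * q (u.1 + u.2 - n)
    + q u.1 * h u.2 * q (u.1 + u.2 - n) + ε * (q u.1 * q u.2 * h (u.1 + u.2 - n)))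

/-- The triangle inequality shows that the truncated subtraction in `expA` loses nothing; this is
the divisibility on which the scaling rests. -/
theorem expA_add (u : ℤ × ℤ) (n : ℤ) :
    expA u n + n.natAbs = u.1.natAbs + u.2.natAbs + (u.1 + u.2 - n).natAbs := by
  unfold expA
  omega

theorem expB_add (u : ℤ × ℤ) (n : ℤ) : expB u n + (n + 1).natAbs
    = (u.1 + 1).natAbs + (u.2 + 1).natAbs + (u.1 + u.2 - n + 1).natAbs := by
  unfold expB
  omega

/-- The truncated exponent is wrong only at `m = 0`, where `g` vanishes. -/
theorem mul_pow_sub_one_mul {g : ℤ → ℝ} (hg : g 0 = 0) (A : ℝ) (m : ℤ) (i : ℕ) :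
    g m * A ^ (m.natAbs - 1) * A ^ i = g m * A ^ (m.natAbs + i - 1) := by
  rcases eq_or_ne m 0 with h0 | h0
  · simp [h0, hg]
  · rw [mul_assoc, ← pow_add]
    congr 2
    omega

theorem abs_mon_le {A B : ℝ} (hA : |A| ≤ 1) (hB : |B| ≤ 1) (n : ℤ) : |mon A B n| ≤ 1 := by
  rw [mon, abs_mul, abs_pow, abs_pow]
  exact mul_le_one₀ (pow_le_one₀ (abs_nonneg _) hA) (by positivity)
    (pow_le_one₀ (abs_nonneg _) hB)

theorem summable_profileCoeff {A B : ℝ} (hA : |A| ≤ 1) (hB : |B| ≤ 1) (c : SeqSpace) :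
    Summable fun n => ‖profileCoeff A B c n‖ := by
  refine Summable.of_nonneg_of_le (fun _ => norm_nonneg _) (fun n => ?_)
    ((seq_summable c).mul_left |amp|)
  rw [profileCoeff, norm_mul, norm_mul]
  simp only [Real.norm_eq_abs]
  gcongr
  exact mul_le_of_le_one_right (abs_nonneg _) (abs_mon_le hA hB n)

theorem abs_tangentCoeff_le {A B : ℝ} (hA : |A| ≤ 1) (hB : |B| ≤ 1) {c d : SeqSpace}
    (hd : IsWeighting c d) {g : ℤ → ℝ} (hg : ∀ n : ℤ, |g n| ≤ 1 + |(n : ℝ)|) (n : ℤ) :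
    |tangentCoeff A B c g n| ≤ d n := by
  rw [tangentCoeff, abs_mul, abs_mul]
  refine le_trans ?_ (hd.mul_abs_le (hg n))
  gcongr
  refine mul_le_of_le_one_right (abs_nonneg _) ?_
  rw [abs_mul, abs_pow, abs_pow]
  exact mul_le_one₀ (pow_le_one₀ (abs_nonneg _) hA) (by positivity)
    (pow_le_one₀ (abs_nonneg _) hB)

theorem summable_tangentCoeff {A B : ℝ} (hA : |A| ≤ 1) (hB : |B| ≤ 1) {c d : SeqSpace}
    (hd : IsWeighting c d) {g : ℤ → ℝ} (hg : ∀ n : ℤ, |g n| ≤ 1 + |(n : ℝ)|) :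
    Summable fun n => ‖tangentCoeff A B c g n‖ :=
  Summable.of_nonneg_of_le (fun _ => norm_nonneg _) (fun n =>
    (abs_tangentCoeff_le hA hB hd hg n).trans (le_abs_self _)) (seq_summable d)

/-- Up to its factor `g`, each term of the linearized cubic sum is the same monomial `A^(expA + |n|
- 1) B^(expB + |n+1|)`. The wave equation rewrites the diagonal term as such a sum with factor `-g
n`, so only the combination of values of `g` remains. -/
theorem linSeq_tangentCoeff {s A B p p' : ℝ} {c : SeqSpace} (h : IsScaledWave s A B p p' c)
    {d : SeqSpace} (hd : IsWeighting c d) {g : ℤ → ℝ} (hg0 : g 0 = 0)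
    (hg : ∀ n : ℤ, |g n| ≤ 1 + |(n : ℝ)|) (ε : ℝ) (n : ℤ) :
    linSeq s p p' ε (profileCoeff A B c) (tangentCoeff A B c g) n = s * amp ^ 2 *
      ∑' u : ℤ × ℤ, (g u.1 + g u.2 + ε * g (u.1 + u.2 - n) - g n)
        * (A ^ (expA u n + n.natAbs - 1) * B ^ (expB u n + (n + 1).natAbs))
        * (c u.1 * c u.2 * c (u.1 + u.2 - n)) := by
  have hq := summable_profileCoeff h.abs_A h.abs_B c
  have ht := summable_tangentCoeff h.abs_A h.abs_B hd hg
  set q := profileCoeff A B c with hqd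
  set t := tangentCoeff A B c g with htd
  have s1 := (summable_norm_triple_fiber (R := ℝ) ht hq hq n).of_norm
  have s2 := (summable_norm_triple_fiber (R := ℝ) hq ht hq n).of_norm
  have s3 := (summable_norm_triple_fiber (R := ℝ) hq hq ht n).of_norm
  have hS := (s1.add s2).add (s3.mul_left ε)
  have hC := (summable_cubic h.abs_A h.abs_B c n).mul_left
    (amp ^ 2 * (g n * (A ^ (n.natAbs - 1) * B ^ (n + 1).natAbs)))
  have e1 : dispersion p p' n * t n = -(s * ∑' u : ℤ × ℤ,
      amp ^ 2 * (g n * (A ^ (n.natAbs - 1) * B ^ (n + 1).natAbs))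
        * (wt A B u n * (c u.1 * c u.2 * c (u.1 + u.2 - n)))) := by
    rw [tsum_mul_left]
    have := h.equation n
    simp only [htd, tangentCoeff]
    linear_combination (g n * (A ^ (n.natAbs - 1) * B ^ (n + 1).natAbs)) * this
  rw [linSeq, e1, neg_add_eq_sub, ← mul_sub, ← hS.tsum_sub hC, mul_assoc]
  congr 1
  rw [← tsum_mul_left]
  refine tsum_congr fun u => ?_
  have eB := expB_add u n
  have eA := expA_add u n
  have k0 : g n * A ^ (n.natAbs - 1) * A ^ expA u n = g n * A ^ (expA u n + n.natAbs - 1) := by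
    rw [mul_pow_sub_one_mul hg0, add_comm]
  have k1 : g u.1 * A ^ (u.1.natAbs - 1) * A ^ (u.2.natAbs + (u.1 + u.2 - n).natAbs)
      = g u.1 * A ^ (expA u n + n.natAbs - 1) := by
    rw [mul_pow_sub_one_mul hg0, eA, add_assoc]
  have k2 : g u.2 * A ^ (u.2.natAbs - 1) * A ^ (u.1.natAbs + (u.1 + u.2 - n).natAbs)
      = g u.2 * A ^ (expA u n + n.natAbs - 1) := by
    rw [mul_pow_sub_one_mul hg0, eA]
    congr 3
    omega
  have k3 : g (u.1 + u.2 - n) * A ^ ((u.1 + u.2 - n).natAbs - 1) * A ^ (u.1.natAbs + u.2.natAbs)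
      = g (u.1 + u.2 - n) * A ^ (expA u n + n.natAbs - 1) := by
    rw [mul_pow_sub_one_mul hg0, eA]
    congr 3
    omega
  simp only [hqd, htd, profileCoeff, tangentCoeff, mon, wt]
  rw [eB]
  rw [pow_add] at k1 k2 k3
  have eB' : B ^ (n + 1).natAbs * B ^ expB u n
      = B ^ (u.1 + 1).natAbs * B ^ (u.2 + 1).natAbs * B ^ (u.1 + u.2 - n + 1).natAbs := by
    rw [← pow_add, ← pow_add, ← pow_add, add_comm, eB]
  rw [pow_add, pow_add]
  linear_combination amp ^ 2 * (c u.1 * c u.2 * c (u.1 + u.2 - n)) *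
    (B ^ (u.1 + 1).natAbs * B ^ (u.2 + 1).natAbs * B ^ (u.1 + u.2 - n + 1).natAbs
      * (k1 + k2 + ε * k3 - k0)
      - g n * A ^ (n.natAbs - 1) * A ^ expA u n * eB')

/-- The kernel vectors of the linearized operator. -/
theorem linSeq_tangentCoeff_neg {s A B p p' : ℝ} {c : SeqSpace} (h : IsScaledWave s A B p p' c)
    {d : SeqSpace} (hd : IsWeighting c d) (n : ℤ) :
    linSeq s p p' (-1) (profileCoeff A B c) (tangentCoeff A B c fun m => -(m : ℝ)) n = 0 := by
  rw [linSeq_tangentCoeff h hd (by simp) (fun m => by rw [abs_neg]; linarith)]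
  -- For `g m = -m` and `ε = -1` the bracket `g u₁ + g u₂ - g (u₁+u₂-n) - g n` vanishes identically:
  -- this is invariance under the phase of one mode.
  rw [tsum_congr (g := fun _ => 0) fun u => by push_cast; ring]
  simp

/-- The residual of the derivative of the profile with respect to `A`. -/
def residual (A B : ℝ) (c : ℤ → ℝ) (u : ℤ × ℤ) (n : ℤ) : ℝ :=
  expA u n * (A ^ (expA u n + n.natAbs - 1) * B ^ (expB u n + (n + 1).natAbs))
    * (c u.1 * c u.2 * c (u.1 + u.2 - n))

/-- For `g = |·|` and `ε = 1` the bracket is `expA`: monomials without an excess power of `A` leave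
no residual. -/
theorem linSeq_tangentCoeff_abs {s A B p p' : ℝ} {c : SeqSpace} (h : IsScaledWave s A B p p' c)
    {d : SeqSpace} (hd : IsWeighting c d) (n : ℤ) :
    linSeq s p p' 1 (profileCoeff A B c) (tangentCoeff A B c fun m => |(m : ℝ)|) n
      = s * amp ^ 2 * ∑' u : ℤ × ℤ, residual A B c u n := by
  rw [linSeq_tangentCoeff h hd (by simp) (fun m => by rw [abs_abs]; linarith)]
  congr 1
  refine tsum_congr fun u => ?_
  have e : (expA u n : ℝ) + |(n : ℝ)| = |(u.1 : ℝ)| + |(u.2 : ℝ)| + |((u.1 + u.2 - n : ℤ) : ℝ)| := by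
    have := expA_add u n
    have h2 : ((expA u n + n.natAbs : ℕ) : ℝ)
      = ((u.1.natAbs + u.2.natAbs + (u.1 + u.2 - n).natAbs : ℕ) : ℝ) := by rw [this]
    simpa only [Nat.cast_add, Nat.cast_natAbs, Int.cast_abs] using h2
  rw [residual, one_mul, ← e, add_sub_cancel_right]

end PeriodicNLS

end

noncomputable section

namespace PeriodicNLS

/-! ### Estimates of the residuals -/

/-- Here `216 = 6³` comes from the norm bound on the weighted sequence. -/
theorem abs_tsum_fiber_le {d : SeqSpace} (hd : ‖d‖ ≤ 6) {n : ℤ} {K : ℝ} (hK : 0 ≤ K)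
    {g : ℤ × ℤ → ℝ} (hg : ∀ u, |g u| ≤ K * |d u.1 * d u.2 * d (u.1 + u.2 - n)|) :
    Summable g ∧ |∑' u, g u| ≤ 216 * K := by
  have h1 := (seq_triple_summable d d d).mul_left K
  have h2 := summable_fiber_of_le (g := fun t => K * |d t.1.1 * d t.1.2 * d (t.1.1 + t.1.2 - t.2)|)
    (G := fun t => K * |d t.1.1 * d t.1.2 * d (t.1.1 + t.1.2 - t.2)|)
    (fun t => (abs_of_nonneg (by positivity)).le) h1
  have h3 : Summable fun u : ℤ × ℤ => K * |d u.1 * d u.2 * d (u.1 + u.2 - n)| :=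
    (summable_norm_triple_fiber (R := ℝ) (seq_summable d) (seq_summable d)
      (seq_summable d) n).mul_left K
  have hs : Summable g := Summable.of_norm_bounded h3 hg
  refine ⟨hs, ?_⟩
  have h4 : |∑' u, g u| ≤ ∑' u : ℤ × ℤ, K * |d u.1 * d u.2 * d (u.1 + u.2 - n)| :=
    (norm_tsum_le_tsum_norm hs.norm).trans (hs.norm.tsum_le_tsum hg h3)
  have h5 := h2.1.le_tsum n fun _ _ => abs_nonneg _
  refine h4.trans ((le_abs_self _).trans (h5.trans (h2.2.trans ?_)))
  rw [tsum_mul_left, seq_triple_tsum]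
  have : ‖d‖ * ‖d‖ * ‖d‖ ≤ 6 * 6 * 6 := by gcongr
  nlinarith

theorem mul_pow_le_mul_pow {A B : ℝ} (hA : |A| ≤ 1) (hB : |B| ≤ 1) {i j i' j' : ℕ} (hi : i' ≤ i)
    (hj : j' ≤ j) : |A| ^ i * |B| ^ j ≤ |A| ^ i' * |B| ^ j' := by
  have h1 := pow_le_pow_of_le_one (abs_nonneg A) hA hi
  have h2 := pow_le_pow_of_le_one (abs_nonneg B) hB hj
  gcongr

/-- `expA` is even, since its absolute values add up to `2(u₁ + u₂ - n)` modulo 2. -/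
theorem two_le_expA {u : ℤ × ℤ} {n : ℤ} (h : expA u n ≠ 0) : 2 ≤ expA u n := by
  unfold expA at h ⊢
  omega

theorem two_le_expB_neg_one {u : ℤ × ℤ} (h : u ≠ (-1, -1)) : 2 ≤ expB u (-1) := by
  have h1 : ¬ (u.1 = -1 ∧ u.2 = -1) := fun h2 => h (Prod.ext h2.1 h2.2)
  unfold expB
  omega

/-- The two excluded pairs give the leading term `4AB`; every other monomial that contributes gains
a factor `A²` or `B²`. -/
theorem exp_zero_cases {u : ℤ × ℤ} (h1 : u ≠ (-1, 0)) (h2 : u ≠ (0, -1)) :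
    4 ≤ expA u 0 ∨ 2 ≤ expB u 0 := by
  have h1' : ¬ (u.1 = -1 ∧ u.2 = 0) := fun h2 => h1 (Prod.ext h2.1 h2.2)
  have h2' : ¬ (u.1 = 0 ∧ u.2 = -1) := fun h1 => h2 (Prod.ext h1.1 h1.2)
  unfold expA expB
  omega

/-- The factor `expA` grows linearly in the indices and is absorbed by the weights; this is why
residuals are measured with `d` rather than `c`. -/
theorem IsWeighting.abs_expA_mul_le {c d : SeqSpace} (h : IsWeighting c d) (u : ℤ × ℤ) (n : ℤ) :
    (expA u n : ℝ) * |c u.1 * c u.2 * c (u.1 + u.2 - n)|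
      ≤ |d u.1 * d u.2 * d (u.1 + u.2 - n)| := by
  have hb (m : ℤ) : (1 + |(m : ℝ)|) * |c m| ≤ |d m| := by
    have := h.mul_abs_le (n := m) (t := 1 + |(m : ℝ)|) (abs_of_nonneg (by positivity)).le
    rw [abs_of_nonneg (by positivity : 0 ≤ 1 + |(m : ℝ)|)] at this
    exact this.trans (le_abs_self _)
  have e : (expA u n : ℝ) ≤ |(u.1 : ℝ)| + |(u.2 : ℝ)| + |((u.1 + u.2 - n : ℤ) : ℝ)| := by
    have h1 : expA u n ≤ u.1.natAbs + u.2.natAbs + (u.1 + u.2 - n).natAbs := by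
      unfold expA
      omega
    have h2 : ((expA u n : ℕ) : ℝ)
      ≤ ((u.1.natAbs + u.2.natAbs + (u.1 + u.2 - n).natAbs : ℕ) : ℝ) := by exact_mod_cast h1
    simpa only [Nat.cast_add, Nat.cast_natAbs, Int.cast_abs] using h2
  have e2 : (expA u n : ℝ)
      ≤ (1 + |(u.1 : ℝ)|) * (1 + |(u.2 : ℝ)|) * (1 + |((u.1 + u.2 - n : ℤ) : ℝ)|) := by
    have a1 := abs_nonneg (u.1 : ℝ)
    have a2 := abs_nonneg (u.2 : ℝ)
    have a3 := abs_nonneg ((u.1 + u.2 - n : ℤ) : ℝ)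
    nlinarith [mul_nonneg a1 a2, mul_nonneg a1 a3, mul_nonneg a2 a3, mul_nonneg (mul_nonneg a1 a2) a3]
  rw [abs_mul, abs_mul, abs_mul, abs_mul]
  calc _ ≤ (1 + |(u.1 : ℝ)|) * (1 + |(u.2 : ℝ)|) * (1 + |((u.1 + u.2 - n : ℤ) : ℝ)|)
        * (|c u.1| * |c u.2| * |c (u.1 + u.2 - n)|) := by gcongr
    _ = ((1 + |(u.1 : ℝ)|) * |c u.1|) * ((1 + |(u.2 : ℝ)|) * |c u.2|)
        * ((1 + |((u.1 + u.2 - n : ℤ) : ℝ)|) * |c (u.1 + u.2 - n)|) := by ring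
    _ ≤ _ := by gcongr <;> exact hb _

theorem abs_residual_le {c d : SeqSpace} (h : IsWeighting c d) {A B K : ℝ} (hK0 : 0 ≤ K)
    {u : ℤ × ℤ} {n : ℤ}
    (hK : 2 ≤ expA u n →
      |A| ^ (expA u n + n.natAbs - 1) * |B| ^ (expB u n + (n + 1).natAbs) ≤ K) :
    |residual A B c u n| ≤ K * |d u.1 * d u.2 * d (u.1 + u.2 - n)| := by
  by_cases he : expA u n = 0
  · rw [residual, he]
    simp only [Nat.cast_zero, zero_mul, abs_zero]
    positivity
  have h1 := h.abs_expA_mul_le u n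
  rw [residual, abs_mul, abs_mul, abs_mul (A ^ _), abs_pow, abs_pow, Nat.abs_cast, mul_right_comm,
    mul_comm K]
  exact mul_le_mul h1 (hK (two_le_expA he)) (by positivity) (abs_nonneg _)

theorem summable_residual {A B : ℝ} (hA : |A| ≤ 1) (hB : |B| ≤ 1) {c d : SeqSpace}
    (h : IsWeighting c d) (hd : ‖d‖ ≤ 6) (n : ℤ) : Summable fun u => residual A B c u n := by
  refine (abs_tsum_fiber_le (n := n) hd zero_le_one fun u => ?_).1
  refine abs_residual_le h zero_le_one fun _ => ?_
  simpa using mul_pow_le_mul_pow hA hB (Nat.zero_le _) (Nat.zero_le _)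

/-- Only the self-interaction `u = (-1, -1)` is free of `B`; it yields `2A²`. -/
theorem abs_tsum_residual_neg_one {A B : ℝ} (hA : |A| ≤ 1) (hB : |B| ≤ 1) {c d : SeqSpace}
    (hc : c (-1) = 1) (h : IsWeighting c d) (hd : ‖d‖ ≤ 6) :
    |∑' u, residual A B c u (-1) - 2 * A ^ 2| ≤ 216 * (A ^ 2 * B ^ 2) := by
  have h1 : HasSum (fun u : ℤ × ℤ => if u = (-1, -1) then 2 * A ^ 2 else 0) (2 * A ^ 2) :=
    hasSum_ite_eq _ _
  have h2 := summable_residual hA hB h hd (-1)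
  rw [← h1.tsum_eq, ← h2.tsum_sub h1.summable]
  refine (abs_tsum_fiber_le (n := -1) hd (by positivity) fun u => ?_).2
  split_ifs with hu
  · have : residual A B c u (-1) = 2 * A ^ 2 := by
      rw [hu]
      simp [residual, expA, expB, hc]
    rw [this, sub_self, abs_zero]
    positivity
  · rw [sub_zero]
    refine abs_residual_le h (by positivity) fun he => ?_
    rw [← sq_abs A, ← sq_abs B]
    have := two_le_expB_neg_one hu
    exact mul_pow_le_mul_pow hA hB (by simp; omega) (by omega)

theorem abs_tsum_residual_zero {A B : ℝ} (hA : |A| ≤ 1) (hB : |B| ≤ 1) {c d : SeqSpace}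
    (hc : c (-1) = 1) (hc0 : c 0 = 1) (h : IsWeighting c d) (hd : ‖d‖ ≤ 6) :
    |∑' u, residual A B c u 0 - 4 * (A * B)| ≤ 216 * (|A| * |B| * (A ^ 2 + B ^ 2)) := by
  have h1 : HasSum (fun u : ℤ × ℤ => if u = (-1, 0) then 2 * (A * B) else 0) (2 * (A * B)) :=
    hasSum_ite_eq _ _
  have h1' : HasSum (fun u : ℤ × ℤ => if u = (0, -1) then 2 * (A * B) else 0) (2 * (A * B)) :=
    hasSum_ite_eq _ _
  have h3 := h1.add h1'
  have h2 := summable_residual hA hB h hd 0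
  rw [show 4 * (A * B) = 2 * (A * B) + 2 * (A * B) by ring, ← h3.tsum_eq, ← h2.tsum_sub h3.summable]
  refine (abs_tsum_fiber_le (n := 0) hd (by positivity) fun u => ?_).2
  by_cases hu : u = (-1, 0)
  · have : residual A B c u 0 = 2 * (A * B) := by
      rw [hu]
      simp [residual, expA, expB, hc, hc0]
    rw [this, if_pos hu, if_neg (by rw [hu]; simp), add_zero, sub_self, abs_zero]
    positivity
  by_cases hu' : u = (0, -1)
  · have : residual A B c u 0 = 2 * (A * B) := by
      rw [hu']
      simp [residual, expA, expB, hc, hc0]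
    rw [this, if_pos hu', if_neg hu, zero_add, sub_self, abs_zero]
    positivity
  rw [if_neg hu, if_neg hu', add_zero, sub_zero]
  refine abs_residual_le h (by positivity) fun he => ?_
  have e : |A| * |B| * (A ^ 2 + B ^ 2) = |A| ^ 3 * |B| ^ 1 + |A| ^ 1 * |B| ^ 3 := by
    rw [← sq_abs A, ← sq_abs B]
    ring
  rw [e]
  have p1 : 0 ≤ |A| ^ 3 * |B| ^ 1 := by positivity
  have p2 : 0 ≤ |A| ^ 1 * |B| ^ 3 := by positivity
  rcases exp_zero_cases hu hu' with h4 | h4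
  · have := mul_pow_le_mul_pow hA hB (i := expA u 0 + (0 : ℤ).natAbs - 1)
      (j := expB u 0 + (0 + 1 : ℤ).natAbs) (i' := 3) (j' := 1) (by simp; omega) (by simp)
    linarith
  · have := mul_pow_le_mul_pow hA hB (i := expA u 0 + (0 : ℤ).natAbs - 1)
      (j := expB u 0 + (0 + 1 : ℤ).natAbs) (i' := 1) (j' := 3) (by simp; omega) (by simp; omega)
    linarith

/-- Both bounds are needed: `A²` for the diagonal entries of the residual pairing and `|A||B|` for
the off-diagonal ones, each error being relative to the leading term of its entry. -/
theorem tsum_tail_residual {A B : ℝ} (hA : |A| ≤ 1) (hB : |B| ≤ 1) {c d : SeqSpace}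
    (h : IsWeighting c d) (hd : ‖d‖ ≤ 6) :
    (Summable fun n => |∑' u, residual A B c u n|) ∧
    ∑' n, (if n = 0 ∨ n = -1 then 0 else |∑' u, residual A B c u n|) ≤ 216 * A ^ 2 ∧
    ∑' n, (if n = 0 ∨ n = -1 then 0 else |∑' u, residual A B c u n|) ≤ 216 * (|A| * |B|) := by
  have hd3 : ‖d‖ * ‖d‖ * ‖d‖ ≤ 216 := by
    have : ‖d‖ * ‖d‖ * ‖d‖ ≤ 6 * 6 * 6 := by gcongr
    linarith
  have h1 := seq_triple_summable d d d
  refine ⟨?_, ?_⟩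
  · refine (summable_fiber_of_le (g := fun t => residual A B c t.1 t.2) (fun t => ?_)
      (h1.mul_left 1)).1
    refine abs_residual_le h zero_le_one fun _ => ?_
    simpa using mul_pow_le_mul_pow hA hB (Nat.zero_le _) (Nat.zero_le _)
  -- Off the modes `0` and `-1` both `|n|` and `|n+1|` are positive, and `expA ≥ 2`; this supplies
  -- the powers asked for.
  have key (K : ℝ) (hK : 0 ≤ K) (hb : ∀ (u : ℤ × ℤ) (n : ℤ), ¬ (n = 0 ∨ n = -1) → 2 ≤ expA u n →
      |A| ^ (expA u n + n.natAbs - 1) * |B| ^ (expB u n + (n + 1).natAbs) ≤ K) :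
      ∑' n, (if n = 0 ∨ n = -1 then 0 else |∑' u, residual A B c u n|) ≤ 216 * K := by
    have h2 := (summable_fiber_of_le
      (g := fun t => if t.2 = 0 ∨ t.2 = -1 then 0 else residual A B c t.1 t.2) (fun t => ?_)
      (h1.mul_left K)).2
    · rw [tsum_mul_left, seq_triple_tsum] at h2
      refine le_trans (le_of_eq ?_) (h2.trans (by nlinarith))
      refine tsum_congr fun n => ?_
      split_ifs with hn <;> simp
    · split_ifs with hn
      · rw [abs_zero]
        positivity
      · exact abs_residual_le h hK fun he => hb _ _ hn he
  constructor
  · refine key _ (by positivity) fun u n hn he => ?_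
    have := mul_pow_le_mul_pow hA hB (i := expA u n + n.natAbs - 1)
      (j := expB u n + (n + 1).natAbs) (i' := 2) (j' := 0) (by omega) (by omega)
    simpa using this
  · refine key _ (by positivity) fun u n hn he => ?_
    have := mul_pow_le_mul_pow hA hB (i := expA u n + n.natAbs - 1)
      (j := expB u n + (n + 1).natAbs) (i' := 1) (j' := 1) (by omega) (by omega)
    simpa using this

/-! ### The reflection exchanging the two amplitudes -/

/-- The involution `n ↦ -1 - n`. -/
def reflEquiv : ℤ ≃ ℤ where
  toFun n := -1 - n
  invFun n := -1 - n
  left_inv n := by ring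
  right_inv n := by ring

/-- The involution on pairs of indices. -/
def reflPair : ℤ × ℤ ≃ ℤ × ℤ := reflEquiv.prodCongr reflEquiv

/-- The reflected sequence `n ↦ c (-1 - n)`. -/
def reflSeq (c : SeqSpace) : SeqSpace :=
  ⟨fun n => c (-1 - n), memSeq_iff.2 (by
    have h := (seq_summable c).comp_injective reflEquiv.injective
    exact h)⟩

theorem reflSeq_apply (c : SeqSpace) (n : ℤ) : reflSeq c n = c (-1 - n) := rfl

theorem norm_reflSeq (c : SeqSpace) : ‖reflSeq c‖ = ‖c‖ := by
  rw [seq_norm, seq_norm]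
  exact reflEquiv.tsum_eq fun n => |c n|

theorem wt_refl (A B : ℝ) (u : ℤ × ℤ) (n : ℤ) :
    wt B A (reflPair u) n = wt A B u (-1 - n) := by
  have h1 : expA (reflPair u) n = expB u (-1 - n) := by
    change (-1 - u.1).natAbs + (-1 - u.2).natAbs + (-1 - u.1 + (-1 - u.2) - n).natAbs - n.natAbs = _
    unfold expB
    omega
  have h2 : expB (reflPair u) n = expA u (-1 - n) := by
    change (-1 - u.1 + 1).natAbs + (-1 - u.2 + 1).natAbs + (-1 - u.1 + (-1 - u.2) - n + 1).natAbs
      - (n + 1).natAbs = _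
    unfold expA
    omega
  rw [wt, wt, h1, h2, mul_comm]

theorem dispersion_refl (p p' : ℝ) (n : ℤ) : dispersion p' p n = dispersion p p' (-1 - n) := by
  unfold dispersion
  push_cast
  ring

theorem reflPair_third (u : ℤ × ℤ) (n : ℤ) :
    -1 - ((reflPair u).1 + (reflPair u).2 - n) = u.1 + u.2 - (-1 - n) := by
  change -1 - (-1 - u.1 + (-1 - u.2) - n) = _
  ring

theorem reflPair_fst (u : ℤ × ℤ) : -1 - (reflPair u).1 = u.1 := by
  change -1 - (-1 - u.1) = _
  ring

theorem reflPair_snd (u : ℤ × ℤ) : -1 - (reflPair u).2 = u.2 := by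
  change -1 - (-1 - u.2) = _
  ring

/-- The symmetry `x ↦ -x` of the equation exchanges the frequencies `p` and `-p'`, hence the two
amplitudes. Statements about `A` thus transfer to `B`. -/
theorem IsScaledWave.reflect {s A B p p' : ℝ} {c : SeqSpace} (h : IsScaledWave s A B p p' c) :
    IsScaledWave s B A p' p (reflSeq c) where
  abs_A := h.abs_B
  abs_B := h.abs_A
  abs_p := h.abs_p'
  abs_p' := h.abs_p
  c_zero := by rw [reflSeq_apply]; exact h.c_neg_one
  c_neg_one := by rw [reflSeq_apply]; exact h.c_zero
  norm_c := by rw [norm_reflSeq]; exact h.norm_c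
  equation n := by
    rw [dispersion_refl, reflSeq_apply, h.equation (-1 - n)]
    congr 1
    symm
    rw [← reflPair.tsum_eq]
    refine tsum_congr fun u => ?_
    simp only [wt_refl, reflSeq_apply, reflPair_third, reflPair_fst, reflPair_snd]

theorem profileCoeff_refl (A B : ℝ) (c : SeqSpace) (n : ℤ) :
    profileCoeff B A (reflSeq c) n = profileCoeff A B c (-1 - n) := by
  have h1 : (-1 - n).natAbs = (n + 1).natAbs := by omega
  have h2 : (-1 - n + 1).natAbs = n.natAbs := by omega
  rw [profileCoeff, profileCoeff, mon, mon, reflSeq_apply, h1, h2, mul_comm (B ^ _)]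

theorem linSeq_refl (s p p' ε : ℝ) (q h : ℤ → ℝ) (n : ℤ) :
    linSeq s p' p ε (fun m => q (-1 - m)) (fun m => h (-1 - m)) n
      = linSeq s p p' ε q h (-1 - n) := by
  rw [linSeq, linSeq, dispersion_refl, ← reflPair.tsum_eq]
  congr 2
  refine tsum_congr fun u => ?_
  simp only [reflPair_third, reflPair_fst, reflPair_snd]

theorem linSeq_reflected (s A B p p' ε : ℝ) (c : SeqSpace) (h : ℤ → ℝ) (n : ℤ) :
    linSeq s p p' ε (profileCoeff A B c) (fun m => h (-1 - m)) n
      = linSeq s p' p ε (profileCoeff B A (reflSeq c)) h (-1 - n) := by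
  rw [← linSeq_refl]
  congr 1
  funext m
  rw [profileCoeff_refl]
  congr 1
  ring

end PeriodicNLS

end

noncomputable section

namespace PeriodicNLS

open scoped ComplexConjugate

/-! ### Absolutely convergent Fourier series -/

theorem hasSum_of_eq {ι M : Type*} [AddCommMonoid M] [TopologicalSpace M] {f g : ι → M} {a : M}
    (h : ∀ i, f i = g i) (hg : HasSum g a) : HasSum f a := by
  rwa [funext h]

/-- The Fourier coefficient as a bounded functional on continuous functions. -/
def coeffCLM (n : ℤ) : C(AddCircle (2 * π), ℂ) →L[ℂ] ℂ :=
  (hat n).comp (ContinuousMap.toLp (E := ℂ) 2 haarAddCircle ℂ)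

theorem coeffCLM_apply (n : ℤ) (φ : C(AddCircle (2 * π), ℂ)) :
    coeffCLM n φ = fourierCoeff φ n := hat_toLp φ n

theorem coeffCLM_fourier (n m : ℤ) :
    coeffCLM n (fourier (T := 2 * π) m) = if n = m then 1 else 0 := by
  rw [coeffCLM_apply, ← hat_toLp]
  have : ContinuousMap.toLp (E := ℂ) 2 haarAddCircle ℂ (fourier (T := 2 * π) m)
      = fourierBasis (T := 2 * π) m := by
    rw [coe_fourierBasis]
  rw [this, hat_fourierBasis]

theorem fourierCoeff_fourier_mul (φ : C(AddCircle (2 * π), ℂ)) (j d : ℤ) :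
    fourierCoeff (fourier (T := 2 * π) j * φ : C(AddCircle (2 * π), ℂ)) d
      = fourierCoeff φ (d - j) := by
  rw [fourierCoeff, fourierCoeff]
  congr 1
  funext z
  rw [ContinuousMap.mul_apply, smul_eq_mul, smul_eq_mul, ← mul_assoc, ← fourier_add]
  congr 3
  ring

/-- The function with Fourier coefficients `q`. -/
def fourierSum (q : ℤ → ℝ) : C(AddCircle (2 * π), ℂ) := ∑' n, (q n : ℂ) • fourier n

section FourierSum

variable {q r : ℤ → ℝ}

theorem norm_smul_fourier (q : ℤ → ℝ) (n : ℤ) :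
    ‖(q n : ℂ) • fourier (T := 2 * π) n‖ = ‖q n‖ := by
  rw [norm_smul, fourier_norm, mul_one, Complex.norm_real]

theorem hasSum_fourierSum (hq : Summable fun n => ‖q n‖) :
    HasSum (fun n => (q n : ℂ) • fourier (T := 2 * π) n) (fourierSum q) := by
  refine Summable.hasSum (Summable.of_norm ?_)
  simpa only [norm_smul_fourier] using hq

theorem norm_fourierSum_le (hq : Summable fun n => ‖q n‖) : ‖fourierSum q‖ ≤ ∑' n, ‖q n‖ := by
  have h : Summable fun n => ‖(q n : ℂ) • fourier (T := 2 * π) n‖ := by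
    simpa only [norm_smul_fourier] using hq
  rw [fourierSum]
  have := norm_tsum_le_tsum_norm h
  simpa only [norm_smul_fourier] using this

theorem fourierCoeff_fourierSum (hq : Summable fun n => ‖q n‖) (n : ℤ) :
    fourierCoeff (fourierSum q) n = q n := by
  have h := (coeffCLM n).hasSum (hasSum_fourierSum hq)
  rw [← coeffCLM_apply]
  refine h.unique ?_
  refine hasSum_of_eq (fun m => ?_) (hasSum_ite_eq n (q n : ℂ))
  rw [map_smul, coeffCLM_fourier, smul_eq_mul]
  by_cases hm : m = n
  · simp [hm]
  · simp [hm, Ne.symm hm]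

theorem hasSum_fourierCoeff_mul (hq : Summable fun n => ‖q n‖) (hr : Summable fun n => ‖r n‖)
    (d : ℤ) : HasSum (fun j => q j * r (d - j) : ℤ → ℂ)
      (fourierCoeff (fourierSum q * fourierSum r : C(AddCircle (2 * π), ℂ)) d) := by
  have h := (coeffCLM d).hasSum ((hasSum_fourierSum hq).mul_right (fourierSum r))
  rw [coeffCLM_apply] at h
  refine hasSum_of_eq (fun j => ?_) h
  rw [smul_mul_assoc, map_smul, coeffCLM_apply, fourierCoeff_fourier_mul,
    fourierCoeff_fourierSum hr, smul_eq_mul]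

theorem star_fourierSum (hq : Summable fun n => ‖q n‖) :
    star (fourierSum q) = fourierSum fun n => q (-n) := by
  have hn : Summable fun n => ‖q (-n)‖ := hq.comp_injective neg_injective
  have h := (hasSum_fourierSum hq).star
  have h2 := (Equiv.neg ℤ).hasSum_iff.2 (hasSum_fourierSum hn)
  refine h.unique ?_
  refine hasSum_of_eq (fun n => ?_) h2
  ext z
  simp

theorem fourierCoeff_mul_star (hq : Summable fun n => ‖q n‖) (d : ℤ) :
    fourierCoeff (fourierSum q * star (fourierSum q) : C(AddCircle (2 * π), ℂ)) d
      = ((∑' j, q j * q (j - d) : ℝ) : ℂ) := by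
  have hn : Summable fun n => ‖q (-n)‖ := hq.comp_injective neg_injective
  rw [star_fourierSum hq, ← (hasSum_fourierCoeff_mul hq hn d).tsum_eq, Complex.ofReal_tsum]
  refine tsum_congr fun j => ?_
  rw [Complex.ofReal_mul, neg_sub]

theorem fourierCoeff_mul_self (hq : Summable fun n => ‖q n‖) (d : ℤ) :
    fourierCoeff (fourierSum q * fourierSum q : C(AddCircle (2 * π), ℂ)) d
      = ((∑' j, q j * q (d - j) : ℝ) : ℂ) := by
  rw [← (hasSum_fourierCoeff_mul hq hq d).tsum_eq, Complex.ofReal_tsum]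
  refine tsum_congr fun j => ?_
  rw [Complex.ofReal_mul]

theorem tsum_autocorrelation_neg (q : ℤ → ℝ) (d : ℤ) :
    ∑' j, q j * q (j - -d) = ∑' j, q j * q (j - d) := by
  rw [← (Equiv.subRight d).tsum_eq]
  refine tsum_congr fun j => ?_
  simp [mul_comm]

end FourierSum

/-! ### Vectors in the two invariant sectors -/

/-- The vector with coefficients `h` in the sector `τ`. -/
def sector (τ : Bool) (h : ℤ → ℝ) : L2per2 := ∑' m, (h m : ℂ) • bas (τ, m)

section Sector

variable {h y q : ℤ → ℝ}

theorem norm_smul_bas (τ : Bool) (h : ℤ → ℝ) (m : ℤ) : ‖(h m : ℂ) • bas (τ, m)‖ = ‖h m‖ := by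
  rw [norm_smul, bas.orthonormal.norm_eq_one, mul_one, Complex.norm_real]

theorem hasSum_sector (τ : Bool) (hh : Summable fun n => ‖h n‖) :
    HasSum (fun m => (h m : ℂ) • bas (τ, m)) (sector τ h) := by
  refine Summable.hasSum (Summable.of_norm ?_)
  simpa only [norm_smul_bas] using hh

theorem inner_bas_sector (τ : Bool) (hh : Summable fun n => ‖h n‖) (i : Bool × ℤ) :
    inner ℂ (bas i) (sector τ h) = if i.1 = τ then (h i.2 : ℂ) else 0 := by
  classical
  have h1 := (innerSL ℂ (bas i)).hasSum (hasSum_sector τ hh)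
  refine h1.unique ?_
  have e (m : ℤ) : (innerSL ℂ (bas i)) ((h m : ℂ) • bas (τ, m))
      = if m = i.2 then (if i.1 = τ then (h i.2 : ℂ) else 0) else 0 := by
    rw [map_smul, innerSL_apply_apply, orthonormal_iff_ite.1 bas.orthonormal, smul_eq_mul]
    obtain ⟨σ, n⟩ := i
    simp only [Prod.mk.injEq]
    by_cases hm : m = n
    · simp [hm]
    · simp [hm, Ne.symm hm]
  have h2 := hasSum_ite_eq i.2 (if i.1 = τ then (h i.2 : ℂ) else 0)
  refine hasSum_of_eq (fun m => ?_) h2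
  exact e m

/-- The reindexing of `(m, j)` by `(j, n + m - j)`. -/
def shearEquiv (n : ℤ) : ℤ × ℤ ≃ ℤ × ℤ where
  toFun v := (v.2, n + v.1 - v.2)
  invFun u := (u.1 + u.2 - n, u.1)
  left_inv v := by ext <;> simp
  right_inv u := by ext <;> simp

theorem hasSum_mul_autocorrelation (hh : Summable fun n => ‖h n‖) (hq : Summable fun n => ‖q n‖)
    (n : ℤ) : HasSum (fun m => h m * ∑' j, q j * q (j - (n - m)))
      (∑' u : ℤ × ℤ, h u.1 * q u.2 * q (u.1 + u.2 - n)) := by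
  have h1 := (summable_norm_triple_fiber (R := ℝ) hh hq hq n).of_norm
  have h2 := h1.hasSum.prod_fiberwise fun m => (h1.prod_factor m).hasSum
  refine hasSum_of_eq (fun m => ?_) h2
  rw [← tsum_mul_left]
  refine tsum_congr fun j => ?_
  rw [← mul_assoc, show j - (n - m) = m + j - n by ring]

theorem hasSum_mul_selfConvolution (hh : Summable fun n => ‖h n‖) (hq : Summable fun n => ‖q n‖)
    (n : ℤ) : HasSum (fun m => h m * ∑' j, q j * q (n + m - j))
      (∑' u : ℤ × ℤ, q u.1 * q u.2 * h (u.1 + u.2 - n)) := by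
  have h1 := (summable_norm_triple_fiber (R := ℝ) hq hq hh n).of_norm
  have h2 := (shearEquiv n).hasSum_iff.2 h1.hasSum
  have h3 := h2.prod_fiberwise fun m => (h2.summable.prod_factor m).hasSum
  refine hasSum_of_eq (fun m => ?_) h3
  rw [← tsum_mul_left]
  refine tsum_congr fun j => ?_
  change h m * (q j * q (n + m - j)) = q j * q (n + m - j) * h (j + (n + m - j) - n)
  rw [show j + (n + m - j) - n = m by ring, mul_comm]

/-- The sign of a sector. -/
def sgn (τ : Bool) : ℝ := if τ then 1 else -1

/-- The first two terms of the linearization agree after swapping `u₁` and `u₂` and produce the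
autocorrelation twice; the third produces the self-convolution with the sign of the sector. -/
theorem hasSum_sector_potential (hh : Summable fun n => ‖h n‖) (hq : Summable fun n => ‖q n‖)
    (s ε : ℝ) (n : ℤ) :
    HasSum (fun m => h m * (s * (2 * ∑' j, q j * q (j - (n - m)) + ε * ∑' j, q j * q (n + m - j))))
      (s * ∑' u : ℤ × ℤ, (h u.1 * q u.2 * q (u.1 + u.2 - n)
    + q u.1 * h u.2 * q (u.1 + u.2 - n) + ε * (q u.1 * q u.2 * h (u.1 + u.2 - n)))) := by
  have s1 := (summable_norm_triple_fiber (R := ℝ) hh hq hq n).of_norm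
  have s2 := (summable_norm_triple_fiber (R := ℝ) hq hh hq n).of_norm
  have s3 := (summable_norm_triple_fiber (R := ℝ) hq hq hh n).of_norm
  have e : ∑' u : ℤ × ℤ, q u.1 * h u.2 * q (u.1 + u.2 - n)
      = ∑' u : ℤ × ℤ, h u.1 * q u.2 * q (u.1 + u.2 - n) := by
    rw [← (Equiv.prodComm ℤ ℤ).tsum_eq]
    refine tsum_congr fun u => ?_
    simp only [Equiv.prodComm_apply, Prod.fst_swap, Prod.snd_swap]
    rw [add_comm u.2, mul_comm (q u.2)]
  rw [(s1.add s2).tsum_add (s3.mul_left ε), s1.tsum_add s2, e, tsum_mul_left, ← two_mul]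
  have := (((hasSum_mul_autocorrelation hh hq n).mul_left 2).add
    ((hasSum_mul_selfConvolution hh hq n).mul_left ε)).mul_left s
  refine hasSum_of_eq (fun m => ?_) this
  ring

theorem inner_potOp_eq (s : ℝ) (hq : Summable fun n => ‖q n‖) (τ : Bool) (n m : ℤ) :
    inner ℂ (bas (τ, n)) (potOp s (fourierSum q) (bas (τ, m)))
      = ((s * (2 * ∑' j, q j * q (j - (n - m)) + sgn τ * ∑' j, q j * q (n + m - j)) : ℝ) : ℂ) := by
  have h := inner_potOp (s := s) (Q := fourierSum q) (fourierCoeff_mul_star hq)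
    (tsum_autocorrelation_neg q) (fourierCoeff_mul_self hq) n m
  cases τ
  · rw [h.2.1, sgn]
    simp only [Bool.false_eq_true, if_false]
    push_cast
    ring
  · rw [h.1, sgn]
    simp only [if_true]
    push_cast
    ring

theorem inner_potOp_ne (s : ℝ) (hq : Summable fun n => ‖q n‖) {σ τ : Bool} (hστ : σ ≠ τ)
    (n m : ℤ) : inner ℂ (bas (σ, n)) (potOp s (fourierSum q) (bas (τ, m))) = 0 := by
  have h := inner_potOp (s := s) (Q := fourierSum q) (fourierCoeff_mul_star hq)
    (tsum_autocorrelation_neg q) (fourierCoeff_mul_self hq) n m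
  cases σ <;> cases τ
  · exact absurd rfl hστ
  · exact h.2.2.2
  · exact h.2.2.1
  · exact absurd rfl hστ

theorem inner_potOp_sector (s : ℝ) (hh : Summable fun n => ‖h n‖) (hq : Summable fun n => ‖q n‖)
    (τ : Bool) (i : Bool × ℤ) : inner ℂ (bas i) (potOp s (fourierSum q) (sector τ h))
      = if i.1 = τ then ((s * ∑' u : ℤ × ℤ, (h u.1 * q u.2 * q (u.1 + u.2 - i.2)
        + q u.1 * h u.2 * q (u.1 + u.2 - i.2)
        + sgn τ * (q u.1 * q u.2 * h (u.1 + u.2 - i.2))) : ℝ) : ℂ) else 0 := by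
  have h1 := ((innerSL ℂ (bas i)).comp (potOp s (fourierSum q))).hasSum (hasSum_sector τ hh)
  refine h1.unique ?_
  obtain ⟨σ, n⟩ := i
  by_cases hσ : σ = τ
  · subst hσ
    simp only [if_true]
    have h2 := (hasSum_sector_potential hh hq s (sgn σ) n)
    have h3 := Complex.hasSum_ofReal.2 h2
    refine hasSum_of_eq (fun m => ?_) h3
    rw [map_smul, ContinuousLinearMap.comp_apply, innerSL_apply_apply,
      inner_potOp_eq s hq, smul_eq_mul, Complex.ofReal_mul (h m)]
  · simp only [if_neg hσ]
    refine hasSum_of_eq (fun m => ?_) hasSum_zero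
    rw [map_smul, ContinuousLinearMap.comp_apply, innerSL_apply_apply,
      inner_potOp_ne s hq hσ, smul_zero]

/-- This transfers identities between coefficient sequences to the unbounded operator. -/
theorem sector_mem_diagGraph {s p p' : ℝ} (hh : Summable fun n => ‖h n‖)
    (hq : Summable fun n => ‖q n‖) (hy : Summable fun n => ‖y n‖) (τ : Bool)
    (hyh : ∀ n, linSeq s p p' (sgn τ) q h n = y n) :
    (sector τ h, sector τ y)
      ∈ diagGraph bas (fun i => dispersion p p' i.2) (potOp s (fourierSum q)) := by
  rw [mem_diagGraph]
  intro i
  rw [inner_bas_sector τ hh, inner_bas_sector τ hy, inner_potOp_sector s hh hq, ← hyh, linSeq]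
  split_ifs
  · push_cast
    ring
  · simp

end Sector

end PeriodicNLS

end

noncomputable section

namespace PeriodicNLS

/-! ### The approximate eigenvectors -/

/-- The sum of a nonnegative sequence outside of the two low modes. -/
def tailSum (h : ℤ → ℝ) : ℝ := ∑' n, if n = 0 ∨ n = -1 then 0 else |h n|

theorem tail_le_abs (h : ℤ → ℝ) (n : ℤ) : (if n = 0 ∨ n = -1 then 0 else |h n|) ≤ |h n| := by
  split_ifs
  · exact abs_nonneg _
  · exact le_rfl

theorem tail_nonneg (h : ℤ → ℝ) (n : ℤ) : 0 ≤ if n = 0 ∨ n = -1 then 0 else |h n| := by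
  split_ifs
  · exact le_rfl
  · exact abs_nonneg _

theorem summable_tail {h : ℤ → ℝ} (hh : Summable fun n => ‖h n‖) :
    Summable fun n => if n = 0 ∨ n = -1 then 0 else |h n| :=
  Summable.of_nonneg_of_le (tail_nonneg h) (tail_le_abs h) hh

theorem tailSum_nonneg (h : ℤ → ℝ) : 0 ≤ tailSum h := tsum_nonneg (tail_nonneg h)

theorem tailSum_mono {h h' : ℤ → ℝ} (hh' : Summable fun n => ‖h' n‖) (hle : ∀ n, |h n| ≤ |h' n|) :
    tailSum h ≤ tailSum h' := by
  have hh : Summable fun n => ‖h n‖ := Summable.of_nonneg_of_le (fun _ => norm_nonneg _) hle hh'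
  refine (summable_tail hh).tsum_le_tsum (fun n => ?_) (summable_tail hh')
  split_ifs
  · exact le_rfl
  · exact hle n

theorem tailSum_refl (h : ℤ → ℝ) : tailSum (fun n => h (-1 - n)) = tailSum h := by
  rw [tailSum, tailSum, ← reflEquiv.tsum_eq fun n => if n = 0 ∨ n = -1 then 0 else |h n|]
  refine tsum_congr fun n => ?_
  change _ = if -1 - n = 0 ∨ -1 - n = -1 then 0 else |h (-1 - n)|
  refine if_congr ?_ rfl rfl
  omega

/-- The coefficients of the derivative `w` of the profile with respect to the amplitude `A` of the
mode `m`, of the image `r` of `w` under the linearized operator, and of the derivative `v` with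
respect to the phase of this mode. -/
structure IsTangentPair (s A B p p' : ℝ) (q : ℤ → ℝ) (m m' : ℤ) (w r v : ℤ → ℝ) : Prop where
  summable_w : Summable fun n => ‖w n‖
  summable_r : Summable fun n => ‖r n‖
  summable_v : Summable fun n => ‖v n‖
  lin_w : ∀ n, linSeq s p p' 1 q w n = r n
  lin_v : ∀ n, linSeq s p p' (-1) q v n = 0
  w_self : w m = 1
  w_other : w m' = 0
  v_self : v m = 1
  v_other : v m' = 0
  tail_w : tailSum w ≤ 1 / 100
  tail_v : tailSum v ≤ 1 / 100
  r_self : |r m - 2 * (s * amp ^ 2 * A ^ 2)| ≤ amp ^ 2 * (216 * (A ^ 2 * B ^ 2))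
  r_other : |r m' - 4 * (s * amp ^ 2 * (A * B))|
    ≤ amp ^ 2 * (216 * (|A| * |B| * (A ^ 2 + B ^ 2)))
  tail_r : tailSum r ≤ amp ^ 2 * (216 * A ^ 2)
  tail_r' : tailSum r ≤ amp ^ 2 * (216 * (|A| * |B|))

theorem IsScaledWave.exists_tangentPair {s A B p p' : ℝ} {c : SeqSpace}
    (h : IsScaledWave s A B p p' c) (hs : |s| = 1) :
    ∃ w r v, IsTangentPair s A B p p' (profileCoeff A B c) (-1) 0 w r v := by
  obtain ⟨d, hd, hd6, hdt⟩ := h.exists_weighting hs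
  have hA := h.abs_A
  have hB := h.abs_B
  have hg1 (m : ℤ) : |(|(m : ℝ)|)| ≤ 1 + |(m : ℝ)| := by rw [abs_abs]; linarith
  have hg2 (m : ℤ) : |(-(m : ℝ))| ≤ 1 + |(m : ℝ)| := by rw [abs_neg]; linarith
  have htail {g : ℤ → ℝ} (hg : ∀ m : ℤ, |g m| ≤ 1 + |(m : ℝ)|) :
      tailSum (tangentCoeff A B c g) ≤ 1 / 100 :=
    (tailSum_mono (seq_summable d) fun n =>
      (abs_tangentCoeff_le hA hB hd hg n).trans (le_abs_self _)).trans hdt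
  have hr (t : ℝ) : |s * amp ^ 2 * t| = amp ^ 2 * |t| := by
    rw [abs_mul, abs_mul, hs, one_mul, abs_of_nonneg (sq_nonneg amp)]
  obtain ⟨k1, k2, k3⟩ := tsum_tail_residual hA hB hd hd6
  have htr : tailSum (fun n => s * amp ^ 2 * ∑' u, residual A B c u n)
      = amp ^ 2 * ∑' n, (if n = 0 ∨ n = -1 then 0 else |∑' u, residual A B c u n|) := by
    rw [tailSum, ← tsum_mul_left]
    refine tsum_congr fun n => ?_
    rw [hr]
    split_ifs <;> simp
  refine ⟨tangentCoeff A B c fun m => |(m : ℝ)|, fun n => s * amp ^ 2 * ∑' u, residual A B c u n,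
    tangentCoeff A B c fun m => -(m : ℝ), ?_⟩
  constructor
  · exact summable_tangentCoeff hA hB hd hg1
  · simp only [Real.norm_eq_abs, hr]
    exact k1.mul_left _
  · exact summable_tangentCoeff hA hB hd hg2
  · exact linSeq_tangentCoeff_abs h hd
  · exact linSeq_tangentCoeff_neg h hd
  · simp [tangentCoeff, h.c_neg_one]
  · simp [tangentCoeff]
  · simp [tangentCoeff, h.c_neg_one]
  · simp [tangentCoeff]
  · exact htail hg1
  · exact htail hg2
  · have := abs_tsum_residual_neg_one hA hB h.c_neg_one hd hd6
    rw [show s * amp ^ 2 * ∑' u, residual A B c u (-1) - 2 * (s * amp ^ 2 * A ^ 2)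
      = s * amp ^ 2 * (∑' u, residual A B c u (-1) - 2 * A ^ 2) by ring, hr]
    gcongr
  · have := abs_tsum_residual_zero hA hB h.c_neg_one h.c_zero hd hd6
    rw [show s * amp ^ 2 * ∑' u, residual A B c u 0 - 4 * (s * amp ^ 2 * (A * B))
      = s * amp ^ 2 * (∑' u, residual A B c u 0 - 4 * (A * B)) by ring, hr]
    gcongr
  · rw [htr]
    gcongr
  · rw [htr]
    gcongr

theorem IsScaledWave.exists_tangentPair' {s A B p p' : ℝ} {c : SeqSpace}
    (h : IsScaledWave s A B p p' c) (hs : |s| = 1) :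
    ∃ w r v, IsTangentPair s B A p p' (profileCoeff A B c) 0 (-1) w r v := by
  obtain ⟨w, r, v, H⟩ := h.reflect.exists_tangentPair hs
  have hsum {f : ℤ → ℝ} (hf : Summable fun n => ‖f n‖) : Summable fun n : ℤ => ‖f (-1 - n)‖ := by
    have := hf.comp_injective reflEquiv.injective
    exact this
  refine ⟨fun n => w (-1 - n), fun n => r (-1 - n), fun n => v (-1 - n), ?_⟩
  constructor
  · exact hsum H.summable_w
  · exact hsum H.summable_r
  · exact hsum H.summable_v
  · exact fun n => by rw [linSeq_reflected, H.lin_w]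
  · exact fun n => by rw [linSeq_reflected, H.lin_v]
  · exact H.w_self
  · exact H.w_other
  · exact H.v_self
  · exact H.v_other
  · rw [tailSum_refl]; exact H.tail_w
  · rw [tailSum_refl]; exact H.tail_v
  · exact H.r_self
  · exact H.r_other
  · rw [tailSum_refl]; exact H.tail_r
  · rw [tailSum_refl]; exact H.tail_r'

/-- The coordinates of `x` on the two low modes are exactly 1 and 0, so the error involves only the
tail of `h` times the distance of `x` from its basis vector: a product of two small quantities. -/
theorem norm_inner_sector_sub_le {h : ℤ → ℝ} (hh : Summable fun n => ‖h n‖) {x : L2per2} {v : ℝ}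
    {m m' : ℤ} (hm : m = 0 ∧ m' = -1 ∨ m = -1 ∧ m' = 0)
    (hx : ‖x - bas (true, m)‖ ≤ v) (h1 : inner ℂ (bas (true, m)) x = 1)
    (h2 : inner ℂ (bas (true, m')) x = 0) :
    ‖inner ℂ (sector true h) x - h m‖ ≤ v * tailSum h := by
  classical
  have hmm : m' ≠ m := by omega
  have e1 : HasSum (fun n => (h n : ℂ) * inner ℂ (bas (true, n)) x) (inner ℂ (sector true h) x) := by
    have := ((innerSL ℂ x).hasSum (hasSum_sector true hh)).star
    rw [innerSL_apply_apply, RCLike.star_def, inner_conj_symm] at this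
    refine hasSum_of_eq (fun n => ?_) this
    rw [map_smul, innerSL_apply_apply, smul_eq_mul, map_mul, inner_conj_symm,
      Complex.conj_ofReal]
  have e2 : HasSum (fun n => if n = m then (h m : ℂ) else 0) (h m) := hasSum_ite_eq _ _
  have e3 := e1.sub e2
  rw [← e3.tsum_eq, tailSum, ← tsum_mul_left]
  refine tsum_of_norm_bounded ((summable_tail hh).mul_left v).hasSum fun n => ?_
  have hv : 0 ≤ v := (norm_nonneg _).trans hx
  by_cases hn : n = m
  · rw [hn, h1, if_pos rfl, mul_one, sub_self, norm_zero]
    exact mul_nonneg hv (tail_nonneg h m)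
  rw [if_neg hn, sub_zero]
  by_cases hn' : n = m'
  · rw [hn', h2, mul_zero, norm_zero]
    exact mul_nonneg hv (tail_nonneg h m')
  rw [if_neg (by omega), norm_mul, Complex.norm_real, mul_comm v]
  refine mul_le_mul_of_nonneg_left ?_ (norm_nonneg _)
  have e4 : inner ℂ (bas (true, n)) x = inner ℂ (bas (true, n)) (x - bas (true, m)) := by
    rw [inner_sub_right, orthonormal_iff_ite.1 bas.orthonormal, if_neg (by simpa using hn), sub_zero]
  rw [e4]
  refine (norm_inner_le_norm _ _).trans ?_
  rw [bas.orthonormal.norm_eq_one, one_mul]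
  exact hx

theorem norm_sector_sub_bas_le {h : ℤ → ℝ} (hh : Summable fun n => ‖h n‖) (τ : Bool)
    {m m' : ℤ} (hm : m = 0 ∧ m' = -1 ∨ m = -1 ∧ m' = 0) (h1 : h m = 1) (h2 : h m' = 0) :
    ‖sector τ h - bas (τ, m)‖ ≤ tailSum h := by
  have e2 : HasSum (fun n => if n = m then bas (τ, m) else 0) (bas (τ, m)) := hasSum_ite_eq _ _
  have e3 := (hasSum_sector τ hh).sub e2
  rw [← e3.tsum_eq, tailSum]
  refine tsum_of_norm_bounded (summable_tail hh).hasSum fun n => ?_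
  by_cases hn : n = m
  · rw [hn, h1, if_pos rfl, Complex.ofReal_one, one_smul, sub_self, norm_zero]
    split_ifs <;> simp
  rw [if_neg hn, sub_zero]
  by_cases hn' : n = m'
  · rw [hn', h2, Complex.ofReal_zero, zero_smul, norm_zero]
    split_ifs <;> simp
  rw [if_neg (by omega), norm_smul_bas, Real.norm_eq_abs]

/-! ### The reduced matrix -/

theorem norm_mul_sub_mul_le {x y a b : ℂ} {e f M N : ℝ} (hx : ‖x - a‖ ≤ e) (hy : ‖y - b‖ ≤ f)
    (ha : ‖a‖ ≤ M) (hb : ‖b‖ ≤ N) : ‖x * y - a * b‖ ≤ M * f + N * e + e * f := by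
  have e1 : x * y - a * b = a * (y - b) + b * (x - a) + (x - a) * (y - b) := by ring
  rw [e1]
  refine (norm_add₃_le).trans ?_
  rw [norm_mul, norm_mul, norm_mul]
  have := (norm_nonneg _).trans ha
  have := (norm_nonneg _).trans hb
  have := (norm_nonneg _).trans hx
  gcongr

/-- The matrices `G`, `N`, `R` are the Gram matrix, the reduced operator and the residual pairing. -/
structure IsReduced (s A B : ℝ) (G N R : Matrix (Fin 2) (Fin 2) ℂ) : Prop where
  mul_eq : G * N = R
  small : A ^ 2 + B ^ 2 ≤ 1 / 10000
  abs_s : |s| = 1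
  g00 : ‖G 0 0 - 1‖ ≤ A ^ 2 + B ^ 2
  g01 : ‖G 0 1‖ ≤ A ^ 2 + B ^ 2
  g10 : ‖G 1 0‖ ≤ A ^ 2 + B ^ 2
  g11 : ‖G 1 1 - 1‖ ≤ A ^ 2 + B ^ 2
  r00 : ‖R 0 0 - (2 * (s * amp ^ 2 * A ^ 2) : ℝ)‖ ≤ amp ^ 2 * (432 * A ^ 2 * (A ^ 2 + B ^ 2))
  r01 : ‖R 0 1 - (4 * (s * amp ^ 2 * (A * B)) : ℝ)‖
    ≤ amp ^ 2 * (432 * (|A| * |B|) * (A ^ 2 + B ^ 2))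
  r10 : ‖R 1 0 - (4 * (s * amp ^ 2 * (A * B)) : ℝ)‖
    ≤ amp ^ 2 * (432 * (|A| * |B|) * (A ^ 2 + B ^ 2))
  r11 : ‖R 1 1 - (2 * (s * amp ^ 2 * B ^ 2) : ℝ)‖ ≤ amp ^ 2 * (432 * B ^ 2 * (A ^ 2 + B ^ 2))

/-! ### Determinant and trace of the reduced matrix. -/

section Reduced

variable {s A B : ℝ} {G N R : Matrix (Fin 2) (Fin 2) ℂ}

/-- The determinant is multiplicative, so `det N = det R / det G`. The leading part of `det R` is
`(4 - 16) amp⁴ A²B²`, since `s² = 1`, and each error carries the factor `A²B²` because the entry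
errors are relative. -/
theorem IsReduced.norm_det_add_le (h : IsReduced s A B G N R) :
    ‖N.det + (12 * (amp ^ 2) ^ 2 * (A ^ 2 * B ^ 2) : ℝ)‖
      ≤ 14000 * (amp ^ 2) ^ 2 * (A ^ 2 * B ^ 2 * (A ^ 2 + B ^ 2)) := by
  set t := A ^ 2 + B ^ 2 with ht
  have ht0 : 0 ≤ t := by positivity
  have ht1 : t ≤ 1 / 10000 := h.small
  set a := amp ^ 2 with ha
  have ha0 : 0 ≤ a := sq_nonneg _
  set P := A ^ 2 * B ^ 2 with hP
  have hP0 : 0 ≤ P := by positivity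
  have hAB : (|A| * |B|) * (|A| * |B|) = P := by
    rw [hP, ← sq_abs A, ← sq_abs B]; ring
  have habs (k x : ℝ) (hk : 0 ≤ k) : ‖((k * (s * a * x) : ℝ) : ℂ)‖ = k * (a * |x|) := by
    rw [Complex.norm_real, Real.norm_eq_abs, abs_mul, abs_mul, abs_mul, h.abs_s, one_mul,
      abs_of_nonneg hk, abs_of_nonneg ha0]
  have hs2 : s * s = 1 := by
    rw [← abs_mul_abs_self, h.abs_s, one_mul]
  have d1 := norm_mul_sub_mul_le h.r00 h.r11 (habs 2 _ (by norm_num)).le (habs 2 _ (by norm_num)).le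
  have d2 := norm_mul_sub_mul_le h.r01 h.r10 (habs 4 _ (by norm_num)).le (habs 4 _ (by norm_num)).le
  rw [abs_of_nonneg (sq_nonneg A), abs_of_nonneg (sq_nonneg B)] at d1
  rw [abs_mul] at d2
  -- Here `1728 + 186624 t < 1750` because `t ≤ 1/10000`.
  have d1' : ‖R 0 0 * R 1 1 - (4 * a ^ 2 * P : ℝ)‖ ≤ a ^ 2 * P * t * 1750 := by
    have e : (2 * (s * a * A ^ 2) * (2 * (s * a * B ^ 2)) : ℝ) = 4 * a ^ 2 * P := by
      rw [hP]; linear_combination (4 * a ^ 2 * A ^ 2 * B ^ 2) * hs2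
    rw [← Complex.ofReal_mul, e] at d1
    refine d1.trans ?_
    have e2 : 2 * (a * A ^ 2) * (a * (432 * B ^ 2 * t)) + 2 * (a * B ^ 2) * (a * (432 * A ^ 2 * t))
        + a * (432 * A ^ 2 * t) * (a * (432 * B ^ 2 * t))
        = a ^ 2 * P * t * (1728 + 186624 * t) := by rw [hP]; ring
    rw [e2]
    gcongr
    linarith
  have d2' : ‖R 0 1 * R 1 0 - (16 * a ^ 2 * P : ℝ)‖ ≤ a ^ 2 * P * t * 3480 := by
    have e : (4 * (s * a * (A * B)) * (4 * (s * a * (A * B))) : ℝ) = 16 * a ^ 2 * P := by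
      rw [hP]; linear_combination (16 * a ^ 2 * A ^ 2 * B ^ 2) * hs2
    rw [← Complex.ofReal_mul, e] at d2
    refine d2.trans ?_
    have e2 : 4 * (a * (|A| * |B|)) * (a * (432 * (|A| * |B|) * t))
        + 4 * (a * (|A| * |B|)) * (a * (432 * (|A| * |B|) * t))
        + a * (432 * (|A| * |B|) * t) * (a * (432 * (|A| * |B|) * t))
        = a ^ 2 * P * t * (3456 + 186624 * t) := by rw [← hAB]; ring
    rw [e2]
    gcongr
    linarith
  have dR : ‖R.det + (12 * a ^ 2 * P : ℝ)‖ ≤ a ^ 2 * P * t * 5230 := by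
    rw [Matrix.det_fin_two]
    have e : R 0 0 * R 1 1 - R 0 1 * R 1 0 + (12 * a ^ 2 * P : ℝ)
        = (R 0 0 * R 1 1 - (4 * a ^ 2 * P : ℝ)) - (R 0 1 * R 1 0 - (16 * a ^ 2 * P : ℝ)) := by
      push_cast; ring
    rw [e]
    refine (norm_sub_le _ _).trans ?_
    linarith
  have dG : ‖G.det - 1‖ ≤ 3 * t := by
    rw [Matrix.det_fin_two]
    have c1 := norm_mul_sub_mul_le h.g00 h.g11 (by simp : ‖(1 : ℂ)‖ ≤ 1) (by simp : ‖(1 : ℂ)‖ ≤ 1)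
    have c2 : ‖G 0 1 * G 1 0‖ ≤ t * t := by
      rw [norm_mul]; exact mul_le_mul h.g01 h.g10 (norm_nonneg _) ht0
    have e : G 0 0 * G 1 1 - G 0 1 * G 1 0 - 1 = (G 0 0 * G 1 1 - 1 * 1) - G 0 1 * G 1 0 := by ring
    rw [e]
    refine (norm_sub_le _ _).trans ?_
    nlinarith
  have hdet : G.det * N.det = R.det := by rw [← Matrix.det_mul, h.mul_eq]
  have hGlow : 1 / 2 ≤ ‖G.det‖ := by
    have := norm_sub_norm_le (1 : ℂ) (1 - G.det)
    rw [norm_one, sub_sub_cancel, norm_sub_rev] at this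
    linarith
  -- The errors `5230` from `R` and `36` from `det G - 1` stay below 5300; dividing by `‖det G‖ ≥
  -- 1/2` gives at most 10600.
  have key : ‖G.det‖ * ‖N.det + (12 * a ^ 2 * P : ℝ)‖ ≤ a ^ 2 * P * t * 5300 := by
    rw [← norm_mul]
    have e : G.det * (N.det + (12 * a ^ 2 * P : ℝ)) = (R.det + (12 * a ^ 2 * P : ℝ))
        + (G.det - 1) * (12 * a ^ 2 * P : ℝ) := by rw [← hdet]; ring
    rw [e]
    refine (norm_add_le _ _).trans ?_
    rw [norm_mul, Complex.norm_real, Real.norm_of_nonneg (by positivity)]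
    have : ‖G.det - 1‖ * (12 * a ^ 2 * P) ≤ 3 * t * (12 * a ^ 2 * P) := by gcongr
    nlinarith [mul_nonneg (mul_nonneg (sq_nonneg a) hP0) ht0]
  have h0 := norm_nonneg (N.det + (12 * a ^ 2 * P : ℝ))
  nlinarith [mul_le_mul_of_nonneg_right hGlow h0, mul_nonneg (mul_nonneg (sq_nonneg a) hP0) ht0]

/-- The trace is not multiplicative, so `G N = R` is solved column by column: `N` differs from `R`
by `O(t)` times `N` itself. An error relative to `A² + B²` is enough here. -/
theorem IsReduced.norm_trace_sub_le (h : IsReduced s A B G N R) :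
    ‖N.trace - (2 * (s * amp ^ 2 * (A ^ 2 + B ^ 2)) : ℝ)‖ ≤ amp ^ 2 * (A ^ 2 + B ^ 2) := by
  set t := A ^ 2 + B ^ 2 with ht
  have ht0 : 0 ≤ t := by positivity
  have ht1 : t ≤ 1 / 10000 := h.small
  set a := amp ^ 2 with ha
  have ha0 : 0 ≤ a := sq_nonneg _
  have hat : 0 ≤ a * t := mul_nonneg ha0 ht0
  have hAB : |A| * |B| ≤ t / 2 := by
    rw [ht, ← sq_abs A, ← sq_abs B]; nlinarith [sq_nonneg (|A| - |B|)]
  have habs (k x : ℝ) (hk : 0 ≤ k) : ‖((k * (s * a * x) : ℝ) : ℂ)‖ = k * (a * |x|) := by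
    rw [Complex.norm_real, Real.norm_eq_abs, abs_mul, abs_mul, abs_mul, h.abs_s, one_mul,
      abs_of_nonneg hk, abs_of_nonneg ha0]
  have hR {x y : ℂ} {e M : ℝ} (h1 : ‖x - y‖ ≤ e) (h2 : ‖y‖ ≤ M) : ‖x‖ ≤ e + M := by
    have := norm_add_le (x - y) y
    rw [sub_add_cancel] at this
    linarith
  have hA2 : A ^ 2 ≤ t := by rw [ht]; nlinarith [sq_nonneg B]
  have hB2 : B ^ 2 ≤ t := by rw [ht]; nlinarith [sq_nonneg A]
  have htt : a * (432 * t * t) ≤ a * t := by nlinarith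
  have b00 : ‖R 0 0‖ ≤ 3 * (a * t) := by
    refine (hR h.r00 (habs 2 _ (by norm_num)).le).trans ?_
    rw [abs_of_nonneg (sq_nonneg A)]
    have : a * (432 * A ^ 2 * t) ≤ a * (432 * t * t) := by gcongr
    have : a * A ^ 2 ≤ a * t := by gcongr
    linarith
  have b11 : ‖R 1 1‖ ≤ 3 * (a * t) := by
    refine (hR h.r11 (habs 2 _ (by norm_num)).le).trans ?_
    rw [abs_of_nonneg (sq_nonneg B)]
    have : a * (432 * B ^ 2 * t) ≤ a * (432 * t * t) := by gcongr
    have : a * B ^ 2 ≤ a * t := by gcongr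
    linarith
  have boff : 4 * (a * (|A| * |B|)) + a * (432 * (|A| * |B|) * t) ≤ 3 * (a * t) := by
    have h1 : a * (432 * (|A| * |B|) * t) ≤ a * (432 * (t / 2) * t) := by gcongr
    have h2 : a * (|A| * |B|) ≤ a * (t / 2) := by gcongr
    linarith
  have b01 : ‖R 0 1‖ ≤ 3 * (a * t) := by
    have := hR h.r01 (habs 4 _ (by norm_num)).le
    rw [abs_mul] at this
    linarith
  have b10 : ‖R 1 0‖ ≤ 3 * (a * t) := by
    have := hR h.r10 (habs 4 _ (by norm_num)).le
    rw [abs_mul] at this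
    linarith
  have eq (i k : Fin 2) : G i 0 * N 0 k + G i 1 * N 1 k = R i k := by
    rw [← h.mul_eq, Matrix.mul_apply, Fin.sum_univ_two]
  have col (k : Fin 2) (h0 : ‖R 0 k‖ ≤ 3 * (a * t)) (h1 : ‖R 1 k‖ ≤ 3 * (a * t)) :
      ‖N 0 k‖ + ‖N 1 k‖ ≤ 7 * (a * t) ∧ ‖N 0 k - R 0 k‖ ≤ t * (‖N 0 k‖ + ‖N 1 k‖) ∧
        ‖N 1 k - R 1 k‖ ≤ t * (‖N 0 k‖ + ‖N 1 k‖) := by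
    have e0 : N 0 k - R 0 k = -((G 0 0 - 1) * N 0 k + G 0 1 * N 1 k) := by rw [← eq 0 k]; ring
    have e1 : N 1 k - R 1 k = -(G 1 0 * N 0 k + (G 1 1 - 1) * N 1 k) := by rw [← eq 1 k]; ring
    have f0 : ‖N 0 k - R 0 k‖ ≤ t * (‖N 0 k‖ + ‖N 1 k‖) := by
      rw [e0, norm_neg, mul_add]
      refine (norm_add_le _ _).trans ?_
      rw [norm_mul, norm_mul]
      exact add_le_add (mul_le_mul_of_nonneg_right h.g00 (norm_nonneg _))
        (mul_le_mul_of_nonneg_right h.g01 (norm_nonneg _))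
    have f1 : ‖N 1 k - R 1 k‖ ≤ t * (‖N 0 k‖ + ‖N 1 k‖) := by
      rw [e1, norm_neg, mul_add]
      refine (norm_add_le _ _).trans ?_
      rw [norm_mul, norm_mul]
      exact add_le_add (mul_le_mul_of_nonneg_right h.g10 (norm_nonneg _))
        (mul_le_mul_of_nonneg_right h.g11 (norm_nonneg _))
    have k0 := hR f0 h0
    have k1 := hR f1 h1
    refine ⟨?_, f0, f1⟩
    nlinarith [norm_nonneg (N 0 k), norm_nonneg (N 1 k)]
  obtain ⟨c0, c1, -⟩ := col 0 b00 b10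
  obtain ⟨c2, -, c3⟩ := col 1 b01 b11
  rw [Matrix.trace_fin_two]
  have e : N 0 0 + N 1 1 - (2 * (s * a * t) : ℝ) = (N 0 0 - R 0 0) + (N 1 1 - R 1 1)
      + ((R 0 0 - (2 * (s * a * A ^ 2) : ℝ)) + (R 1 1 - (2 * (s * a * B ^ 2) : ℝ))) := by
    rw [ht]; push_cast; ring
  rw [e]
  refine (norm_add_le _ _).trans ?_
  have n1 := norm_add_le (N 0 0 - R 0 0) (N 1 1 - R 1 1)
  have n2 := (norm_add_le (R 0 0 - (2 * (s * a * A ^ 2) : ℝ)) (R 1 1 - (2 * (s * a * B ^ 2) : ℝ))).trans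
    (add_le_add h.r00 h.r11)
  have n3 : a * (432 * A ^ 2 * t) + a * (432 * B ^ 2 * t) = a * t * (432 * t) := by
    rw [ht]; ring
  rw [n3] at n2
  have n4 : t * (‖N 0 0‖ + ‖N 1 0‖) ≤ t * (7 * (a * t)) := by gcongr
  have n5 : t * (‖N 0 1‖ + ‖N 1 1‖) ≤ t * (7 * (a * t)) := by gcongr
  nlinarith

end Reduced

end PeriodicNLS

end

noncomputable section

namespace PeriodicNLS

/-! ### The spectrum at a small wave -/

/-- For every integer `n`, one of `|n|` and `|n + 1|` is at least 1. -/
theorem abs_mon_le_sqrt {A B : ℝ} (hA : |A| ≤ 1) (hB : |B| ≤ 1) (n : ℤ) :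
    |mon A B n| ≤ √(A ^ 2 + B ^ 2) := by
  rw [mon, abs_mul, abs_pow, abs_pow]
  rcases le_or_gt 0 n with hn | hn
  · have h1 := mul_pow_le_mul_pow hA hB (Nat.zero_le n.natAbs)
      (show 1 ≤ (n + 1).natAbs by omega)
    rw [pow_zero, one_mul, pow_one] at h1
    exact h1.trans (Real.abs_le_sqrt (by nlinarith [sq_nonneg A]))
  · have h1 := mul_pow_le_mul_pow hA hB (show 1 ≤ n.natAbs by omega)
      (Nat.zero_le (n + 1).natAbs)
    rw [pow_zero, mul_one, pow_one] at h1
    exact h1.trans (Real.abs_le_sqrt (by nlinarith [sq_nonneg B]))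

theorem IsScaledWave.norm_profile_le {s A B p p' : ℝ} {c : SeqSpace}
    (h : IsScaledWave s A B p p' c) :
    ‖fourierSum (profileCoeff A B c)‖ ≤ 3 * amp * √(A ^ 2 + B ^ 2) := by
  refine (norm_fourierSum_le (summable_profileCoeff h.abs_A h.abs_B c)).trans ?_
  have h1 : ∑' n, ‖profileCoeff A B c n‖ ≤ ∑' n, amp * √(A ^ 2 + B ^ 2) * |c n| := by
    refine (summable_profileCoeff h.abs_A h.abs_B c).tsum_le_tsum (fun n => ?_)
      ((seq_summable c).mul_left _)
    rw [profileCoeff, norm_mul, norm_mul]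
    simp only [Real.norm_eq_abs]
    rw [abs_of_nonneg (by norm_num [amp] : 0 ≤ amp)]
    have ha : 0 ≤ amp := by norm_num [amp]
    gcongr
    exact abs_mon_le_sqrt h.abs_A h.abs_B n
  refine h1.trans ?_
  rw [tsum_mul_left, ← seq_norm]
  have h2 := h.norm_c
  have h3 : 0 ≤ amp * √(A ^ 2 + B ^ 2) := mul_nonneg (by norm_num [amp]) (Real.sqrt_nonneg _)
  nlinarith

theorem IsScaledWave.norm_potOp_le {s A B p p' : ℝ} {c : SeqSpace}
    (h : IsScaledWave s A B p p' c) (hs : |s| = 1) :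
    ‖potOp s (fourierSum (profileCoeff A B c))‖ ≤ (A ^ 2 + B ^ 2) / 100 := by
  refine (PeriodicNLS.norm_potOp_le hs _).trans ?_
  have h1 := pow_le_pow_left₀ (norm_nonneg _) h.norm_profile_le 2
  have h2 : (3 * amp * √(A ^ 2 + B ^ 2)) ^ 2 = 9 * amp ^ 2 * (A ^ 2 + B ^ 2) := by
    rw [mul_pow, Real.sq_sqrt (by positivity)]
    ring
  rw [h2] at h1
  have h3 : amp ^ 2 = 1 / 10000 := by norm_num [amp]
  rw [h3] at h1
  nlinarith [sq_nonneg A, sq_nonneg B]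

/-! ### Spans and biorthogonal or orthonormal families. -/

section Span

variable {E : Type*} [NormedAddCommGroup E] [InnerProductSpace ℂ E]

theorem linearIndependent_of_biorthogonal {x e : Fin 2 → E}
    (h : ∀ i k, inner ℂ (e i) (x k) = if i = k then 1 else 0) : LinearIndependent ℂ x := by
  rw [Fintype.linearIndependent_iff]
  intro g hg i
  have h1 := congrArg (inner ℂ (e i)) hg
  simp only [inner_sum, inner_smul_right, h, inner_zero_right] at h1
  simpa using h1

theorem inner_eq_zero_of_mem_span {κ : Type*} {y : κ → E} {u x : E}
    (h : ∀ i, inner ℂ (y i) u = 0) (hx : x ∈ Submodule.span ℂ (Set.range y)) :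
    inner ℂ x u = 0 := by
  induction hx using Submodule.span_induction with
  | mem x hx =>
    obtain ⟨i, rfl⟩ := hx
    exact h i
  | zero => exact inner_zero_left u
  | add x z _ _ h1 h2 => rw [inner_add_left, h1, h2, add_zero]
  | smul c x _ h1 => rw [inner_smul_left, h1, mul_zero]

theorem inner_eq_zero_of_mem_span' {κ : Type*} {y : κ → E} {u x : E}
    (h : ∀ i, inner ℂ u (y i) = 0) (hx : x ∈ Submodule.span ℂ (Set.range y)) :
    inner ℂ u x = 0 :=
  inner_eq_zero_symm.1 (inner_eq_zero_of_mem_span (fun i => inner_eq_zero_symm.1 (h i)) hx)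

theorem orthonormal_sumElim {y z : Fin 2 → E} (hy : Orthonormal ℂ y) (hz : Orthonormal ℂ z)
    (h : ∀ i k, inner ℂ (y i) (z k) = 0) : Orthonormal ℂ (Sum.elim y z) := by
  refine ⟨fun i => ?_, fun i k hik => ?_⟩
  · rcases i with i | i
    · exact hy.1 i
    · exact hz.1 i
  · rcases i with i | i <;> rcases k with k | k
    · exact hy.2 fun h => hik (congrArg Sum.inl h)
    · exact h i k
    · exact inner_eq_zero_symm.1 (h k i)
    · exact hz.2 fun h => hik (congrArg Sum.inr h)

end Span

theorem inner_eq_zero_of_sectors {y z : L2per2} (hy : ∀ n, inner ℂ (bas (true, n)) y = 0)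
    (hz : ∀ n, inner ℂ (bas (false, n)) z = 0) : inner ℂ y z = 0 := by
  rw [← bas.tsum_inner_mul_inner]
  refine (tsum_congr fun i => ?_).trans tsum_zero
  obtain ⟨τ, n⟩ := i
  cases τ
  · rw [hz, mul_zero]
  · rw [inner_eq_zero_symm.1 (hy n), zero_mul]

/-- The two low modes in a sector. -/
def lowMode (k : Fin 2) : ℤ := if k = 0 then -1 else 0

theorem dispersion_low {p p' : ℝ} (hp : |p - 1| ≤ 1 / 100) (hp' : |p' - 1| ≤ 1 / 100) {n : ℤ}
    (hn : n = 0 ∨ n = -1) : |dispersion p p' n| ≤ 1 / 10 := by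
  obtain ⟨a1, a2⟩ := abs_le.1 hp
  obtain ⟨b1, b2⟩ := abs_le.1 hp'
  rcases hn with rfl | rfl
  · have : dispersion p p' 0 = p ^ 2 - 1 := by simp [dispersion]
    rw [this, abs_le]
    constructor <;> nlinarith
  · have : dispersion p p' (-1) = p' ^ 2 - 1 := by simp [dispersion]
    rw [this, abs_le]
    constructor <;> nlinarith

theorem isReduced_of_pairs {s A B p p' : ℝ} {q wA rA vA wB rB vB : ℤ → ℝ} {V : L2per2 →L[ℂ] L2per2}
    (hA : IsTangentPair s A B p p' q (-1) 0 wA rA vA)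
    (hB : IsTangentPair s B A p p' q 0 (-1) wB rB vB) (hs : |s| = 1)
    (hsm : A ^ 2 + B ^ 2 ≤ 1 / 10000) (hV : ‖V‖ ≤ (A ^ 2 + B ^ 2) / 100) {x : Fin 2 → L2per2}
    (hx : ∀ k, ‖x k - bas (true, lowMode k)‖ ≤ ‖V‖)
    (hxi : ∀ i k, inner ℂ (bas (true, lowMode i)) (x k) = if i = k then 1 else 0)
    {N : Matrix (Fin 2) (Fin 2) ℂ}
    (hmul : Matrix.of (fun i k => inner ℂ ((![sector true wA, sector true wB] : Fin 2 → L2per2) i)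
      (x k)) * N = Matrix.of fun i k =>
        inner ℂ ((![sector true rA, sector true rB] : Fin 2 → L2per2) i) (x k)) :
    IsReduced s A B (Matrix.of (fun i k =>
        inner ℂ ((![sector true wA, sector true wB] : Fin 2 → L2per2) i) (x k))) N
      (Matrix.of fun i k =>
        inner ℂ ((![sector true rA, sector true rB] : Fin 2 → L2per2) i) (x k)) := by
  have hh : 0 ≤ A ^ 2 + B ^ 2 := by positivity
  have ha : 0 ≤ amp ^ 2 := sq_nonneg _
  have p0 {f : ℤ → ℝ} (hf : Summable fun n => ‖f n‖) :
      ‖inner ℂ (sector true f) (x 0) - f (-1)‖ ≤ (A ^ 2 + B ^ 2) * tailSum f :=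
    (norm_inner_sector_sub_le hf (m := -1) (m' := 0) (Or.inr ⟨rfl, rfl⟩) (hx 0)
      (by simpa [lowMode] using hxi 0 0) (by simpa [lowMode] using hxi 1 0)).trans
      (mul_le_mul_of_nonneg_right (by linarith) (tailSum_nonneg f))
  have p1 {f : ℤ → ℝ} (hf : Summable fun n => ‖f n‖) :
      ‖inner ℂ (sector true f) (x 1) - f 0‖ ≤ (A ^ 2 + B ^ 2) * tailSum f :=
    (norm_inner_sector_sub_le hf (m := 0) (m' := -1) (Or.inl ⟨rfl, rfl⟩) (hx 1)
      (by simpa [lowMode] using hxi 1 1) (by simpa [lowMode] using hxi 0 1)).trans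
      (mul_le_mul_of_nonneg_right (by linarith) (tailSum_nonneg f))
  have tri {z : ℂ} {y t e : ℝ} {f : ℝ} (h1 : ‖z - y‖ ≤ e) (h2 : |y - t| ≤ f) :
      ‖z - (t : ℝ)‖ ≤ e + f := by
    have h3 : ‖(y : ℂ) - (t : ℂ)‖ = |y - t| := by
      rw [← Complex.ofReal_sub, Complex.norm_real, Real.norm_eq_abs]
    have := norm_add_le (z - y) ((y : ℂ) - t)
    rw [sub_add_sub_cancel] at this
    linarith
  have hw : (A ^ 2 + B ^ 2) * tailSum wA ≤ A ^ 2 + B ^ 2 :=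
    mul_le_of_le_one_right hh (hA.tail_w.trans (by norm_num))
  have hw' : (A ^ 2 + B ^ 2) * tailSum wB ≤ A ^ 2 + B ^ 2 :=
    mul_le_of_le_one_right hh (hB.tail_w.trans (by norm_num))
  have hab : 0 ≤ |A| * |B| := by positivity
  constructor
  · exact hmul
  · exact hsm
  · exact hs
  · have := p0 hA.summable_w
    rw [hA.w_self] at this
    simpa using this.trans hw
  · have := p1 hA.summable_w
    rw [hA.w_other] at this
    simpa using this.trans hw
  · have := p0 hB.summable_w
    rw [hB.w_other] at this
    simpa using this.trans hw'
  · have := p1 hB.summable_w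
    rw [hB.w_self] at this
    simpa using this.trans hw'
  · refine (tri (p0 hA.summable_r) hA.r_self).trans ?_
    have h1 := mul_le_mul_of_nonneg_left hA.tail_r hh
    nlinarith [mul_nonneg ha (mul_nonneg (sq_nonneg A) (sq_nonneg A))]
  · refine (tri (p1 hA.summable_r) hA.r_other).trans ?_
    have h1 := mul_le_mul_of_nonneg_left hA.tail_r' hh
    linarith
  · have h0 := hB.r_other
    rw [mul_comm B A, mul_comm |B| |A|, add_comm (B ^ 2)] at h0
    refine (tri (p0 hB.summable_r) h0).trans ?_
    have h1 := mul_le_mul_of_nonneg_left hB.tail_r' hh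
    rw [mul_comm |B| |A|] at h1
    linarith
  · refine (tri (p1 hB.summable_r) hB.r_self).trans ?_
    have h1 := mul_le_mul_of_nonneg_left hB.tail_r hh
    nlinarith [mul_nonneg ha (mul_nonneg (sq_nonneg B) (sq_nonneg B))]

/-- The spectral conclusions, for an operator `T` at a wave with amplitudes `a` and `b`. -/
def SpectralPicture (T : L2per2 →ₗ.[ℂ] L2per2) (lam2 lam3 : ℝ) : Prop :=
  (∃ σ₁ : Set ℝ, σ₁ ⊆ Set.Ici 6 ∧
    PeriodicNLS.spectrum T = Complex.ofReal '' ({0, lam2, lam3} ∪ σ₁)) ∧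
  ∀ μ : ℝ, μ < 6 → Module.finrank ℂ (PeriodicNLS.eigenspace T μ) =
    (if μ = 0 then 2 else 0) + (if μ = lam2 then 1 else 0) + (if μ = lam3 then 1 else 0)

/-- The low space is the sum of an invariant plane in the real sector and the explicit kernel plane
in the imaginary sector. Both are diagonalized, and the form bound handles the complement. -/
theorem IsScaledWave.exists_spectralPicture {s A B p p' : ℝ} {c : SeqSpace}
    (h : IsScaledWave s A B p p' c) (hs : |s| = 1) (hsm : A ^ 2 + B ^ 2 ≤ 1 / 10000)
    {T : L2per2 →ₗ.[ℂ] L2per2} (hT : T.graph = diagGraph bas (fun i => dispersion p p' i.2)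
      (potOp s (fourierSum (profileCoeff A B c)))) :
    IsSelfAdjoint T ∧ ∃ (lam2 lam3 : ℝ) (G N R : Matrix (Fin 2) (Fin 2) ℂ),
      SpectralPicture T lam2 lam3 ∧ IsReduced s A B G N R ∧ lam2 ≤ lam3 ∧
      (lam3 : ℂ) * lam2 = N.det ∧ (lam3 : ℂ) + lam2 = N.trace := by
  set V := potOp s (fourierSum (profileCoeff A B c)) with hVdef
  have hq := summable_profileCoeff h.abs_A h.abs_B c
  have hVs : ∀ x y, inner ℂ (V x) y = inner ℂ x (V y) := potOp_symm s _
  have hVn : ‖V‖ ≤ (A ^ 2 + B ^ 2) / 100 := h.norm_potOp_le hs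
  have hVn' : ‖V‖ ≤ 1 / 100 := by linarith
  have hsa : IsSelfAdjoint T := isSelfAdjoint_of_graph_eq hVs hT
  refine ⟨hsa, ?_⟩
  obtain ⟨wA, rA, vA, hA⟩ := h.exists_tangentPair hs
  obtain ⟨wB, rB, vB, hB⟩ := h.exists_tangentPair' hs
  have hinj : Function.Injective fun k : Fin 2 => ((true, lowMode k) : Bool × ℤ) := by
    intro i k hik
    have := (Prod.ext_iff.1 hik).2
    fin_cases i <;> fin_cases k <;> simp_all [lowMode]
  obtain ⟨x, N, hx1, hx2, hx3, hx4⟩ := exists_invariant_pair (b := bas)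
    (Λ := fun i => dispersion p p' i.2) (V := V) (S := {i | i.1 = true}) hVs (by
      rintro ⟨σ, n⟩ hσ ⟨τ, m⟩ hτ
      refine inner_potOp_ne s hq (fun hστ => hσ ?_) n m
      exact hστ.trans hτ) hVn' hinj (fun k => rfl) (fun k => by
      refine dispersion_low h.abs_p h.abs_p' ?_
      fin_cases k <;> simp [lowMode]) (by
      rintro ⟨σ, n⟩ hσ hne
      have h0 := hne 0
      have h1 := hne 1
      have hσ' : σ = true := hσ
      simp only [lowMode, if_true, hσ', ne_eq, Prod.mk.injEq, true_and, one_ne_zero, if_false]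
        at h0 h1
      have := (dispersion_lower h.abs_p h.abs_p' h1 h0).1
      linarith)
  let xv : Fin 2 → L2per2 := ![sector false vA, sector false vB]
  have hxv (i k : Fin 2) : inner ℂ (bas (false, lowMode i)) (xv k) = if i = k then 1 else 0 := by
    fin_cases k
    · change inner ℂ _ (sector false vA) = _
      rw [inner_bas_sector false hA.summable_v]
      fin_cases i <;> simp [lowMode, hA.v_self, hA.v_other]
    · change inner ℂ _ (sector false vB) = _
      rw [inner_bas_sector false hB.summable_v]
      fin_cases i <;> simp [lowMode, hB.v_self, hB.v_other]
  have hz0 : Summable fun _ : ℤ => ‖(0 : ℝ)‖ := by simp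
  have hsec0 : sector false (fun _ => 0) = 0 := by simp [sector]
  have hxvgr (k : Fin 2) : (xv k, ∑ i, (0 : Matrix (Fin 2) (Fin 2) ℂ) i k • xv i) ∈ T.graph := by
    rw [hT]
    simp only [Matrix.zero_apply, zero_smul, Finset.sum_const_zero]
    rw [← hsec0]
    fin_cases k
    · exact sector_mem_diagGraph hA.summable_v hq hz0 false (by simpa [sgn] using hA.lin_v)
    · exact sector_mem_diagGraph hB.summable_v hq hz0 false (by simpa [sgn] using hB.lin_v)
  have hxgr (k : Fin 2) : (x k, ∑ i, N i k • x i) ∈ T.graph := by rw [hT]; exact hx4 k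
  obtain ⟨y, lam, hy1, hy2, hy3, hy4, hy5, hy6⟩ :=
    exists_eigenvectors_of_plane hsa (linearIndependent_of_biorthogonal hx2) hxgr
  obtain ⟨z, kap, hz1, hz2, hz3, -, hz5, hz6⟩ :=
    exists_eigenvectors_of_plane hsa (linearIndependent_of_biorthogonal hxv) hxvgr
  -- The plane of `xv` has matrix 0, so its eigenvalues have zero sum and zero product.
  have hkap : kap 0 = 0 ∧ kap 1 = 0 := by
    rw [Matrix.det_zero] at hz5
    rw [Matrix.trace_zero] at hz6
    have e1 : kap 0 * kap 1 = 0 := by exact_mod_cast hz5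
    have e2 : kap 0 + kap 1 = 0 := by exact_mod_cast hz6
    have e3 : kap 1 = -kap 0 := by linarith
    rw [e3] at e1
    have e4 : kap 0 = 0 := by nlinarith
    exact ⟨e4, by rw [e3, e4, neg_zero]⟩
  have hyz (i k : Fin 2) : inner ℂ (z i) (y k) = 0 := by
    have hz := hz3 ▸ Submodule.subset_span (Set.mem_range_self i)
    have hy := hy3 ▸ Submodule.subset_span (Set.mem_range_self k)
    refine inner_eq_zero_of_sectors (fun n => inner_eq_zero_of_mem_span' (fun l => ?_) hz)
      (fun n => inner_eq_zero_of_mem_span' (fun l => ?_) hy)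
    · fin_cases l
      · exact (inner_bas_sector false hA.summable_v (true, n)).trans (by simp)
      · exact (inner_bas_sector false hB.summable_v (true, n)).trans (by simp)
    · exact hx3 (false, n) (by simp) l
  have horth := orthonormal_sumElim hz1 hy1 hyz
  have hgr (i : Fin 2 ⊕ Fin 2) :
      (Sum.elim z y i, ((Sum.elim kap lam i : ℝ) : ℂ) • Sum.elim z y i) ∈ T.graph := by
    rcases i with i | i
    · exact hz2 i
    · exact hy2 i
  have hM (u w : L2per2) (huw : (u, w) ∈ T.graph)
      (hu : ∀ i : Fin 2 ⊕ Fin 2, inner ℂ (Sum.elim z y i) u = 0) :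
      6 * ‖u‖ ^ 2 ≤ (inner ℂ u w).re := by
    rw [hT] at huw
    have hux (k : Fin 2) : inner ℂ (x k) u = 0 :=
      inner_eq_zero_of_mem_span (fun i => hu (Sum.inr i))
        (hy3.symm ▸ Submodule.subset_span (Set.mem_range_self k))
    have huv (k : Fin 2) : inner ℂ (xv k) u = 0 :=
      inner_eq_zero_of_mem_span (fun i => hu (Sum.inl i))
        (hz3.symm ▸ Submodule.subset_span (Set.mem_range_self k))
    -- The index set consists of the two low modes in both sectors; orthogonality to the
    -- eigenvectors passes to `x` and `xv`, which span the same planes.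
    refine six_le_of_orthogonal hVn' (Finset.univ ×ˢ {0, -1}) (by simp) (fun i hi => ?_)
      (fun i hi => ?_) (x := fun i => if i.1 = true then (if i.2 = -1 then x 0 else x 1)
        else (if i.2 = -1 then xv 0 else xv 1)) (fun i hi => ?_) huw (fun i hi => ?_)
    · refine dispersion_low h.abs_p h.abs_p' ?_
      simpa using hi
    · simp only [Finset.mem_product, Finset.mem_univ, true_and, Finset.mem_insert,
        Finset.mem_singleton, not_or] at hi
      exact (dispersion_lower h.abs_p h.abs_p' hi.1 hi.2).1
    · simp only [Finset.mem_product, Finset.mem_univ, true_and, Finset.mem_insert,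
        Finset.mem_singleton] at hi
      obtain ⟨σ, n⟩ := i
      have e1 : ‖xv 0 - bas (false, -1)‖ ≤ 1 / 10 :=
        (norm_sector_sub_bas_le hA.summable_v false (Or.inr ⟨rfl, rfl⟩) hA.v_self hA.v_other).trans
          (hA.tail_v.trans (by norm_num))
      have e2 : ‖xv 1 - bas (false, 0)‖ ≤ 1 / 10 :=
        (norm_sector_sub_bas_le hB.summable_v false (Or.inl ⟨rfl, rfl⟩) hB.v_self hB.v_other).trans
          (hB.tail_v.trans (by norm_num))
      have e3 : ‖x 0 - bas (true, -1)‖ ≤ 1 / 10 := (hx1 0).trans (by linarith)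
      have e4 : ‖x 1 - bas (true, 0)‖ ≤ 1 / 10 := (hx1 1).trans (by linarith)
      rcases hi with hi | hi <;> cases σ <;> simp only at hi <;> subst hi
      · simpa using e2
      · simpa using e4
      · simpa using e1
      · simpa using e3
    · split_ifs
      · exact hux 0
      · exact hux 1
      · exact huv 0
      · exact huv 1
  have hgram := gram_mul_eq (w := ![sector true wA, sector true wB])
    (r := ![sector true rA, sector true rB]) hVs hx4 (by
      intro k
      fin_cases k
      · exact sector_mem_diagGraph hA.summable_w hq hA.summable_r true (by simpa [sgn] using hA.lin_w)
      · exact sector_mem_diagGraph hB.summable_w hq hB.summable_r true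
          (by simpa [sgn] using hB.lin_w))
  -- The indices are swapped because `lam` is decreasing.
  refine ⟨lam 1, lam 0, _, N, _, ⟨?_, fun μ hμ => ?_⟩,
    isReduced_of_pairs hA hB hs hsm hVn hx1 hx2 hgram, hy4, hy5, hy6⟩
  · obtain ⟨σ₁, hσ, hspec⟩ := exists_spectrum_eq hsa horth hgr hM
    refine ⟨σ₁, hσ, ?_⟩
    rw [hspec]
    congr 2
    ext t
    simp only [Set.mem_range, Sum.exists, Sum.elim_inl, Sum.elim_inr, Fin.exists_fin_two, hkap.1,
      hkap.2, Set.mem_insert_iff, Set.mem_singleton_iff, or_self]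
    constructor
    · rintro (h | h | h) <;> simp [h.symm]
    · rintro (h | h | h) <;> simp [h]
  · rw [finrank_eigenspace hsa horth hgr hM hμ, Fintype.sum_sum_type, Fin.sum_univ_two,
      Fin.sum_univ_two]
    simp only [Sum.elim_inl, Sum.elim_inr, hkap.1, hkap.2]
    change ((if μ = 0 then 1 else 0) + (if μ = 0 then 1 else 0))
      + ((if μ = lam 0 then 1 else 0) + (if μ = lam 1 then 1 else 0)) = _
    split_ifs <;> rfl

end PeriodicNLS

end

noncomputable section

namespace PeriodicNLS

open scoped ComplexConjugate

/-- Product and trace determine the picture: the product is nonpositive, and negative if `AB ≠ 0`,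
while the trace is nonzero unless both amplitudes vanish. -/
theorem IsReduced.eigenvalues {s A B lam2 lam3 : ℝ} {G N R : Matrix (Fin 2) (Fin 2) ℂ}
    (h : IsReduced s A B G N R) (hle : lam2 ≤ lam3) (hdet : (lam3 : ℂ) * lam2 = N.det)
    (htr : (lam3 : ℂ) + lam2 = N.trace) :
    lam3 < 6 ∧ (A ^ 2 + B ^ 2 ≠ 0 → lam2 < lam3) ∧ (A ^ 2 + B ^ 2 = 0 → lam2 = lam3) ∧
    (A * B ≠ 0 → lam2 < 0 ∧ 0 < lam3) ∧
    |lam2 * lam3 + 12 * (amp ^ 2) ^ 2 * (A ^ 2 * B ^ 2)|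
      ≤ 14000 * (amp ^ 2) ^ 2 * (A ^ 2 * B ^ 2 * (A ^ 2 + B ^ 2)) := by
  have h1 := h.norm_det_add_le
  have h2 := h.norm_trace_sub_le
  have hsm := h.small
  rw [← hdet, ← Complex.ofReal_mul, ← Complex.ofReal_add, Complex.norm_real, Real.norm_eq_abs,
    mul_comm lam3] at h1
  rw [← htr, ← Complex.ofReal_add, ← Complex.ofReal_sub, Complex.norm_real, Real.norm_eq_abs] at h2
  have ha : amp ^ 2 = 1 / 10000 := by norm_num [amp]
  set t := A ^ 2 + B ^ 2 with ht
  have ht0 : 0 ≤ t := by positivity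
  have hP1 : A ^ 2 * B ^ 2 ≤ 1 := by
    have h3 : A ^ 2 ≤ 1 := by nlinarith [sq_nonneg B]
    have h4 : B ^ 2 ≤ 1 := by nlinarith [sq_nonneg A]
    exact mul_le_one₀ h3 (sq_nonneg B) h4
  have hPpos : A * B ≠ 0 → 0 < A ^ 2 * B ^ 2 := fun hAB => by rw [← mul_pow]; positivity
  have hPzero : t = 0 → A ^ 2 * B ^ 2 = 0 := fun h0 => by
    have hA0 : A ^ 2 = 0 := by nlinarith [sq_nonneg A, sq_nonneg B]
    rw [hA0, zero_mul]
  have hPt : A ^ 2 * B ^ 2 * t ≤ A ^ 2 * B ^ 2 * (1 / 10000) := by gcongr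
  have hP0 : 0 ≤ A ^ 2 * B ^ 2 := by positivity
  refine ⟨?_, ?_, ?_, ?_, h1⟩
  all_goals
    obtain ⟨d1, d2⟩ := abs_le.1 h1
    obtain ⟨t1, t2⟩ := abs_le.1 h2
    have hst : |s * t| = t := by rw [abs_mul, h.abs_s, one_mul, abs_of_nonneg ht0]
    obtain ⟨u1, u2⟩ := abs_le.1 hst.le
    rw [ha] at d1 d2 t1 t2
    rw [show 2 * (s * (1 / 10000) * t) = 2 / 10000 * (s * t) by ring] at t1 t2
    generalize A ^ 2 * B ^ 2 = P at *
    -- Since `14000 t ≤ 14/10`, the coefficient 12 keeps more than 10.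
    have hneg : lam2 * lam3 ≤ -P * (10 * (1 / 10000) ^ 2) := by linarith
  -- If `lam3 ≥ 6`, the tiny trace gives `lam2 ≤ -5` and a product of at most `-30`, far below its
  -- lower bound.
  · by_contra hcon
    push Not at hcon
    have h5 : lam2 ≤ -5 := by linarith
    have h6 := mul_nonneg (show 0 ≤ lam3 by linarith) (show 0 ≤ -5 - lam2 by linarith)
    linarith
  -- Coinciding eigenvalues have a product that is a square; being nonpositive, it vanishes. The
  -- trace would then be 0, although its leading part has modulus `2 amp² t` and its error is at
  -- most `amp² t`.
  · intro h0
    refine lt_of_le_of_ne hle fun heq => ?_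
    rw [heq] at hneg
    have h3 : lam3 = 0 := mul_self_eq_zero.1 (le_antisymm (by linarith) (mul_self_nonneg _))
    rw [heq, h3] at t1 t2
    have htpos : 0 < t := lt_of_le_of_ne ht0 (Ne.symm h0)
    rcases abs_cases (s * t) with ⟨e, -⟩ | ⟨e, -⟩ <;> rw [hst] at e <;> linarith
  · intro h0
    have hP := hPzero h0
    rw [h0, mul_zero] at t1 t2
    rw [hP, h0] at d1
    have e1 : lam3 = -lam2 := by linarith
    rw [e1] at d1 ⊢
    have h3 : lam2 = 0 := mul_self_eq_zero.1 (le_antisymm (by linarith) (mul_self_nonneg _))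
    rw [h3, neg_zero]
  · intro hAB
    have hpos := hPpos hAB
    have hl : lam2 * lam3 < 0 := by linarith
    rcases mul_neg_iff.1 hl with ⟨e1, e2⟩ | ⟨e1, e2⟩
    · linarith
    · exact ⟨e1, e2⟩

/-! ### Derivatives of Fourier series -/

theorem hasDerivAt_fourierSum {q : ℤ → ℝ} (hq : Summable fun n => ‖q n‖)
    (hq' : Summable fun n : ℤ => ‖(n : ℝ) * q n‖) (x : ℝ) :
    HasDerivAt (fun y : ℝ => fourierSum q y)
      (Complex.I * fourierSum (fun n => n * q n) (x : AddCircle (2 * π))) x := by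
  have hev (r : ℤ → ℝ) (hr : Summable fun n => ‖r n‖) (y : ℝ) :
      HasSum (fun n => (r n : ℂ) * fourier n (y : AddCircle (2 * π))) (fourierSum r y) := by
    have := (ContinuousMap.evalCLM ℂ (y : AddCircle (2 * π))).hasSum (hasSum_fourierSum hr)
    exact this
  have hd (n : ℤ) (y : ℝ) : HasDerivAt (fun y : ℝ => (q n : ℂ) * fourier n (y : AddCircle (2 * π)))
      (Complex.I * (((n * q n : ℝ) : ℂ) * fourier n (y : AddCircle (2 * π)))) y := by
    have h1 := (hasDerivAt_fourier (2 * π) n y).const_mul (q n : ℂ)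
    have h3 : 2 * (π : ℂ) * Complex.I * n / ((2 * π : ℝ) : ℂ) = Complex.I * n := by
      have : (π : ℂ) ≠ 0 := Complex.ofReal_ne_zero.2 Real.pi_ne_zero
      push_cast
      field_simp
    rw [h3] at h1
    have e : Complex.I * (((n * q n : ℝ) : ℂ) * fourier n (y : AddCircle (2 * π)))
        = q n * (Complex.I * n * fourier n (y : AddCircle (2 * π))) := by
      push_cast
      ring
    rw [e]
    exact h1
  have h2 := hasDerivAt_tsum (u := fun n : ℤ => ‖(n : ℝ) * q n‖) hq' hd (fun n y => by
    rw [norm_mul, norm_mul, Complex.norm_I, one_mul, Complex.norm_real]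
    refine mul_le_of_le_one_right (norm_nonneg _) ?_
    rw [fourier_apply]
    exact (Circle.norm_coe _).le) (y₀ := 0) (hev q hq 0).summable x
  have e1 : (fun y : ℝ => ∑' n, (q n : ℂ) * fourier n (y : AddCircle (2 * π)))
      = fun y : ℝ => fourierSum q y := funext fun y => (hev q hq y).tsum_eq
  rw [e1, tsum_mul_left, (hev _ hq' x).tsum_eq] at h2
  exact h2

theorem contDiff_two_of_hasDerivAt {f f₁ f₂ : ℝ → ℂ} (h1 : ∀ x, HasDerivAt f (f₁ x) x)
    (h2 : ∀ x, HasDerivAt f₁ (f₂ x) x) (h3 : Continuous f₂) : ContDiff ℝ 2 f := by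
  have e1 : deriv f = f₁ := funext fun x => (h1 x).deriv
  have e2 : deriv f₁ = f₂ := funext fun x => (h2 x).deriv
  have h4 : ContDiff ℝ 1 f₁ := by
    rw [contDiff_one_iff_deriv, e2]
    exact ⟨fun x => (h2 x).differentiableAt, h3⟩
  rw [show (2 : WithTop ℕ∞) = 1 + 1 by norm_num, contDiff_succ_iff_deriv, e1]
  exact ⟨fun x => (h1 x).differentiableAt, by simp, h4⟩

/-! ### The profile equation -/

theorem waveW_eq (l k : ℝ) (P : ℝ → ℂ) (x : ℝ) :
    waveW l k P x = Complex.exp (Complex.I * ((l + k) * x : ℝ)) * profileQ P (2 * k * x) := by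
  rw [waveW, profileQ, ← mul_assoc, ← Complex.exp_add]
  have e : 2 * k * x / 2 = k * x := by ring
  rw [e]
  congr 2
  push_cast
  ring

theorem norm_waveW (l k : ℝ) (P : ℝ → ℂ) (x : ℝ) :
    ‖waveW l k P x‖ = ‖profileQ P (2 * k * x)‖ := by
  rw [waveW_eq, norm_mul, mul_comm Complex.I, Complex.norm_exp_ofReal_mul_I, one_mul]

theorem deriv_deriv_waveW {l k : ℝ} {P Q₁ Q₂ : ℝ → ℂ}
    (h1 : ∀ z, HasDerivAt (profileQ P) (Q₁ z) z) (h2 : ∀ z, HasDerivAt Q₁ (Q₂ z) z) (x : ℝ) :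
    deriv (deriv (waveW l k P)) x = Complex.exp (Complex.I * ((l + k) * x : ℝ)) *
      (4 * k ^ 2 * Q₂ (2 * k * x) + 4 * Complex.I * (l + k) * k * Q₁ (2 * k * x)
        - (l + k) ^ 2 * profileQ P (2 * k * x)) := by
  have hE (x : ℝ) : HasDerivAt (fun x : ℝ => Complex.exp (Complex.I * ((l + k) * x : ℝ)))
      (Complex.I * (l + k) * Complex.exp (Complex.I * ((l + k) * x : ℝ))) x := by
    have h3 : HasDerivAt (fun x : ℝ => Complex.I * ((l + k) * x : ℝ)) (Complex.I * (l + k)) x := by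
      have := ((hasDerivAt_id x).const_mul (l + k)).ofReal_comp.const_mul Complex.I
      simpa using this
    have h4 := h3.cexp
    rwa [mul_comm] at h4
  have hc {f f' : ℝ → ℂ} (hf : ∀ z, HasDerivAt f (f' z) z) (x : ℝ) :
      HasDerivAt (fun x => f (2 * k * x)) (2 * k * f' (2 * k * x)) x := by
    have h3 : HasDerivAt (fun x : ℝ => 2 * k * x) (2 * k) x := by
      simpa using (hasDerivAt_id x).const_mul (2 * k)
    have h4 := (hf (2 * k * x)).scomp x h3
    have e : ((2 * k : ℝ) • f' (2 * k * x) : ℂ) = 2 * k * f' (2 * k * x) := by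
      rw [Complex.real_smul]; push_cast; ring
    rw [e] at h4
    exact h4
  have e0 : waveW l k P = fun x => Complex.exp (Complex.I * ((l + k) * x : ℝ))
      * profileQ P (2 * k * x) := funext (waveW_eq l k P)
  have e1 : deriv (waveW l k P) = fun x => Complex.exp (Complex.I * ((l + k) * x : ℝ))
      * (Complex.I * (l + k) * profileQ P (2 * k * x) + 2 * k * Q₁ (2 * k * x)) := by
    funext x
    rw [e0, ((hE x).fun_mul (hc h1 x)).deriv]
    ring
  rw [e1]
  have h5 := (hE x).fun_mul (((hc h1 x).const_mul (Complex.I * (l + k))).fun_add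
    ((hc h2 x).const_mul (2 * k : ℂ)))
  rw [h5.deriv]
  linear_combination (Complex.exp (Complex.I * ((l + k) * x : ℝ)) * (l + k) ^ 2
    * profileQ P (2 * k * x)) * Complex.I_sq

/-- The wave equation for `W` is the profile equation for `Q`. -/
theorem wave_equation_iff {s l k : ℝ} {P Q₁ Q₂ : ℝ → ℂ}
    (h1 : ∀ z, HasDerivAt (profileQ P) (Q₁ z) z) (h2 : ∀ z, HasDerivAt Q₁ (Q₂ z) z) (x : ℝ) :
    deriv (deriv (waveW l k P)) x + waveW l k P x
      - s * (‖waveW l k P x‖ ^ 2 : ℝ) * waveW l k P x = 0 ↔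
    4 * k ^ 2 * Q₂ (2 * k * x) + 4 * Complex.I * (l + k) * k * Q₁ (2 * k * x)
      + (1 - (l + k) ^ 2) * profileQ P (2 * k * x) - s * (profileQ P (2 * k * x)
        * conj (profileQ P (2 * k * x)) * profileQ P (2 * k * x)) = 0 := by
  rw [deriv_deriv_waveW h1 h2, norm_waveW, waveW_eq, Complex.mul_conj, Complex.normSq_eq_norm_sq]
  have hne := Complex.exp_ne_zero (Complex.I * ((l + k) * x : ℝ))
  constructor
  · intro h
    apply mul_left_cancel₀ hne
    linear_combination h
  · intro h
    linear_combination Complex.exp (Complex.I * ((l + k) * x : ℝ)) * h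

theorem eq_zero_of_fourierCoeff {φ : C(AddCircle (2 * π), ℂ)} (h : ∀ n, fourierCoeff φ n = 0) :
    φ = 0 := by
  have h1 := hasSum_fourier_series_of_summable (f := φ) (by
    rw [funext h]
    exact summable_zero)
  simp only [h, zero_smul] at h1
  exact h1.unique hasSum_zero

/-- The profile equation on the Fourier side. -/
theorem profile_equation_iff {s k p p' : ℝ} (hk : k = (p + p') / 2)
    {Q Q₁ Q₂ : C(AddCircle (2 * π), ℂ)} (h1 : ∀ n, fourierCoeff Q₁ n = Complex.I * n * fourierCoeff Q n)
    (h2 : ∀ n, fourierCoeff Q₂ n = Complex.I * n * fourierCoeff Q₁ n) :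
    (∀ z, 4 * k ^ 2 * Q₂ z + 4 * Complex.I * p * k * Q₁ z + (1 - p ^ 2) * Q z
      - s * (Q z * conj (Q z) * Q z) = 0) ↔
    ∀ n, dispersion p p' n * fourierCoeff Q n
      = -s * fourierCoeff (Q * star Q * Q : C(AddCircle (2 * π), ℂ)) n := by
  set F : C(AddCircle (2 * π), ℂ) := (4 * k ^ 2 : ℂ) • Q₂ + (4 * Complex.I * p * k : ℂ) • Q₁
    + (1 - p ^ 2 : ℂ) • Q - (s : ℂ) • (Q * star Q * Q) with hF
  have hcoeff (n : ℤ) : fourierCoeff F n = -(dispersion p p' n * fourierCoeff Q n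
      + s * fourierCoeff (Q * star Q * Q : C(AddCircle (2 * π), ℂ)) n) := by
    have hd : (dispersion p p' n : ℂ) = (p + 2 * k * n) ^ 2 - 1 := by
      rw [dispersion, hk]
      push_cast
      ring
    rw [← coeffCLM_apply, hF]
    simp only [map_add, map_sub, map_smul, smul_eq_mul, coeffCLM_apply, h2, h1, hd]
    linear_combination (4 * k ^ 2 * n ^ 2 * fourierCoeff Q n
      + 4 * p * k * n * fourierCoeff Q n) * Complex.I_sq
  constructor
  · intro h n
    have : F = 0 := by
      ext z
      exact h z
    have h3 := hcoeff n
    rw [this, ← coeffCLM_apply, map_zero] at h3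
    linear_combination h3
  · intro h z
    have : F = 0 := eq_zero_of_fourierCoeff fun n => by
      rw [hcoeff, h n]
      ring
    exact congrArg (fun φ : C(AddCircle (2 * π), ℂ) => φ z) this

theorem fourierCoeff_cubic {q : ℤ → ℝ} (hq : Summable fun n => ‖q n‖) (n : ℤ) :
    fourierCoeff (fourierSum q * star (fourierSum q) * fourierSum q : C(AddCircle (2 * π), ℂ)) n
      = ((∑' u : ℤ × ℤ, q u.1 * q u.2 * q (u.1 + u.2 - n) : ℝ) : ℂ) := by
  have h1 := (coeffCLM n).hasSum
    ((hasSum_fourierSum hq).mul_right (fourierSum q * star (fourierSum q)))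
  rw [coeffCLM_apply, mul_comm (fourierSum q) (fourierSum q * _)] at h1
  refine h1.unique ?_
  have h2 := Complex.hasSum_ofReal.2 (hasSum_mul_autocorrelation hq hq n)
  refine hasSum_of_eq (fun j => ?_) h2
  rw [smul_mul_assoc, map_smul, coeffCLM_apply, fourierCoeff_fourier_mul,
    fourierCoeff_mul_star hq, smul_eq_mul, Complex.ofReal_mul]

/-- Each cubic product of the coefficients equals `amp³`, the monomial of the output mode, the
weight `wt` and a product of values of `c`; the scaled equation is the unscaled one with that
monomial removed. -/
theorem IsScaledWave.profile_equation {s A B p p' : ℝ} {c : SeqSpace}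
    (h : IsScaledWave s A B p p' c) (n : ℤ) :
    dispersion p p' n * profileCoeff A B c n = -s * ∑' u : ℤ × ℤ, profileCoeff A B c u.1
      * profileCoeff A B c u.2 * profileCoeff A B c (u.1 + u.2 - n) := by
  have e : ∑' u : ℤ × ℤ, profileCoeff A B c u.1 * profileCoeff A B c u.2
      * profileCoeff A B c (u.1 + u.2 - n)
      = amp ^ 3 * mon A B n * ∑' u : ℤ × ℤ, wt A B u n * (c u.1 * c u.2 * c (u.1 + u.2 - n)) := by
    rw [← tsum_mul_left]
    refine tsum_congr fun u => ?_
    have eA : A ^ n.natAbs * A ^ expA u n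
        = A ^ u.1.natAbs * A ^ u.2.natAbs * A ^ (u.1 + u.2 - n).natAbs := by
      rw [← pow_add, ← pow_add, ← pow_add, add_comm, expA_add]
    have eB : B ^ (n + 1).natAbs * B ^ expB u n
        = B ^ (u.1 + 1).natAbs * B ^ (u.2 + 1).natAbs * B ^ (u.1 + u.2 - n + 1).natAbs := by
      rw [← pow_add, ← pow_add, ← pow_add, add_comm, expB_add]
    simp only [profileCoeff, mon, wt]
    linear_combination -(amp ^ 3 * (c u.1 * c u.2 * c (u.1 + u.2 - n))) *
      (B ^ (u.1 + 1).natAbs * B ^ (u.2 + 1).natAbs * B ^ (u.1 + u.2 - n + 1).natAbs * eA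
        + A ^ n.natAbs * A ^ expA u n * eB)
  rw [e, profileCoeff]
  linear_combination (amp * mon A B n) * h.equation n

end PeriodicNLS

end

noncomputable section

namespace PeriodicNLS

open scoped ComplexConjugate

/-! ### Existence of a family of small waves -/

theorem integral_comp_half_of_periodic {g : ℝ → ℂ} (hg : Continuous g)
    (hper : Function.Periodic g π) :
    ∫ z in (0 : ℝ)..(2 * π), g (z / 2) = ∫ y in (0 : ℝ)..(2 * π), g y := by
  have hi (a b : ℝ) : IntervalIntegrable g volume a b := hg.intervalIntegrable a b
  rw [intervalIntegral.integral_comp_div g two_ne_zero,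
    ← intervalIntegral.integral_add_adjacent_intervals (hi 0 π) (hi π (2 * π))]
  have h1 := hper.intervalIntegral_add_eq π 0
  rw [show π + π = 2 * π by ring, zero_add] at h1
  rw [h1, zero_div, mul_div_cancel_left₀ _ (two_ne_zero' ℝ), two_smul]

theorem exp_I_mul_add_pi (y : ℝ) :
    Complex.exp (Complex.I * (y + π : ℝ)) = -Complex.exp (Complex.I * y) := by
  rw [Complex.ofReal_add, mul_add, Complex.exp_add, mul_comm Complex.I (π : ℂ),
    Complex.exp_pi_mul_I, mul_neg_one]

/-- As `P(y) = e^{iy} Q(2y)`, the mode `n` of `Q` is the mode `2n + 1` of `P`. Antiperiodicity makes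
the integrands `π`-periodic, so the halved variable leaves the integral unchanged. -/
theorem fourierCoeff_profile {P : ℝ → ℂ} (hP : Continuous P) (hanti : ∀ y, P (y + π) = -P y)
    {Q : C(AddCircle (2 * π), ℂ)} (hQ : ∀ z : ℝ, Q z = profileQ P z) :
    fourierCoeff Q (-1) = (1 / (2 * π) : ℝ) *
      ∫ y in (0 : ℝ)..(2 * π), P y * Complex.exp (Complex.I * y) ∧
    fourierCoeff Q 0 = (1 / (2 * π) : ℝ) *
      ∫ y in (0 : ℝ)..(2 * π), P y * Complex.exp (-(Complex.I * y)) := by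
  have hpi : (π : ℂ) ≠ 0 := Complex.ofReal_ne_zero.2 Real.pi_ne_zero
  constructor
  · rw [← integral_comp_half_of_periodic (g := fun y : ℝ => P y * Complex.exp (Complex.I * y))
      (by fun_prop) (fun y => by
        simp only
        rw [hanti, exp_I_mul_add_pi, neg_mul_neg]),
      fourierCoeff_eq_intervalIntegral (T := 2 * π) _ _ 0, zero_add, Complex.real_smul]
    congr 1
    refine intervalIntegral.integral_congr fun z _ => ?_
    simp only [smul_eq_mul]
    rw [hQ, profileQ, fourier_coe_apply, ← mul_assoc, ← Complex.exp_add, mul_comm]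
    congr 2
    push_cast
    field_simp
    ring
  · rw [← integral_comp_half_of_periodic (g := fun y : ℝ => P y * Complex.exp (-(Complex.I * y)))
      (by fun_prop) (fun y => by
        simp only
        rw [hanti, Complex.exp_neg, exp_I_mul_add_pi, Complex.exp_neg, inv_neg, neg_mul_neg]),
      fourierCoeff_eq_intervalIntegral (T := 2 * π) _ _ 0, zero_add, Complex.real_smul]
    congr 1
    refine intervalIntegral.integral_congr fun z _ => ?_
    simp only [smul_eq_mul]
    rw [hQ, profileQ, neg_zero, fourier_zero, one_mul, mul_comm]

/-- The function `P(y) = e^{iy} Q(2y)`. -/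
def unprofile (Q : C(AddCircle (2 * π), ℂ)) (y : ℝ) : ℂ :=
  Complex.exp (Complex.I * y) * Q ((2 * y : ℝ) : AddCircle (2 * π))

theorem profileQ_unprofile (Q : C(AddCircle (2 * π), ℂ)) (z : ℝ) :
    profileQ (unprofile Q) z = Q z := by
  rw [profileQ, unprofile, ← mul_assoc, ← Complex.exp_add, neg_add_cancel, Complex.exp_zero, one_mul,
    mul_div_cancel₀ z two_ne_zero]

theorem unprofile_add_pi (Q : C(AddCircle (2 * π), ℂ)) (y : ℝ) :
    unprofile Q (y + π) = -unprofile Q y := by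
  rw [unprofile, unprofile, exp_I_mul_add_pi, mul_add, AddCircle.coe_add, AddCircle.coe_period,
    add_zero, neg_mul]

theorem continuous_unprofile (Q : C(AddCircle (2 * π), ℂ)) : Continuous (unprofile Q) := by
  unfold unprofile
  have h : Continuous fun y : ℝ => Q ((2 * y : ℝ) : AddCircle (2 * π)) :=
    Q.continuous.comp ((AddCircle.continuous_mk' _).comp (continuous_const_mul 2))
  fun_prop

theorem abs_profileCoeff_le {A B : ℝ} (hA : |A| ≤ 1) (hB : |B| ≤ 1) (c : ℤ → ℝ) (n : ℤ) :
    |profileCoeff A B c n| ≤ |c n| := by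
  rw [profileCoeff, abs_mul, abs_mul]
  refine mul_le_of_le_one_left (abs_nonneg _) ?_
  exact mul_le_one₀ (by norm_num [amp, abs_of_pos]) (abs_nonneg _) (abs_mon_le hA hB n)

theorem IsScaledWave.summable_deriv {s A B p p' : ℝ} {c : SeqSpace}
    (h : IsScaledWave s A B p p' c) (hs : |s| = 1) :
    (Summable fun n : ℤ => ‖(n : ℝ) * profileCoeff A B c n‖) ∧
    Summable fun n : ℤ => ‖(n : ℝ) * ((n : ℝ) * profileCoeff A B c n)‖ := by
  obtain ⟨d, hd, -, -⟩ := h.exists_weighting hs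
  have hq := abs_profileCoeff_le h.abs_A h.abs_B c
  constructor
  · refine Summable.of_nonneg_of_le (fun _ => norm_nonneg _) (fun n => ?_) (seq_summable d)
    rw [norm_mul, Real.norm_eq_abs, Real.norm_eq_abs]
    have h1 := hd.mul_abs_le (n := n) (t := n) (by linarith)
    exact (mul_le_mul_of_nonneg_left (hq n) (abs_nonneg _)).trans (h1.trans (le_abs_self _))
  · refine Summable.of_nonneg_of_le (fun _ => norm_nonneg _) (fun n => ?_) (seq_summable d)
    rw [norm_mul, norm_mul]
    simp only [Real.norm_eq_abs]
    rw [hd n, abs_of_nonneg (by positivity : 0 ≤ (1 + |(n : ℝ)|) ^ 2 * |c n|), ← mul_assoc]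
    have h1 := hq n
    have h2 := abs_nonneg (n : ℝ)
    gcongr
    nlinarith

/-- The derivatives of the profile of a wave. -/
theorem IsScaledWave.exists_deriv {s A B p p' : ℝ} {c : SeqSpace}
    (h : IsScaledWave s A B p p' c) (hs : |s| = 1) : ∃ Q₁ Q₂ : C(AddCircle (2 * π), ℂ),
      (∀ x : ℝ, HasDerivAt (fun y : ℝ => fourierSum (profileCoeff A B c) y) (Q₁ x) x) ∧
      ∀ x : ℝ, HasDerivAt (fun y : ℝ => Q₁ y) (Q₂ x) x := by
  have h0 := summable_profileCoeff h.abs_A h.abs_B c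
  obtain ⟨h1, h2⟩ := h.summable_deriv hs
  set q := profileCoeff A B c
  refine ⟨Complex.I • fourierSum (fun n => n * q n),
    Complex.I • Complex.I • fourierSum (fun n => n * (n * q n)), fun x => ?_, fun x => ?_⟩
  · exact hasDerivAt_fourierSum h0 h1 x
  · exact (hasDerivAt_fourierSum h1 h2 x).const_mul Complex.I

theorem IsScaledWave.fourierCoeff_equation {s A B p p' : ℝ} {c : SeqSpace}
    (h : IsScaledWave s A B p p' c) (n : ℤ) :
    dispersion p p' n * fourierCoeff (fourierSum (profileCoeff A B c)) n
      = -s * fourierCoeff (fourierSum (profileCoeff A B c) * star (fourierSum (profileCoeff A B c))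
        * fourierSum (profileCoeff A B c) : C(AddCircle (2 * π), ℂ)) n := by
  have h0 := summable_profileCoeff h.abs_A h.abs_B c
  rw [fourierCoeff_cubic h0, fourierCoeff_fourierSum h0]
  exact_mod_cast h.profile_equation n

theorem profileCoeff_low {A B : ℝ} {c : ℤ → ℝ} (h0 : c 0 = 1) (h1 : c (-1) = 1) :
    profileCoeff A B c 0 = amp * B ∧ profileCoeff A B c (-1) = amp * A := by
  simp [profileCoeff, mon, h0, h1]

theorem IsScaledWave.contDiff_unprofile {s A B p p' : ℝ} {c : SeqSpace}
    (h : IsScaledWave s A B p p' c) (hs : |s| = 1) :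
    ContDiff ℝ 2 (unprofile (fourierSum (profileCoeff A B c))) := by
  obtain ⟨Q₁, Q₂, h1, h2⟩ := h.exists_deriv hs
  have h3 : ContDiff ℝ 2 fun y : ℝ => fourierSum (profileCoeff A B c) y :=
    contDiff_two_of_hasDerivAt h1 h2 (Q₂.continuous.comp (AddCircle.continuous_mk' _))
  have h4 : ContDiff ℝ 2 fun y : ℝ => fourierSum (profileCoeff A B c) (2 * y : ℝ) :=
    h3.comp (contDiff_const.mul contDiff_id)
  have h5 : ContDiff ℝ 2 fun y : ℝ => Complex.exp (Complex.I * y) :=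
    (contDiff_const.mul Complex.ofRealCLM.contDiff).cexp
  exact h5.mul h4

theorem IsScaledWave.wave_equation {s A B p p' : ℝ} {c : SeqSpace}
    (h : IsScaledWave s A B p p' c) (hs : |s| = 1) {l k : ℝ} (hl : l = (p - p') / 2)
    (hk : k = (p + p') / 2) {P : ℝ → ℂ}
    (hP : P = unprofile (fourierSum (profileCoeff A B c))) (x : ℝ) :
    deriv (deriv (waveW l k P)) x + waveW l k P x
      - s * (‖waveW l k P x‖ ^ 2 : ℝ) * waveW l k P x = 0 := by
  obtain ⟨Q₁, Q₂, h1, h2⟩ := h.exists_deriv hs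
  have hprof : profileQ P = fun z : ℝ => fourierSum (profileCoeff A B c) z := by
    rw [hP]
    exact funext (profileQ_unprofile _)
  rw [wave_equation_iff (Q₁ := fun z : ℝ => Q₁ z) (Q₂ := fun z : ℝ => Q₂ z)
    (fun z => by rw [hprof]; exact h1 z) h2, hprof]
  have h3 := (profile_equation_iff (s := s) hk (fourierCoeff_deriv h1)
    (fourierCoeff_deriv h2)).2 h.fourierCoeff_equation ((2 * k * x : ℝ) : AddCircle (2 * π))
  have h4 : (l : ℂ) + k = p := by
    rw [hl, hk]
    push_cast
    ring
  rw [h4]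
  exact h3

theorem fourierSum_sub {q r : ℤ → ℝ} (hq : Summable fun n => ‖q n‖) (hr : Summable fun n => ‖r n‖) :
    fourierSum q - fourierSum r = fourierSum fun n => q n - r n := by
  have h := (hasSum_fourierSum hq).sub (hasSum_fourierSum hr)
  rw [← h.tsum_eq, fourierSum]
  refine tsum_congr fun n => ?_
  rw [Complex.ofReal_sub, sub_smul]

theorem continuousOn_profile {c : ℝ × ℝ → SeqSpace} (hc : ContinuousOn c square) :
    ContinuousOn (fun q : ℝ × ℝ => fourierSum (profileCoeff q.1 q.2 (c q))) square := by
  intro q₀ hq₀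
  rw [ContinuousWithinAt, tendsto_iff_norm_sub_tendsto_zero]
  have hb : Filter.Tendsto (fun q : ℝ × ℝ => ‖c q - c q₀‖
      + ∑' n, |mon q.1 q.2 n - mon q₀.1 q₀.2 n| * |c q₀ n|) (nhdsWithin q₀ square) (nhds 0) := by
    rw [← add_zero (0 : ℝ)]
    refine Filter.Tendsto.add (tendsto_iff_norm_sub_tendsto_zero.1 (hc q₀ hq₀)) ?_
    rw [← tsum_zero (α := ℝ) (β := ℤ)]
    refine tendsto_tsum_of_dominated_convergence ((seq_summable (c q₀)).mul_left 2)
      (fun n => ?_) ?_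
    · have : Continuous fun q : ℝ × ℝ => |mon q.1 q.2 n - mon q₀.1 q₀.2 n| * |c q₀ n| := by
        unfold mon
        fun_prop
      have h2 := (this.tendsto q₀).mono_left (nhdsWithin_le_nhds (s := square))
      simpa using h2
    · filter_upwards [self_mem_nhdsWithin] with q hq n
      rw [Real.norm_eq_abs, abs_mul, abs_abs, abs_abs]
      gcongr
      have h1 := abs_sub (mon q.1 q.2 n) (mon q₀.1 q₀.2 n)
      linarith [abs_mon_le hq.1 hq.2 n, abs_mon_le hq₀.1 hq₀.2 n]
  refine squeeze_zero' (Filter.Eventually.of_forall fun _ => norm_nonneg _) ?_ hb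
  filter_upwards [self_mem_nhdsWithin] with q hq
  have s1 := summable_profileCoeff hq.1 hq.2 (c q)
  have s2 := summable_profileCoeff hq₀.1 hq₀.2 (c q₀)
  have s4 : Summable fun n => |mon q.1 q.2 n - mon q₀.1 q₀.2 n| * |c q₀ n| := by
    refine Summable.of_nonneg_of_le (fun _ => by positivity) (fun n => ?_)
      ((seq_summable (c q₀)).mul_left 2)
    gcongr
    have h1 := abs_sub (mon q.1 q.2 n) (mon q₀.1 q₀.2 n)
    linarith [abs_mon_le hq.1 hq.2 n, abs_mon_le hq₀.1 hq₀.2 n]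
  have hle (n : ℤ) : ‖profileCoeff q.1 q.2 (c q) n - profileCoeff q₀.1 q₀.2 (c q₀) n‖
      ≤ |(c q - c q₀) n| + |mon q.1 q.2 n - mon q₀.1 q₀.2 n| * |c q₀ n| := by
    have e : profileCoeff q.1 q.2 (c q) n - profileCoeff q₀.1 q₀.2 (c q₀) n
        = amp * (mon q.1 q.2 n * (c q - c q₀) n
          + (mon q.1 q.2 n - mon q₀.1 q₀.2 n) * c q₀ n) := by
      simp only [profileCoeff, lp.coeFn_sub, Pi.sub_apply]
      ring
    rw [e, norm_mul]
    refine (mul_le_of_le_one_left (norm_nonneg _) (by norm_num [amp, abs_of_pos])).trans ?_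
    refine (norm_add_le _ _).trans ?_
    rw [norm_mul, norm_mul]
    simp only [Real.norm_eq_abs]
    gcongr
    exact mul_le_of_le_one_left (abs_nonneg _) (abs_mon_le hq.1 hq.2 n)
  have s5 := (seq_summable (c q - c q₀)).add s4
  have s3 : Summable fun n => ‖profileCoeff q.1 q.2 (c q) n - profileCoeff q₀.1 q₀.2 (c q₀) n‖ :=
    Summable.of_nonneg_of_le (fun _ => norm_nonneg _) hle s5
  rw [fourierSum_sub s1 s2]
  refine (norm_fourierSum_le s3).trans ?_
  rw [seq_norm, ← (seq_summable (c q - c q₀)).tsum_add s4]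
  exact s3.tsum_le_tsum hle s5

/-- At the low modes every cubic monomial has a positive power of `A` or `B`, so at zero amplitude
the symbol vanishes there and `p² = p'² = 1`. -/
theorem IsScaledWave.eq_one_of_zero {s p p' : ℝ} {c : SeqSpace} (h : IsScaledWave s 0 0 p p' c) :
    p = 1 ∧ p' = 1 ∧ ∀ n, profileCoeff 0 0 c n = 0 := by
  have hz (n : ℤ) (hn : n = 0 ∨ n = -1) : dispersion p p' n * c n = 0 := by
    rw [h.equation n, tsum_congr (g := fun _ => 0), tsum_zero, mul_zero]
    intro u
    have : expA u n ≠ 0 ∨ expB u n ≠ 0 := by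
      unfold expA expB
      omega
    rcases this with h1 | h1 <;> simp [wt, h1]
  obtain ⟨a1, a2⟩ := abs_le.1 h.abs_p
  obtain ⟨b1, b2⟩ := abs_le.1 h.abs_p'
  refine ⟨?_, ?_, fun n => ?_⟩
  · have := hz 0 (Or.inl rfl)
    rw [h.c_zero, dispersion] at this
    push_cast at this
    nlinarith
  · have := hz (-1) (Or.inr rfl)
    rw [h.c_neg_one, dispersion] at this
    push_cast at this
    nlinarith
  · have : n.natAbs ≠ 0 ∨ (n + 1).natAbs ≠ 0 := by omega
    rcases this with h1 | h1 <;> simp only [profileCoeff, mon] <;> rw [zero_pow h1] <;> simp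

/-- The scaled amplitudes. -/
def scaled (q : ℝ × ℝ) : ℝ × ℝ := (q.1 / amp, q.2 / amp)

theorem amp_pos : 0 < amp := by norm_num [amp]

theorem mapsTo_scaled : Set.MapsTo scaled (disc amp) square := by
  intro q hq
  have hq' : q.1 ^ 2 + q.2 ^ 2 < amp ^ 2 := hq
  have h1 : |q.1| ≤ amp := abs_le_of_sq_le_sq (by nlinarith [sq_nonneg q.2]) amp_pos.le
  have h2 : |q.2| ≤ amp := abs_le_of_sq_le_sq (by nlinarith [sq_nonneg q.1]) amp_pos.le
  constructor
  · simp only [scaled]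
    rw [abs_div, abs_of_pos amp_pos]
    exact (div_le_one amp_pos).2 h1
  · simp only [scaled]
    rw [abs_div, abs_of_pos amp_pos]
    exact (div_le_one amp_pos).2 h2

theorem continuous_scaled : Continuous scaled := by
  unfold scaled
  fun_prop

theorem isWaveFamily_of_scaledWave {s : ℝ} (hs : |s| = 1) {p p' : ℝ × ℝ → ℝ} {c : ℝ × ℝ → SeqSpace}
    (hp : ContinuousOn p square) (hp' : ContinuousOn p' square) (hc : ContinuousOn c square)
    (hw : ∀ q ∈ square, IsScaledWave s q.1 q.2 (p q) (p' q) (c q)) :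
    IsWaveFamily s amp (fun q => (p (scaled q) - p' (scaled q)) / 2)
      (fun q => (p (scaled q) + p' (scaled q)) / 2)
      (fun q => unprofile (fourierSum (profileCoeff (scaled q).1 (scaled q).2 (c (scaled q))))) := by
  have h0 : scaled 0 = 0 := by simp [scaled]
  have h00 : (0 : ℝ × ℝ) ∈ square := by simp [square]
  obtain ⟨e1, e2, e3⟩ := (hw 0 h00).eq_one_of_zero
  have hps := hp.comp continuous_scaled.continuousOn mapsTo_scaled
  have hps' := hp'.comp continuous_scaled.continuousOn mapsTo_scaled
  have hW (q : ℝ × ℝ) (hq : q ∈ disc amp) := hw _ (mapsTo_scaled hq)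
  have hcoef (q : ℝ × ℝ) (hq : q ∈ disc amp) := fourierCoeff_profile
    (continuous_unprofile (fourierSum (profileCoeff (scaled q).1 (scaled q).2 (c (scaled q)))))
    (unprofile_add_pi _) (fun z => (profileQ_unprofile _ z).symm)
  have hsum (q : ℝ × ℝ) (hq : q ∈ disc amp) :=
    summable_profileCoeff (hW q hq).abs_A (hW q hq).abs_B (c (scaled q))
  constructor
  · exact (hps.sub hps').div_const 2
  · exact (hps.add hps').div_const 2
  · have h1 := (continuousOn_profile hc).comp continuous_scaled.continuousOn mapsTo_scaled
    have h2 : ContinuousOn (fun x : (ℝ × ℝ) × ℝ => fourierSum (profileCoeff (scaled x.1).1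
        (scaled x.1).2 (c (scaled x.1)))) (disc amp ×ˢ Set.univ) :=
      h1.comp continuousOn_fst fun x hx => hx.1
    have h3 : Continuous fun x : (ℝ × ℝ) × ℝ => ((2 * x.2 : ℝ) : AddCircle (2 * π)) :=
      (AddCircle.continuous_mk' _).comp (continuous_const.mul continuous_snd)
    have h4 : Continuous fun x : (ℝ × ℝ) × ℝ => Complex.exp (Complex.I * x.2) := by fun_prop
    exact h4.continuousOn.mul (h2.eval h3.continuousOn)
  · simp only [h0, e1, e2, sub_self, zero_div]
  · simp only [h0, e1, e2]
    norm_num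
  · intro y
    have : fourierSum (profileCoeff 0 0 (c 0)) = 0 := by
      rw [fourierSum, tsum_congr (g := fun _ => 0) fun n => by rw [e3]; simp, tsum_zero]
    simp only [h0, Prod.fst_zero, Prod.snd_zero, unprofile, this, ContinuousMap.zero_apply, mul_zero]
  · exact fun q hq => (hW q hq).contDiff_unprofile hs
  · exact fun q hq => unprofile_add_pi _
  · exact fun q hq => (hW q hq).wave_equation hs rfl rfl rfl
  · intro q hq
    rw [← (hcoef q hq).1, fourierCoeff_fourierSum (hsum q hq),
      (profileCoeff_low (hW q hq).c_zero (hW q hq).c_neg_one).2, scaled,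
      mul_div_cancel₀ _ amp_pos.ne']
  · intro q hq
    rw [← (hcoef q hq).2, fourierCoeff_fourierSum (hsum q hq),
      (profileCoeff_low (hW q hq).c_zero (hW q hq).c_neg_one).1, scaled,
      mul_div_cancel₀ _ amp_pos.ne']

end PeriodicNLS

end

noncomputable section

namespace PeriodicNLS

open scoped ComplexConjugate

/-! ### Uniqueness of the profile -/

theorem exists_continuousMap_of_periodic {f : ℝ → ℂ} (hf : Continuous f)
    (hper : Function.Periodic f (2 * π)) : ∃ F : C(AddCircle (2 * π), ℂ), ∀ x : ℝ, F x = f x :=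
  ⟨⟨hper.lift, (QuotientAddGroup.isQuotientMap_mk _).continuous_iff.2 hf⟩, fun _ => rfl⟩

theorem periodic_deriv {f : ℝ → ℂ} {T : ℝ} (h : Function.Periodic f T) :
    Function.Periodic (deriv f) T := fun x => by
  rw [← deriv_comp_add_const, funext h]

theorem periodic_profileQ {P : ℝ → ℂ} (hanti : ∀ y, P (y + π) = -P y) :
    Function.Periodic (profileQ P) (2 * π) := fun z => by
  rw [profileQ, profileQ, show (z + 2 * π) / 2 = z / 2 + π by ring, hanti, Complex.exp_neg,
    exp_I_mul_add_pi, inv_neg, neg_mul_neg, ← Complex.exp_neg]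

theorem contDiff_profileQ {P : ℝ → ℂ} (hP : ContDiff ℝ 2 P) : ContDiff ℝ 2 (profileQ P) := by
  have h1 : ContDiff ℝ 2 fun z : ℝ => z / 2 := contDiff_id.div_const 2
  have h2 : ContDiff ℝ 2 fun z : ℝ => ((z / 2 : ℝ) : ℂ) := Complex.ofRealCLM.contDiff.comp h1
  exact ((contDiff_const.mul h2).neg.cexp).mul (hP.comp h1)

/-- The profile of a wave satisfies the equation on the Fourier side. -/
theorem exists_profile {s l k : ℝ} {P : ℝ → ℂ} (hk : k ≠ 0) (hP : ContDiff ℝ 2 P)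
    (hanti : ∀ y, P (y + π) = -P y)
    (heq : ∀ x, deriv (deriv (waveW l k P)) x + waveW l k P x
      - s * (‖waveW l k P x‖ ^ 2 : ℝ) * waveW l k P x = 0) :
    ∃ Q : C(AddCircle (2 * π), ℂ), (∀ z : ℝ, Q z = profileQ P z) ∧
      ∀ n, dispersion (l + k) (k - l) n * fourierCoeff Q n
        = -s * fourierCoeff (Q * star Q * Q : C(AddCircle (2 * π), ℂ)) n := by
  have hc := contDiff_profileQ hP
  have hper := periodic_profileQ hanti
  have hc1 : ContDiff ℝ 1 (deriv (profileQ P)) := by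
    rw [show (2 : WithTop ℕ∞) = 1 + 1 by norm_num, contDiff_succ_iff_deriv] at hc
    exact hc.2.2
  have hd1 (z : ℝ) : HasDerivAt (profileQ P) (deriv (profileQ P) z) z :=
    (hc.differentiable (by norm_num) z).hasDerivAt
  have hd2 (z : ℝ) : HasDerivAt (deriv (profileQ P)) (deriv (deriv (profileQ P)) z) z :=
    (hc1.differentiable (by norm_num) z).hasDerivAt
  obtain ⟨Q, hQ⟩ := exists_continuousMap_of_periodic hc.continuous hper
  obtain ⟨Q₁, hQ₁⟩ := exists_continuousMap_of_periodic hc1.continuous (periodic_deriv hper)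
  obtain ⟨Q₂, hQ₂⟩ := exists_continuousMap_of_periodic (contDiff_one_iff_deriv.1 hc1).2
    (periodic_deriv (periodic_deriv hper))
  refine ⟨Q, hQ, (profile_equation_iff (k := k) (by ring) (Q₁ := Q₁) (Q₂ := Q₂)
    (fourierCoeff_deriv fun x => ?_) (fourierCoeff_deriv fun x => ?_)).1 fun z => ?_⟩
  · rw [funext hQ, hQ₁]
    exact hd1 x
  · rw [funext hQ₁, hQ₂]
    exact hd2 x
  · obtain ⟨x, rfl⟩ := QuotientAddGroup.mk_surjective z
    have h := (wave_equation_iff hd1 hd2 (x / (2 * k))).1 (heq _)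
    rw [mul_div_cancel₀ x (mul_ne_zero two_ne_zero hk)] at h
    have e1 := hQ x
    have e2 := hQ₁ x
    have e3 := hQ₂ x
    rw [e1, e2, e3]
    push_cast
    exact h

theorem norm_fourierCoeff_le (φ : C(AddCircle (2 * π), ℂ)) (n : ℤ) : ‖fourierCoeff φ n‖ ≤ ‖φ‖ := by
  rw [fourierCoeff]
  refine (norm_integral_le_of_norm_le_const (C := ‖φ‖) (Filter.Eventually.of_forall fun z => ?_)).trans
    (by simp)
  rw [norm_smul, fourier_apply, Circle.norm_coe, one_mul]
  exact φ.norm_coe_le_norm z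

theorem norm_cube_sub_le {Q R : C(AddCircle (2 * π), ℂ)} {η : ℝ} (hQ : ‖Q‖ ≤ η) (hR : ‖R‖ ≤ η) :
    ‖Q * star Q * Q - R * star R * R‖ ≤ 3 * η ^ 2 * ‖Q - R‖ := by
  have e : Q * star Q * Q - R * star R * R
      = (Q - R) * star Q * Q + R * star (Q - R) * Q + R * star R * (Q - R) := by
    rw [star_sub]
    ring
  have hη : 0 ≤ η := (norm_nonneg _).trans hQ
  have h3 (x y z : C(AddCircle (2 * π), ℂ)) : ‖x * y * z‖ ≤ ‖x‖ * ‖y‖ * ‖z‖ :=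
    (norm_mul_le _ _).trans (mul_le_mul_of_nonneg_right (norm_mul_le _ _) (norm_nonneg _))
  rw [e]
  refine norm_add₃_le.trans ?_
  have a1 := h3 (Q - R) (star Q) Q
  have a2 := h3 R (star (Q - R)) Q
  have a3 := h3 R (star R) (Q - R)
  rw [norm_star] at a1 a2 a3
  have b1 : ‖Q - R‖ * ‖Q‖ * ‖Q‖ ≤ ‖Q - R‖ * η * η := by gcongr
  have b2 : ‖R‖ * ‖Q - R‖ * ‖Q‖ ≤ η * ‖Q - R‖ * η := by gcongr
  have b3 : ‖R‖ * ‖R‖ * ‖Q - R‖ ≤ η * η * ‖Q - R‖ := by gcongr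
  linarith

theorem norm_le_tsum_fourierCoeff {φ : C(AddCircle (2 * π), ℂ)} {u : ℤ → ℝ} (hu : Summable u)
    (h : ∀ n, ‖fourierCoeff φ n‖ ≤ u n) : ‖φ‖ ≤ ∑' n, u n := by
  have h1 : Summable (fourierCoeff φ) := Summable.of_norm_bounded hu h
  have h2 := hasSum_fourier_series_of_summable h1
  rw [← h2.tsum_eq]
  refine tsum_of_norm_bounded hu.hasSum fun n => ?_
  rw [norm_smul, fourier_norm, mul_one]
  exact h n

theorem summable_inv_sq : Summable fun n : ℤ => 1 / (1 + |(n : ℝ)|) ^ 2 := by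
  refine Summable.of_nonneg_of_le (fun _ => by positivity) (fun n => ?_)
    ((Real.summable_one_div_int_pow.2 one_lt_two).add (hasSum_ite_eq (0 : ℤ) (1 : ℝ)).summable)
  by_cases hn : n = 0
  · simp [hn]
  · rw [if_neg hn, add_zero, ← sq_abs (n : ℝ)]
    have : 0 < |(n : ℝ)| := by positivity
    gcongr
    linarith

/-- The constant in the contraction estimate for the profile. -/
def profileConst : ℝ := 6 * ∑' n : ℤ, 1 / (1 + |(n : ℝ)|) ^ 2 + 120

/-- Both solutions have the same amplitude `b` at this mode, so subtracting the equations leaves `(p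
- r)(p + r) b`. With `p + r ≥ 3/2`, the constant is `3 / (3/2)`. The wave number is controlled only
after multiplication by `b`. -/
theorem abs_sub_mul_le {s p r b t : ℝ} {x y M N : ℂ} (hs : |s| = 1) (hp : |p - 1| ≤ 1 / 100)
    (hr : |r - 1| ≤ 1 / 100) (hx : x = b) (hy : y = b)
    (h1 : ((p ^ 2 - 1 : ℝ) : ℂ) * x = -s * M) (h2 : ((r ^ 2 - 1 : ℝ) : ℂ) * y = -s * N)
    (hMN : ‖M - N‖ ≤ 3 * t) : |p - r| * |b| ≤ 2 * t := by
  have e : (((p - r) * b * (p + r) : ℝ) : ℂ) = -s * (M - N) := by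
    rw [hx] at h1
    rw [hy] at h2
    push_cast at h1 h2 ⊢
    linear_combination h1 - h2
  have h3 := congrArg norm e
  rw [Complex.norm_real] at h3
  simp only [norm_mul, norm_neg, Complex.norm_real, Real.norm_eq_abs, hs, one_mul] at h3
  have h4 : 3 / 2 ≤ |p + r| := by
    refine le_trans ?_ (le_abs_self _)
    linarith [(abs_le.1 hp).1, (abs_le.1 hr).1]
  have h5 := mul_le_mul_of_nonneg_left h4 (mul_nonneg (abs_nonneg (p - r)) (abs_nonneg b))
  linarith

theorem abs_mon_le_mul {A B : ℝ} (hA : |A| ≤ 1) (hB : |B| ≤ 1) {n : ℤ} (h0 : n ≠ 0) (h1 : n ≠ -1) :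
    |mon A B n| ≤ |A| * |B| := by
  rw [mon, abs_mul, abs_pow, abs_pow]
  simpa using mul_pow_le_mul_pow hA hB (show 1 ≤ n.natAbs by omega)
    (show 1 ≤ (n + 1).natAbs by omega)

/-- Small profiles with the same amplitudes agree, if both amplitudes are nonzero. -/
theorem IsScaledWave.eq_profile {s A B p p' r r' η : ℝ} {c : SeqSpace}
    (h : IsScaledWave s A B r r' c) (hs : |s| = 1) (hA : A ≠ 0) (hB : B ≠ 0)
    (hp : |p - 1| ≤ 1 / 100) (hp' : |p' - 1| ≤ 1 / 100) {Q : C(AddCircle (2 * π), ℂ)}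
    (hQ : ∀ n, dispersion p p' n * fourierCoeff Q n
      = -s * fourierCoeff (Q * star Q * Q : C(AddCircle (2 * π), ℂ)) n)
    (h0 : fourierCoeff Q 0 = (amp * B : ℝ)) (h1 : fourierCoeff Q (-1) = (amp * A : ℝ))
    (hQη : ‖Q‖ ≤ η) (hRη : ‖fourierSum (profileCoeff A B c)‖ ≤ η)
    (hη : η ^ 2 * profileConst < 1) :
    Q = fourierSum (profileCoeff A B c) ∧ p = r ∧ p' = r' := by
  set R := fourierSum (profileCoeff A B c) with hR
  have hq := summable_profileCoeff h.abs_A h.abs_B c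
  have hRc (n : ℤ) : fourierCoeff R n = profileCoeff A B c n := fourierCoeff_fourierSum hq n
  have hReq := h.fourierCoeff_equation
  rw [← hR] at hReq
  obtain ⟨r0, r1⟩ := profileCoeff_low (A := A) (B := B) h.c_zero h.c_neg_one
  set S := ‖Q - R‖ with hS
  have hS0 : 0 ≤ S := norm_nonneg _
  have hη0 : 0 ≤ η := (norm_nonneg _).trans hQη
  have hN (n : ℤ) : ‖fourierCoeff (Q * star Q * Q : C(AddCircle (2 * π), ℂ)) n
      - fourierCoeff (R * star R * R : C(AddCircle (2 * π), ℂ)) n‖ ≤ 3 * (η ^ 2 * S) := by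
    rw [← coeffCLM_apply, ← coeffCLM_apply, ← map_sub, coeffCLM_apply]
    refine (norm_fourierCoeff_le _ n).trans ((norm_cube_sub_le hQη hRη).trans (le_of_eq ?_))
    ring
  have d0 (t t' : ℝ) : dispersion t t' 0 = t ^ 2 - 1 := by simp [dispersion]
  have d1 (t t' : ℝ) : dispersion t t' (-1) = t' ^ 2 - 1 := by simp [dispersion]
  have k0 : |p - r| * |amp * B| ≤ 2 * (η ^ 2 * S) :=
    abs_sub_mul_le hs hp h.abs_p h0 ((hRc 0).trans (by rw [r0])) (by rw [← d0 p p']; exact hQ 0)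
      (by rw [← d0 r r']; exact hReq 0) (hN 0)
  have k1 : |p' - r'| * |amp * A| ≤ 2 * (η ^ 2 * S) :=
    abs_sub_mul_le hs hp' h.abs_p' h1 ((hRc (-1)).trans (by rw [r1]))
      (by rw [← d1 p p']; exact hQ (-1)) (by rw [← d1 r r']; exact hReq (-1)) (hN (-1))
  rw [abs_mul, abs_of_pos amp_pos] at k0 k1
  -- The constants are `2 · 3` and `2 · 20`, the factor 2 coming from the lower bound `w / 2` of the
  -- symbol.
  have hD (n : ℤ) : ‖fourierCoeff (Q - R : C(AddCircle (2 * π), ℂ)) n‖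
      ≤ 6 * (η ^ 2 * S) * (1 / (1 + |(n : ℝ)|) ^ 2) + 40 * (η ^ 2 * S) * |c n| := by
    have eD : fourierCoeff (Q - R : C(AddCircle (2 * π), ℂ)) n
        = fourierCoeff Q n - profileCoeff A B c n := by
      rw [← coeffCLM_apply, map_sub, coeffCLM_apply, coeffCLM_apply, hRc]
    by_cases n0 : n = 0
    · rw [eD, n0, h0, r0, sub_self, norm_zero]
      positivity
    by_cases n1 : n = -1
    · rw [eD, n1, h1, r1, sub_self, norm_zero]
      positivity
    have hΛ := (dispersion_lower hp hp' n0 n1).2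
    have hdiff := abs_dispersion_sub_le hp hp' h.abs_p h.abs_p' n
    have e : (dispersion p p' n : ℂ) * fourierCoeff (Q - R : C(AddCircle (2 * π), ℂ)) n
        = -s * (fourierCoeff (Q * star Q * Q : C(AddCircle (2 * π), ℂ)) n
          - fourierCoeff (R * star R * R : C(AddCircle (2 * π), ℂ)) n)
          - ((dispersion p p' n - dispersion r r' n : ℝ) : ℂ) * profileCoeff A B c n := by
      have e1 := hQ n
      have e2 := hReq n
      rw [hRc] at e2
      rw [eD]
      push_cast
      linear_combination e1 - e2
    have e3 := congrArg norm e
    rw [norm_mul, Complex.norm_real, Real.norm_eq_abs] at e3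
    have e4 : |dispersion p p' n| * ‖fourierCoeff (Q - R : C(AddCircle (2 * π), ℂ)) n‖
        ≤ 3 * (η ^ 2 * S) + |dispersion p p' n - dispersion r r' n| * |profileCoeff A B c n| := by
      rw [e3]
      refine (norm_sub_le _ _).trans ?_
      rw [norm_mul, norm_mul, norm_neg, Complex.norm_real, Complex.norm_real, Complex.norm_real,
        Real.norm_eq_abs, Real.norm_eq_abs, Real.norm_eq_abs, hs, one_mul]
      exact add_le_add_left (hN n) _
    have e5 : |profileCoeff A B c n| ≤ amp * (|A| * |B|) * |c n| := by
      rw [profileCoeff, abs_mul, abs_mul, abs_of_pos amp_pos]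
      have := abs_mon_le_mul h.abs_A h.abs_B n0 n1
      have := amp_pos
      gcongr
    -- The factor `|A||B|` of the high modes absorbs the division by the amplitudes, so the estimate
    -- stays uniform as `ab → 0`.
    have e6 : (|p - r| + |p' - r'|) * (amp * (|A| * |B|)) ≤ 4 * (η ^ 2 * S) := by
      have f1 := mul_le_mul k0 h.abs_A (abs_nonneg A) (by positivity)
      have f2 := mul_le_mul k1 h.abs_B (abs_nonneg B) (by positivity)
      linarith
    set w := (1 + |(n : ℝ)|) ^ 2 with hw
    have hw0 : 0 < w := by positivity
    have e7 : |dispersion p p' n - dispersion r r' n| * |profileCoeff A B c n|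
        ≤ w * (20 * (η ^ 2 * S) * |c n|) := by
      calc _ ≤ 5 * w * (|p - r| + |p' - r'|) * (amp * (|A| * |B|) * |c n|) := by gcongr
        _ = 5 * w * |c n| * ((|p - r| + |p' - r'|) * (amp * (|A| * |B|))) := by ring
        _ ≤ 5 * w * |c n| * (4 * (η ^ 2 * S)) := by gcongr
        _ = _ := by ring
    have e8 := mul_le_mul_of_nonneg_right (hΛ.trans (le_abs_self _))
      (norm_nonneg (fourierCoeff (Q - R : C(AddCircle (2 * π), ℂ)) n))
    have e9 : w * ‖fourierCoeff (Q - R : C(AddCircle (2 * π), ℂ)) n‖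
        ≤ w * (6 * (η ^ 2 * S) * (1 / w) + 40 * (η ^ 2 * S) * |c n|) := by
      have : w * (6 * (η ^ 2 * S) * (1 / w) + 40 * (η ^ 2 * S) * |c n|)
          = 6 * (η ^ 2 * S) + w * (40 * (η ^ 2 * S) * |c n|) := by
        field_simp
      rw [this]
      linarith
    exact le_of_mul_le_mul_left e9 hw0
  have hsum := (summable_inv_sq.mul_left (6 * (η ^ 2 * S))).add
    ((seq_summable c).mul_left (40 * (η ^ 2 * S)))
  have hbound := norm_le_tsum_fourierCoeff hsum hD
  rw [(summable_inv_sq.mul_left (6 * (η ^ 2 * S))).tsum_add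
    ((seq_summable c).mul_left (40 * (η ^ 2 * S))), tsum_mul_left, tsum_mul_left, ← seq_norm,
    ← hS] at hbound
  have hc3 : 40 * (η ^ 2 * S) * ‖c‖ ≤ 40 * (η ^ 2 * S) * 3 := by
    have := h.norm_c
    gcongr
  -- The bound `‖c‖ ≤ 3` turns 40 into the 120 of `profileConst`; since `η² profileConst < 1`, the
  -- inequality forces `S = 0`.
  have hSle : S ≤ η ^ 2 * profileConst * S := by
    rw [profileConst]
    linarith
  have hSz : S = 0 := by nlinarith
  rw [hSz, mul_zero, mul_zero] at k0 k1
  have hz {x y : ℝ} (hy : y ≠ 0) (hxy : |x| * (amp * |y|) ≤ 0) : x = 0 := by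
    have h2 : 0 < amp * |y| := mul_pos amp_pos (abs_pos.2 hy)
    have h3 : |x| ≤ 0 := nonpos_of_mul_nonpos_left hxy h2
    exact abs_eq_zero.1 (le_antisymm h3 (abs_nonneg x))
  exact ⟨sub_eq_zero.1 (norm_eq_zero.1 hSz), sub_eq_zero.1 (hz hB k0), sub_eq_zero.1 (hz hA k1)⟩

end PeriodicNLS

end

noncomputable section

namespace PeriodicNLS

open Filter Topology

/-! ### Comparison of two families -/

theorem isOpen_disc (r : ℝ) : IsOpen (disc r) :=
  isOpen_lt (by fun_prop) continuous_const

theorem zero_mem_disc {r : ℝ} (hr : 0 < r) : (0 : ℝ × ℝ) ∈ disc r := by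
  change (0 : ℝ) ^ 2 + (0 : ℝ) ^ 2 < r ^ 2
  rw [zero_pow two_ne_zero, add_zero]
  positivity

theorem disc_subset {r r' : ℝ} (hr : 0 ≤ r) (h : r ≤ r') : disc r ⊆ disc r' := fun q hq =>
  lt_of_lt_of_le (show q.1 ^ 2 + q.2 ^ 2 < r ^ 2 from hq) (by gcongr)

theorem exists_disc_subset {U : Set (ℝ × ℝ)} (hU : U ∈ 𝓝 (0 : ℝ × ℝ)) : ∃ ρ > 0, disc ρ ⊆ U := by
  obtain ⟨ρ, hρ, h⟩ := Metric.mem_nhds_iff.1 hU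
  refine ⟨ρ, hρ, fun q hq => h ?_⟩
  have hq' : q.1 ^ 2 + q.2 ^ 2 < ρ ^ 2 := hq
  rw [mem_ball_zero_iff, Prod.norm_def, max_lt_iff]
  exact ⟨abs_lt_of_sq_lt_sq (by nlinarith [sq_nonneg q.2]) hρ.le,
    abs_lt_of_sq_lt_sq (by nlinarith [sq_nonneg q.1]) hρ.le⟩

theorem norm_profileQ (P : ℝ → ℂ) (z : ℝ) : ‖profileQ P z‖ = ‖P (z / 2)‖ := by
  rw [profileQ, norm_mul, ← mul_neg, ← Complex.ofReal_neg, mul_comm Complex.I,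
    Complex.norm_exp_ofReal_mul_I, one_mul]

section Family

variable {s r : ℝ} {l k : ℝ × ℝ → ℝ} {P : ℝ × ℝ → ℝ → ℂ}

theorem IsWaveFamily.eventually_small (hF : IsWaveFamily s r l k P) (hr : 0 < r) {η : ℝ}
    (hη : 0 < η) : ∀ᶠ q in 𝓝 (0 : ℝ × ℝ), ∀ y ∈ Set.Icc 0 π, ‖P q y‖ < η := by
  refine isCompact_Icc.eventually_forall_of_forall_eventually fun y _ => ?_
  have hn : disc r ×ˢ (Set.univ : Set ℝ) ∈ 𝓝 ((0 : ℝ × ℝ), y) :=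
    prod_mem_nhds ((isOpen_disc r).mem_nhds (zero_mem_disc hr)) univ_mem
  have hc := (hF.continuousOn_P.continuousAt hn).norm
  have h0 : ‖P ((0 : ℝ × ℝ), y).1 ((0 : ℝ × ℝ), y).2‖ < η := by
    simp only [hF.P_zero y, norm_zero]
    exact hη
  exact hc.eventually_lt continuousAt_const h0

theorem IsWaveFamily.eventually_wavenumbers (hF : IsWaveFamily s r l k P) (hr : 0 < r) :
    ∀ᶠ q in 𝓝 (0 : ℝ × ℝ), |l q + k q - 1| < 1 / 100 ∧ |k q - l q - 1| < 1 / 100 := by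
  have hn : disc r ∈ 𝓝 (0 : ℝ × ℝ) := (isOpen_disc r).mem_nhds (zero_mem_disc hr)
  have hl := hF.continuousOn_l.continuousAt hn
  have hk := hF.continuousOn_k.continuousAt hn
  have h1 := ((hl.add hk).sub (continuousAt_const (y := (1 : ℝ)))).abs
  have h2 := ((hk.sub hl).sub (continuousAt_const (y := (1 : ℝ)))).abs
  refine (h1.eventually_lt (continuousAt_const (y := (1 / 100 : ℝ))) ?_).and
    (h2.eventually_lt (continuousAt_const (y := (1 / 100 : ℝ))) ?_)
  · simp [hF.l_zero, hF.k_zero]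
  · simp [hF.l_zero, hF.k_zero]

theorem IsWaveFamily.exists_radius (hF : IsWaveFamily s r l k P) (hr : 0 < r) {η : ℝ}
    (hη : 0 < η) : ∃ ρ > 0, ρ ≤ r ∧ ρ ≤ amp ∧ 3 * ρ ≤ η ∧ ∀ q ∈ disc ρ,
      (|l q + k q - 1| < 1 / 100 ∧ |k q - l q - 1| < 1 / 100) ∧
      ∀ y ∈ Set.Icc 0 π, ‖P q y‖ < η := by
  obtain ⟨ρ, hρ, h⟩ := exists_disc_subset ((hF.eventually_wavenumbers hr).and
    (hF.eventually_small hr hη))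
  refine ⟨min (min ρ r) (min amp (η / 3)), ?_, ?_, ?_, ?_, fun q hq => h (disc_subset ?_ ?_ hq)⟩
  · have := amp_pos
    positivity
  · exact (min_le_left _ _).trans (min_le_right _ _)
  · exact (min_le_right _ _).trans (min_le_left _ _)
  · have := (min_le_right (min ρ r) (min amp (η / 3))).trans (min_le_right _ _)
    linarith
  · have := amp_pos
    positivity
  · exact (min_le_left _ _).trans (min_le_left _ _)

theorem exists_small_amplitude : ∃ η > 0, η ^ 2 * profileConst < 1 := by
  have hK : 0 < profileConst := by
    have : 0 ≤ ∑' n : ℤ, 1 / (1 + |(n : ℝ)|) ^ 2 := tsum_nonneg fun n => by positivity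
    rw [profileConst]
    linarith
  refine ⟨1 / √(2 * profileConst), by positivity, ?_⟩
  rw [div_pow, Real.sq_sqrt (by positivity), one_pow]
  have : 1 / (2 * profileConst) * profileConst = 1 / 2 := by field_simp
  rw [this]
  norm_num

theorem dense_mul_ne_zero : Dense {q : ℝ × ℝ | q.1 ≠ 0 ∧ q.2 ≠ 0} := by
  have h := (dense_compl_singleton (0 : ℝ)).prod (dense_compl_singleton (0 : ℝ))
  exact h

/-- Every family of small waves agrees with the constructed one near the origin. -/
theorem IsWaveFamily.exists_eq (hF : IsWaveFamily s r l k P) (hs : |s| = 1) (hr : 0 < r)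
    {p p' : ℝ × ℝ → ℝ} {c : ℝ × ℝ → SeqSpace} (hp : ContinuousOn p square)
    (hp' : ContinuousOn p' square) (hc : ContinuousOn c square)
    (hw : ∀ q ∈ square, IsScaledWave s q.1 q.2 (p q) (p' q) (c q)) :
    ∃ ρ > 0, ρ ≤ r ∧ ρ ≤ amp ∧ ∀ q ∈ disc ρ, l q + k q = p (scaled q) ∧ k q - l q = p' (scaled q) ∧
      ∀ z : ℝ, profileQ (P q) z
        = fourierSum (profileCoeff (scaled q).1 (scaled q).2 (c (scaled q))) z := by
  obtain ⟨η, hη, hηK⟩ := exists_small_amplitude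
  obtain ⟨ρ, hρ, hρr, hρa, hρη, hsmall⟩ := hF.exists_radius hr hη
  refine ⟨ρ, hρ, hρr, hρa, ?_⟩
  have hsub : disc ρ ⊆ disc r := disc_subset hρ.le hρr
  have hsubA : disc ρ ⊆ disc amp := disc_subset hρ.le hρa
  have hmaps : Set.MapsTo scaled (disc ρ) square := fun q hq => mapsTo_scaled (hsubA hq)
  have main : ∀ q ∈ disc ρ ∩ {q : ℝ × ℝ | q.1 ≠ 0 ∧ q.2 ≠ 0}, l q + k q = p (scaled q) ∧
      k q - l q = p' (scaled q) ∧ ∀ z : ℝ, profileQ (P q) z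
        = fourierSum (profileCoeff (scaled q).1 (scaled q).2 (c (scaled q))) z := by
    rintro q ⟨hq, hq1, hq2⟩
    have hqr := hsub hq
    obtain ⟨⟨b1, b2⟩, b3⟩ := hsmall q hq
    have hk0 : k q ≠ 0 := by
      have h1 := (abs_lt.1 b1).1
      have h2 := (abs_lt.1 b2).1
      intro h0
      rw [h0] at h1 h2
      linarith
    obtain ⟨Q, hQ, hQeq⟩ := exists_profile hk0 (hF.contDiff q hqr) (hF.antiperiodic q hqr)
      (hF.equation q hqr)
    obtain ⟨c1, c2⟩ := fourierCoeff_profile (hF.contDiff q hqr).continuous (hF.antiperiodic q hqr) hQ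
    rw [hF.coeff_a q hqr] at c1
    rw [hF.coeff_b q hqr] at c2
    have hW := hw _ (hmaps hq)
    -- The variable `z` in `(0, 2π]` becomes `z / 2` in `(0, π]`, so the bound on `P` over one
    -- half-period suffices.
    have hQη : ‖Q‖ ≤ η := by
      refine (ContinuousMap.norm_le _ hη.le).2 fun z => ?_
      obtain ⟨x, hx, rfl⟩ : ∃ x ∈ Set.Ioc (0 : ℝ) (0 + 2 * π), (x : AddCircle (2 * π)) = z := by
        have := AddCircle.coe_image_Ioc_eq (2 * π) 0
        have hz : z ∈ (Set.univ : Set (AddCircle (2 * π))) := Set.mem_univ z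
        rw [← this] at hz
        exact hz
      rw [hQ, norm_profileQ]
      rw [zero_add] at hx
      exact (b3 (x / 2) ⟨by linarith [hx.1], by linarith [hx.2]⟩).le
    have hRη : ‖fourierSum (profileCoeff (scaled q).1 (scaled q).2 (c (scaled q)))‖ ≤ η := by
      refine hW.norm_profile_le.trans ?_
      have e : 3 * amp * √((scaled q).1 ^ 2 + (scaled q).2 ^ 2) = 3 * √(q.1 ^ 2 + q.2 ^ 2) := by
        have e1 : (scaled q).1 ^ 2 + (scaled q).2 ^ 2 = (q.1 ^ 2 + q.2 ^ 2) / amp ^ 2 := by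
          simp only [scaled]
          ring
        rw [e1, Real.sqrt_div' _ (sq_nonneg amp), Real.sqrt_sq amp_pos.le]
        have := amp_pos.ne'
        field_simp
      rw [e]
      have h3 : √(q.1 ^ 2 + q.2 ^ 2) ≤ ρ :=
        Real.sqrt_le_iff.2 ⟨hρ.le, le_of_lt hq⟩
      linarith
    have e1 : amp * (scaled q).1 = q.1 := mul_div_cancel₀ _ amp_pos.ne'
    have e2 : amp * (scaled q).2 = q.2 := mul_div_cancel₀ _ amp_pos.ne'
    obtain ⟨f1, f2, f3⟩ := hW.eq_profile hs (div_ne_zero hq1 amp_pos.ne')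
      (div_ne_zero hq2 amp_pos.ne') b1.le b2.le hQeq (by rw [c2, e2]) (by rw [c1, e1]) hQη hRη hηK
    exact ⟨f2, f3, fun z => by rw [← hQ, f1]⟩
  -- Pairs with `ab ≠ 0` are dense, so continuity in the parameters extends the agreement to the
  -- axes; there the equation alone would not fix the wave numbers.
  have hext {Y : Type} [TopologicalSpace Y] [T2Space Y] {f g : ℝ × ℝ → Y}
      (hf : ContinuousOn f (disc ρ)) (hg : ContinuousOn g (disc ρ))
      (hfg : Set.EqOn f g (disc ρ ∩ {q : ℝ × ℝ | q.1 ≠ 0 ∧ q.2 ≠ 0})) : Set.EqOn f g (disc ρ) :=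
    hfg.of_subset_closure hf hg Set.inter_subset_left
      (dense_mul_ne_zero.open_subset_closure_inter (isOpen_disc ρ))
  have hl := hF.continuousOn_l.mono hsub
  have hk := hF.continuousOn_k.mono hsub
  have hcs := continuous_scaled.continuousOn (s := disc ρ)
  have g1 := hext (hl.add hk) (hp.comp hcs hmaps) fun q hq => (main q hq).1
  have g2 := hext (hk.sub hl) (hp'.comp hcs hmaps) fun q hq => (main q hq).2.1
  refine fun q hq => ⟨g1 hq, g2 hq, fun z => ?_⟩
  have hPz : ContinuousOn (fun q => P q (z / 2)) (disc ρ) :=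
    hF.continuousOn_P.comp (f := fun q : ℝ × ℝ => (q, z / 2)) (by fun_prop)
      fun q hq => ⟨hsub hq, Set.mem_univ _⟩
  have hRz : ContinuousOn (fun q => fourierSum (profileCoeff (scaled q).1 (scaled q).2
      (c (scaled q))) (z : AddCircle (2 * π))) (disc ρ) :=
    ((continuousOn_profile hc).comp hcs hmaps).eval continuousOn_const
  exact hext (f := fun q => profileQ (P q) z) (continuousOn_const.mul hPz) hRz
    (fun q hq => (main q hq).2.2 z) hq

end Family

theorem liftIoc_eq {f : ℝ → ℂ} {Q : C(AddCircle (2 * π), ℂ)} (h : ∀ z : ℝ, f z = Q z)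
    (z : AddCircle (2 * π)) : liftIoc (2 * π) 0 f z = Q z := by
  obtain ⟨x, hx, rfl⟩ : ∃ x ∈ Set.Ioc (0 : ℝ) (0 + 2 * π), (x : AddCircle (2 * π)) = z := by
    have := AddCircle.coe_image_Ioc_eq (2 * π) 0
    have hz : z ∈ (Set.univ : Set (AddCircle (2 * π))) := Set.mem_univ z
    rw [← this] at hz
    exact hz
  rw [liftIoc_coe_apply hx, h]

/-- The operator at a wave whose profile is the constructed one. -/
theorem IsScaledWave.waveHessian_spectrum {s A B p p' l k : ℝ} {c : SeqSpace} {P : ℝ → ℂ}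
    (h : IsScaledWave s A B p p' c) (hs : |s| = 1) (hsm : A ^ 2 + B ^ 2 ≤ 1 / 10000)
    (h1 : l + k = p) (h2 : k - l = p')
    (h3 : ∀ z : ℝ, profileQ P z = fourierSum (profileCoeff A B c) z) :
    IsSelfAdjoint (waveHessian s l k P) ∧ ∃ lam2 lam3 : ℝ,
      SpectralPicture (waveHessian s l k P) lam2 lam3 ∧
      lam3 < 6 ∧ (A ^ 2 + B ^ 2 ≠ 0 → lam2 < lam3) ∧ (A ^ 2 + B ^ 2 = 0 → lam2 = lam3) ∧
      (A * B ≠ 0 → lam2 < 0 ∧ 0 < lam3) ∧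
      |lam2 * lam3 + 12 * (amp ^ 2) ^ 2 * (A ^ 2 * B ^ 2)|
        ≤ 14000 * (amp ^ 2) ^ 2 * (A ^ 2 * B ^ 2 * (A ^ 2 + B ^ 2)) := by
  have hk : k = (p + p') / 2 := by linarith
  have hg : (waveHessian s l k P).graph = diagGraph bas (fun i => dispersion p p' i.2)
      (potOp s (fourierSum (profileCoeff A B c))) := by
    rw [waveHessian, hessian_graph, h1]
    exact hessianGraph_eq h.abs_p h.abs_p' hk (liftIoc_eq h3)
  obtain ⟨hsa, lam2, lam3, G, N, R, k1, k2, k3, k4, k5⟩ := h.exists_spectralPicture hs hsm hg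
  exact ⟨hsa, lam2, lam3, k1, k2.eigenvalues k3 k4 k5⟩

theorem sq_add_sq_scaled (q : ℝ × ℝ) :
    (scaled q).1 ^ 2 + (scaled q).2 ^ 2 = 10000 * (q.1 ^ 2 + q.2 ^ 2) := by
  simp only [scaled, amp]
  ring

theorem IsWaveFamily.exists_spectrum {s r : ℝ} {l k : ℝ × ℝ → ℝ} {P : ℝ × ℝ → ℝ → ℂ}
    (hF : IsWaveFamily s r l k P) (hs : |s| = 1) (hr : 0 < r) :
    ∃ ε₀ > 0, ε₀ < r ∧ ∀ q : ℝ × ℝ, ∃ lam2 lam3 : ℝ, q.1 ^ 2 + q.2 ^ 2 ≤ ε₀ ^ 2 →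
      IsSelfAdjoint (waveHessian s (l q) (k q) (P q)) ∧
      SpectralPicture (waveHessian s (l q) (k q) (P q)) lam2 lam3 ∧
      lam3 < 6 ∧ (q ≠ 0 → lam2 < lam3) ∧ (q = 0 → lam2 = lam3) ∧
      (q.1 * q.2 ≠ 0 → lam2 < 0 ∧ 0 < lam3) ∧
      |lam2 * lam3 + 12 * q.1 ^ 2 * q.2 ^ 2|
        ≤ 140000000 * (q.1 ^ 2 * q.2 ^ 2 * (q.1 ^ 2 + q.2 ^ 2)) := by
  obtain ⟨p, p', c, hp, hp', hc, hw⟩ := exists_scaledWave hs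
  obtain ⟨ρ, hρ, hρr, hρa, h⟩ := hF.exists_eq hs hr hp hp' hc hw
  have hm : 0 < min (ρ / 2) (1 / 10000) := by positivity
  have hm1 : min (ρ / 2) (1 / 10000) < ρ := (min_le_left _ _).trans_lt (by linarith)
  -- The bound `1/10000` makes the scaled amplitudes satisfy `A² + B² ≤ 10⁴ · 10⁻⁸`, and halving `ρ`
  -- makes the closed disc fit in the open one.
  refine ⟨min (ρ / 2) (1 / 10000), hm, hm1.trans_le hρr, fun q => ?_⟩
  by_cases hq : q.1 ^ 2 + q.2 ^ 2 ≤ min (ρ / 2) (1 / 10000) ^ 2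
  swap
  · exact ⟨0, 0, fun h0 => absurd h0 hq⟩
  have hqd : q ∈ disc ρ := by
    refine lt_of_le_of_lt hq ?_
    gcongr
  have hsq : q.1 ^ 2 + q.2 ^ 2 ≤ (1 / 10000) ^ 2 := by
    refine hq.trans ?_
    gcongr
    exact min_le_right _ _
  obtain ⟨f1, f2, f3⟩ := h q hqd
  have hW := hw _ (mapsTo_scaled (disc_subset hρ.le hρa hqd))
  obtain ⟨hsa, lam2, lam3, k1, k2, k3, k4, k5, k6⟩ := hW.waveHessian_spectrum hs (by
    rw [sq_add_sq_scaled]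
    linarith) f1 f2 f3
  rw [sq_add_sq_scaled] at k3 k4 k6
  have hz : 10000 * (q.1 ^ 2 + q.2 ^ 2) = 0 ↔ q = 0 := by
    constructor
    · intro h0
      have e1 : q.1 = 0 := by nlinarith [sq_nonneg q.1, sq_nonneg q.2]
      have e2 : q.2 = 0 := by nlinarith [sq_nonneg q.1, sq_nonneg q.2]
      exact Prod.ext e1 e2
    · rintro rfl
      simp
  refine ⟨lam2, lam3, fun _ => ⟨hsa, k1, k2, fun h0 => k3 (hz.not.2 h0), fun h0 => k4 (hz.2 h0),
    fun h0 => k5 ?_, ?_⟩⟩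
  · obtain ⟨h1, h2⟩ := mul_ne_zero_iff.1 h0
    exact mul_ne_zero (div_ne_zero h1 amp_pos.ne') (div_ne_zero h2 amp_pos.ne')
  · have e : (amp ^ 2) ^ 2 * ((scaled q).1 ^ 2 * (scaled q).2 ^ 2) = q.1 ^ 2 * q.2 ^ 2 := by
      simp only [scaled, amp]
      ring
    have e1 : 12 * (amp ^ 2) ^ 2 * ((scaled q).1 ^ 2 * (scaled q).2 ^ 2)
        = 12 * q.1 ^ 2 * q.2 ^ 2 := by linear_combination 12 * e
    rw [e1] at k6
    -- Unscaling `A² + B²` multiplies 14000 by `10⁴`, whereas `amp⁴ A²B²` is exactly `a²b²`.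
    refine k6.trans (le_of_eq ?_)
    linear_combination (140000000 * (q.1 ^ 2 + q.2 ^ 2)) * e

end PeriodicNLS

end

/-! ### The theorem. -/

open PeriodicNLS in
theorem propositionp (s : ℝ) (hs : s = 1 ∨ s = -1) :
    (∃ r > 0, ∃ (l k : ℝ × ℝ → ℝ) (P : ℝ × ℝ → ℝ → ℂ), IsWaveFamily s r l k P) ∧
    ∀ r > 0, ∀ (l k : ℝ × ℝ → ℝ) (P : ℝ × ℝ → ℝ → ℂ), IsWaveFamily s r l k P →
      ∃ ε₀ > 0, ε₀ < r ∧ ∃ (C : ℝ) (lam2 lam3 : ℝ × ℝ → ℝ),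
        lam2 0 = lam3 0 ∧
        ∀ a b : ℝ, a ^ 2 + b ^ 2 ≤ ε₀ ^ 2 →
          IsSelfAdjoint (waveHessian s (l (a, b)) (k (a, b)) (P (a, b))) ∧
          (∃ σ₁ : Set ℝ, σ₁ ⊆ Set.Ici 6 ∧
            PeriodicNLS.spectrum (waveHessian s (l (a, b)) (k (a, b)) (P (a, b))) =
              Complex.ofReal '' ({0, lam2 (a, b), lam3 (a, b)} ∪ σ₁)) ∧
          (∀ μ : ℝ, μ < 6 →
            Module.finrank ℂ
                (PeriodicNLS.eigenspace (waveHessian s (l (a, b)) (k (a, b)) (P (a, b))) μ) =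
              (if μ = 0 then 2 else 0) + (if μ = lam2 (a, b) then 1 else 0) +
                (if μ = lam3 (a, b) then 1 else 0)) ∧
          lam3 (a, b) < 6 ∧
          ((a, b) ≠ (0, 0) → lam2 (a, b) < lam3 (a, b)) ∧
          (a * b ≠ 0 → lam2 (a, b) < 0 ∧ 0 < lam3 (a, b)) ∧
          |lam2 (a, b) * lam3 (a, b) + 12 * a ^ 2 * b ^ 2| ≤
            C * (a ^ 2 * b ^ 2 * (a ^ 2 + b ^ 2)) := by
  have hs' : |s| = 1 := by rcases hs with rfl | rfl <;> simp
  refine ⟨?_, fun r hr l k P hF => ?_⟩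
  · obtain ⟨p, p', c, hp, hp', hc, hw⟩ := exists_scaledWave hs'
    exact ⟨amp, amp_pos, _, _, _, isWaveFamily_of_scaledWave hs' hp hp' hc hw⟩
  · obtain ⟨ε₀, hε, hεr, h⟩ := hF.exists_spectrum hs' hr
    choose lam2 lam3 hlam using h
    refine ⟨ε₀, hε, hεr, 140000000, lam2, lam3, ?_, fun a b hab => ?_⟩
    · exact (hlam 0 (by simpa using sq_nonneg ε₀)).2.2.2.2.1 rfl
    · obtain ⟨h1, ⟨h2, h3⟩, h4, h5, -, h7, h8⟩ := hlam (a, b) hab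
      exact ⟨h1, h2, h3, h4, h5, h7, h8⟩
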